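/- **Setting.** Let $\mathcal S,\mathcal A$ be finite nonempty sets and write $\mathcal P(\cdot)$ for the probability simplex. For $\mu\in\mathcal P(\mathcal S)$ let $P(\cdot\mid s,a,\mu)\in\mathcal P(\mathcal S)$ be a transition kernel, $R(s,a,\mu)\in[0,1]$ a reward, and $0<\rho<1$ a discount factor. Assume Lipschitz dependence on the mean-field: $\|P(\cdot\mid s,a,\mu)-P(\cdot\mid s,a,\mu')\|_1\le L_P\|\mu-\mu'\|_1$ and $|R(s,a,\mu)-R(s,a,\mu')|\le L_R\|\mu-\mu'\|_1$ for all $s,a$ and $\mu,\mu'\in\mathcal P(\mathcal S)$. Let $Q^*_\mu(s,a)=\sup_\pi\mathbb E\big[\sum_{n\ge0}\rho^nR(s_n,a_n,\mu)\mid s_0=s,a_0=a\big]$ (supremum over stationary randomized policies) be the optimal $Q$-function of the MDP induced by $\mu$. Let $\mathcal N\subset\mathcal P(\mathcal S)$ be a finite $\epsilon^{\rm net}$-net of $\mathcal P(\mathcal S)$ in $\|\cdot\|_1$. **Communicating MDPs.** For every $\tilde\mu\in\mathcal N$ and all $s,s'\in\mathcal S$ there is a finite horizon $H$ such that for each $n\ge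 H$ some action sequence of length $n$ leads from $s$ to $s'$ in exactly $n$ transitions with positive probability, when the mean-field is frozen at $\tilde\mu$. **Algorithm.** Parameters: $0<c_\mu\le1$, $0<c_\pi<1$, $0<\psi<1-c_\pi$, $0<\theta<\gamma<1<\zeta$, $\tfrac12<\nu\le1$, $\lambda>0$, $c_\beta$, and the episode length $T\ge1$. Set $$c^k_{\mu,t}=\frac{c_\mu}{k^\gamma t^\zeta},\qquad c^k_{\pi,t}=\frac{c_\pi}{k^\theta t^\zeta},\qquad \beta_t=\frac{c_\beta}{(t+1)^\nu}.$$ Start from $s^1_1\sim p_1$, a distribution $\mu^1_0$, a policy $\pi^1_0$ (policies map $(s,\mu)$ to $\mathcal P(\mathcal A)$), a stochastic matrix $\hat P^1_1$ and a table $Q^1_1$, all arbitrary. For $k=1,2,\dots$ and $t=1,\dots,T$: * $\mu^k_t=(1-c^k_{\mu,t})\mu^k_{t-1}+c^k_{\mu,t}(\hat P^k_t)^\top\mu^k_{t-1}$, and for $t=1$ (only) the right-hand side is replaced by a nearest point of $\mathcal N$ in $\|\cdot\|_1$ (ties broken arbitrarily); * $\pi^k_t=(1-c^k_{\pi,t})\pi^k_{t-1}+c^k_{\pi,t}\big((1-\psi)\,\mathrm{softmax}_\lambda(\cdot,Q^k_t)+\psi/|\mathcal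 A|\big)$, where $\mathrm{softmax}_\lambda(s,Q)_a=e^{\lambda Q(s,a)}/\sum_{a'}e^{\lambda Q(s,a')}$; * draw $a^k_t\sim\pi^k_t(s^k_t,\mu^k_t)$ and $s^k_{t+1}\sim P(\cdot\mid s^k_t,a^k_t,\mu^k_t)$; * $\hat P^k_{t+1}(i,j)=\dfrac{N^k_t(i,j)+1/|\mathcal S|}{\sum_{j'}N^k_t(i,j')+1}$ with $N^k_t(i,j)=|\{l\le t:\ s^k_l=i,\ s^k_{l+1}=j\}|$; * $Q^k_{t+1}(s^k_t,a^k_t)=(1-\beta_t)Q^k_t(s^k_t,a^k_t)+\beta_t\big(R(s^k_t,a^k_t,\mu^k_t)+\rho\max_aQ^k_t(s^k_{t+1},a)\big)$, all other entries of $Q^k_{t+1}$ being those of $Q^k_t$. Each episode starts with the final values of the previous one: $\hat P^{k+1}_1=\hat P^k_{T+1}$, $Q^{k+1}_1=Q^k_{T+1}$, $\mu^{k+1}_0=\mu^k_T$, $\pi^{k+1}_0=\pi^k_T$, $s^{k+1}_1=s^k_{T+1}$. **Lemma.** Assume the Lipschitz and communicating conditions. There are $\sigma\in(0,1)$, $\zeta_0>1$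 and $D>0$, depending only on the game, the net, $c_\mu$, $c_\pi$ and $\psi$, such that for all $\nu\in(\tfrac12,1]$ and $c_\beta\ge\frac1{\sigma(1-\sqrt\rho)}$ there are $C>0$ and $M\ge1$, depending in addition only on $\nu$ and $c_\beta$, with the following property. For all $\gamma,\theta,\zeta,\lambda$ as above, all initial values, all choices of the net projection, all $T\ge1$, every episode $k\ge1$ and every $\delta_Q\in(0,1)$: 1. with probability at least $1-\delta_Q$, $$\|Q^k_T-Q^*_{\mu^k_1}\|_\infty\le C\,(1+\|Q^k_1\|_\infty)\Big(T^{1-2\nu}+T^{1-\zeta-\nu}+\sqrt{\log(2T/\delta_Q)}\;T^{1/2-\nu}+2^{1-\zeta}\Big);$$ 2. if $\zeta\ge\zeta_0$, then with probability at least $1-\delta_Q$, $$\|Q^k_T-Q^*_{\mu^k_1}\|_\infty\le C\,(1+\|Q^k_1\|_\infty)\Big(T^{1-2\nu}+T^{1-\zeta-\nu}+\sqrt{\log(2T/\delta_Q)}\;T^{1/2-\nu}\Big)+D\,2^{1-\zeta}.$$ Moreover, surely $1+\|Q^k_1\|_\infty\le M^{k-1}(1+\|Q^1_1\|_\infty)$,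 a bound that does not depend on $T$, so that for each fixed episode $k$ the error is $\mathcal O(T^{1-2\nu})+\mathcal O(T^{1-\zeta-\nu})+\tilde{\mathcal O}(T^{1/2-\nu})+\mathcal O(2^{1-\zeta})$. -/

import Mathlib

open MeasureTheory

/-- A mean-field game with finite state space `S` and action space `A`: the transition kernel
`P s a μ s'` is `P(s' ∣ s, a, μ)`, the reward is `R s a μ ∈ [0, 1]`, the discount factor is `ρ`. -/
structure MeanFieldGame (S A : Type*) [Fintype S] where
  P : S → A → (S → ℝ) → S → ℝ
  R : S → A → (S → ℝ) → ℝ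
  ρ : ℝ
  P_mem : ∀ s a, ∀ μ ∈ stdSimplex ℝ S, P s a μ ∈ stdSimplex ℝ S
  R_mem : ∀ s a, ∀ μ ∈ stdSimplex ℝ S, R s a μ ∈ Set.Icc (0 : ℝ) 1
  ρ_mem : ρ ∈ Set.Ioo (0 : ℝ) 1

/-- The distance `‖μ - μ'‖₁`. -/
def l1Dist {S : Type*} [Fintype S] (μ μ' : S → ℝ) : ℝ := ∑ s, |μ s - μ' s|

namespace MeanFieldGame

/-- The kernel `P(· ∣ s, a, μ)` is Lipschitz in the mean-field. -/
def KernelLipschitz {S A : Type*} [Fintype S] (G : MeanFieldGame S A) (L : ℝ) : Prop :=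
  ∀ s a, ∀ μ ∈ stdSimplex ℝ S, ∀ μ' ∈ stdSimplex ℝ S,
    l1Dist (G.P s a μ) (G.P s a μ') ≤ L * l1Dist μ μ'

/-- The reward is Lipschitz in the mean-field. -/
def RewardLipschitz {S A : Type*} [Fintype S] (G : MeanFieldGame S A) (L : ℝ) : Prop :=
  ∀ s a, ∀ μ ∈ stdSimplex ℝ S, ∀ μ' ∈ stdSimplex ℝ S,
    |G.R s a μ - G.R s a μ'| ≤ L * l1Dist μ μ'

/-- Probability of being in `s'` after `n` transitions from `s`, when the mean-field is frozen
at `μ` and the actions `b 0, b 1, …, b (n - 1)` are played in this order. -/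
def reachProb {S A : Type*} [Fintype S] [DecidableEq S] (G : MeanFieldGame S A) (μ : S → ℝ)
    (b : ℕ → A) (s : S) : ℕ → S → ℝ
  | 0, s' => if s' = s then 1 else 0
  | n + 1, s' => ∑ j, G.reachProb μ b s n j * G.P j (b n) μ s'

/-- Communicating MDPs: for every mean-field of the net, every state can be reached from every
state, by a suitable action sequence, in every sufficiently large number of transitions. -/
def Communicating {S A : Type*} [Fintype S] [DecidableEq S] (G : MeanFieldGame S A)
    (net : Finset (S → ℝ)) : Prop :=
  ∀ μ ∈ net, ∀ s s' : S, ∃ H : ℕ, ∀ n ≥ H, ∃ b : ℕ → A, 0 < G.reachProb μ b s n s'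

/-- `𝔼[R(s_n, a_n, μ) ∣ s_0 = s, a_0 = a]` in the MDP with frozen mean-field `μ`, when the later
actions are drawn from the stationary policy `π`. -/
def expReward {S A : Type*} [Fintype S] [Fintype A] (G : MeanFieldGame S A) (μ : S → ℝ)
    (π : S → A → ℝ) : ℕ → S → A → ℝ
  | 0, s, a => G.R s a μ
  | n + 1, s, a => ∑ s', G.P s a μ s' * ∑ a', π s' a' * G.expReward μ π n s' a'

/-- The discounted return of the stationary policy `π` from the state-action pair `(s, a)`. -/
noncomputable def qPolicy {S A : Type*} [Fintype S] [Fintype A] (G : MeanFieldGame S A)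
    (μ : S → ℝ) (π : S → A → ℝ) (s : S) (a : A) : ℝ :=
  ∑' n : ℕ, G.ρ ^ n * G.expReward μ π n s a

/-- The optimal `Q`-function `Q*_μ` of the MDP induced by `μ`: the best discounted return over
stationary randomized policies. -/
noncomputable def optQ {S A : Type*} [Fintype S] [Fintype A] (G : MeanFieldGame S A)
    (μ : S → ℝ) (s : S) (a : A) : ℝ :=
  ⨆ π : {π : S → A → ℝ // ∀ s, π s ∈ stdSimplex ℝ A}, G.qPolicy μ π.1 s a

end MeanFieldGame

/-- A finite `ε`-net of the simplex, in the `ℓ¹`-norm. -/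
def IsEpsNet {S : Type*} [Fintype S] (ε : ℝ) (net : Finset (S → ℝ)) : Prop :=
  (∀ μ ∈ net, μ ∈ stdSimplex ℝ S) ∧ ∀ μ ∈ stdSimplex ℝ S, ∃ μ' ∈ net, l1Dist μ μ' ≤ ε

/-- `proj` maps each distribution to a nearest point of the net (ties broken arbitrarily). -/
def IsNetProjection {S : Type*} [Fintype S] (net : Finset (S → ℝ))
    (proj : (S → ℝ) → (S → ℝ)) : Prop :=
  ∀ μ ∈ stdSimplex ℝ S, proj μ ∈ net ∧ ∀ μ' ∈ net, l1Dist μ (proj μ) ≤ l1Dist μ μ'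

/-- The numerical parameters of the algorithm; `lam` is the softmax parameter, `ψ` the
exploration coefficient. -/
structure Schedule where
  cμ : ℝ
  cπ : ℝ
  cβ : ℝ
  γ : ℝ
  θ : ℝ
  ζ : ℝ
  ν : ℝ
  ψ : ℝ
  lam : ℝ

namespace Schedule

/-- The ranges of the parameters. -/
structure Admissible (h : Schedule) : Prop where
  cμ_mem : h.cμ ∈ Set.Ioc (0 : ℝ) 1
  cπ_mem : h.cπ ∈ Set.Ioo (0 : ℝ) 1
  ψ_mem : h.ψ ∈ Set.Ioo (0 : ℝ) (1 - h.cπ)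
  θ_pos : 0 < h.θ
  θ_lt : h.θ < h.γ
  γ_lt : h.γ < 1
  ζ_gt : 1 < h.ζ
  ν_mem : h.ν ∈ Set.Ioc (1 / 2 : ℝ) 1
  lam_pos : 0 < h.lam

/-- `c^k_{μ,t} = c_μ k^{-γ} t^{-ζ}`. -/
noncomputable def rateμ (h : Schedule) (k t : ℕ) : ℝ :=
  h.cμ / (k : ℝ) ^ h.γ * (1 / (t : ℝ) ^ h.ζ)

/-- `c^k_{π,t} = c_π k^{-θ} t^{-ζ}`. -/
noncomputable def rateπ (h : Schedule) (k t : ℕ) : ℝ :=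
  h.cπ / (k : ℝ) ^ h.θ * (1 / (t : ℝ) ^ h.ζ)

/-- `β_t = c_β (t + 1)^{-ν}`. -/
noncomputable def rateβ (h : Schedule) (t : ℕ) : ℝ := h.cβ / ((t : ℝ) + 1) ^ h.ν

end Schedule

/-- The softmax policy `softmax_λ(s, Q)`. -/
noncomputable def softmaxPolicy {S A : Type*} [Fintype A] (lam : ℝ) (Q : S → A → ℝ) (s : S)
    (a : A) : ℝ :=
  Real.exp (lam * Q s a) / ∑ a', Real.exp (lam * Q s a')

/-- What the algorithm holds at the beginning of a time step: the previous mean-field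
`μ_{t-1}` and policy `π_{t-1}` (with `pol s μ a = π(a ∣ s, μ)`), and the current estimates of the
transition matrix and of the `Q`-function. -/
structure Memory (S A : Type*) where
  mf : S → ℝ
  pol : S → (S → ℝ) → A → ℝ
  Phat : S → S → ℝ
  Q : S → A → ℝ

/-- Legal initial values: a distribution, a policy and a stochastic matrix; the initial `Q`-table
is arbitrary. -/
structure Memory.Valid {S A : Type*} [Fintype S] [Fintype A] (m : Memory S A) : Prop where
  mf_mem : m.mf ∈ stdSimplex ℝ S
  pol_mem : ∀ s, ∀ μ ∈ stdSimplex ℝ S, m.pol s μ ∈ stdSimplex ℝ A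
  Phat_mem : ∀ i, m.Phat i ∈ stdSimplex ℝ S

namespace Memory

/-- The mean-field used at step `t` of episode `k`; it is projected on the net iff `t = 1`. -/
noncomputable def nextMF {S A : Type*} [Fintype S] (h : Schedule) (proj : (S → ℝ) → (S → ℝ))
    (k t : ℕ) (m : Memory S A) : S → ℝ :=
  let mix : S → ℝ := fun s' =>
    (1 - h.rateμ k t) * m.mf s' + h.rateμ k t * ∑ s, m.Phat s s' * m.mf s
  if t = 1 then proj mix else mix

/-- The policy used at step `t` of episode `k`. -/
noncomputable def nextPol {S A : Type*} [Fintype A] (h : Schedule) (k t : ℕ) (m : Memory S A) :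
    S → (S → ℝ) → A → ℝ := fun s μ a =>
  (1 - h.rateπ k t) * m.pol s μ a +
    h.rateπ k t * ((1 - h.ψ) * softmaxPolicy h.lam m.Q s a + h.ψ * (1 / (Fintype.card A : ℝ)))

end Memory

/-- The asynchronous `Q`-learning update with step size `β`, after the transition from `s` to `s'`
under action `a` with reward `r`. -/
noncomputable def qUpdate {S A : Type*} [DecidableEq S] [DecidableEq A] (ρ β : ℝ)
    (Q : S → A → ℝ) (s : S) (a : A) (r : ℝ) (s' : S) : S → A → ℝ := fun i b =>
  if i = s ∧ b = a then (1 - β) * Q s a + β * (r + ρ * ⨆ a', Q s' a') else Q i b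

/-- One instance of the algorithm. Its clock counts the time steps of all episodes in a row
from `0`: with episodes of length `T`, step `t` of episode `k` (both counted from `1`) happens at
clock time `n = (k - 1) * T + (t - 1)`. The state `s^1_1` has law `p₁`. -/
structure Sandbox (S A : Type*) [Fintype S] where
  game : MeanFieldGame S A
  sched : Schedule
  proj : (S → ℝ) → (S → ℝ)
  T : ℕ
  p₁ : S → ℝ
  init : Memory S A

namespace Sandbox

/-- Episode of the clock time `n`. -/
def ep {S A : Type*} [Fintype S] (X : Sandbox S A) (n : ℕ) : ℕ := n / X.T + 1

/-- Time step, inside its episode, of the clock time `n`. -/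
def st {S A : Type*} [Fintype S] (X : Sandbox S A) (n : ℕ) : ℕ := n % X.T + 1

/-- Clock time of step `t` of episode `k`. -/
def clock {S A : Type*} [Fintype S] (X : Sandbox S A) (k t : ℕ) : ℕ := (k - 1) * X.T + (t - 1)

/-- The number `N^k_t(i, j)` of transitions from `i` to `j` in the current episode, including
the transition that starts at clock time `n`. -/
def visits {S A : Type*} [Fintype S] [DecidableEq S] (X : Sandbox S A) (x : ℕ → S) (n : ℕ)
    (i j : S) : ℕ :=
  ((Finset.Icc (n / X.T * X.T) n).filter fun l => x l = i ∧ x (l + 1) = j).card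

/-- The algorithm's memory at clock time `n`, along the state sequence `x` and the action
sequence `y` (it depends only on `x 0, …, x n` and `y 0, …, y (n - 1)`). -/
noncomputable def mem {S A : Type*} [Fintype S] [DecidableEq S] [Fintype A] [DecidableEq A]
    (X : Sandbox S A) (x : ℕ → S) (y : ℕ → A) : ℕ → Memory S A
  | 0 => X.init
  | n + 1 =>
    let m := X.mem x y n
    let μ := m.nextMF X.sched X.proj (X.ep n) (X.st n)
    { mf := μ
      pol := m.nextPol X.sched (X.ep n) (X.st n)
      Phat := fun i j => ((X.visits x n i j : ℝ) + 1 / (Fintype.card S : ℝ)) /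
        (((∑ j', X.visits x n i j' : ℕ) : ℝ) + 1)
      Q := qUpdate X.game.ρ (X.sched.rateβ (X.st n)) m.Q (x n) (y n)
        (X.game.R (x n) (y n) μ) (x (n + 1)) }

/-- The mean-field in force at clock time `n`. -/
noncomputable def mfAt {S A : Type*} [Fintype S] [DecidableEq S] [Fintype A] [DecidableEq A]
    (X : Sandbox S A) (x : ℕ → S) (y : ℕ → A) (n : ℕ) : S → ℝ :=
  (X.mem x y n).nextMF X.sched X.proj (X.ep n) (X.st n)

/-- The policy in force at clock time `n`. -/
noncomputable def polAt {S A : Type*} [Fintype S] [DecidableEq S] [Fintype A] [DecidableEq A]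
    (X : Sandbox S A) (x : ℕ → S) (y : ℕ → A) (n : ℕ) : S → (S → ℝ) → A → ℝ :=
  (X.mem x y n).nextPol X.sched (X.ep n) (X.st n)

/-- The probability of the states `x 0, …, x n` and actions `y 0, …, y (n - 1)`: the initial
state has law `p₁`, the action at time `m` has law `π_m(s_m, μ_m)`, and the next state has law
`P(· ∣ s_m, a_m, μ_m)`, where `π_m` and `μ_m` are computed by the algorithm from the past. -/
noncomputable def pathProb {S A : Type*} [Fintype S] [DecidableEq S] [Fintype A] [DecidableEq A]
    (X : Sandbox S A) (x : ℕ → S) (y : ℕ → A) (n : ℕ) : ℝ :=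
  X.p₁ (x 0) * ∏ m ∈ Finset.range n,
    (X.polAt x y m (x m) (X.mfAt x y m) (y m) *
      X.game.P (x m) (y m) (X.mfAt x y m) (x (m + 1)))

/-- The random states `s n` and actions `a n` form a sample path of the algorithm, i.e. they have
the finite-dimensional laws given by `pathProb`. -/
structure IsRun {S A : Type*} [Fintype S] [DecidableEq S] [Fintype A] [DecidableEq A]
    {Ω : Type*} [MeasurableSpace Ω] (X : Sandbox S A) (ℙ : Measure Ω)
    (s : ℕ → Ω → S) (a : ℕ → Ω → A) : Prop where
  meas_s : ∀ n i, MeasurableSet {ω | s n ω = i}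
  meas_a : ∀ n b, MeasurableSet {ω | a n ω = b}
  law : ∀ (n : ℕ) (x : ℕ → S) (y : ℕ → A),
    ℙ.real {ω | (∀ m ≤ n, s m ω = x m) ∧ ∀ m < n, a m ω = y m} = X.pathProb x y n

/-- The random table `Q^k_t`. -/
noncomputable def Qtab {S A : Type*} [Fintype S] [DecidableEq S] [Fintype A] [DecidableEq A]
    {Ω : Type*} (X : Sandbox S A) (s : ℕ → Ω → S) (a : ℕ → Ω → A) (k t : ℕ) (ω : Ω) :
    S → A → ℝ :=
  (X.mem (fun n => s n ω) (fun n => a n ω) (X.clock k t)).Q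

/-- The random mean-field `μ^k_t`. -/
noncomputable def meanField {S A : Type*} [Fintype S] [DecidableEq S] [Fintype A]
    [DecidableEq A] {Ω : Type*} (X : Sandbox S A) (s : ℕ → Ω → S) (a : ℕ → Ω → A) (k t : ℕ)
    (ω : Ω) : S → ℝ :=
  X.mfAt (fun n => s n ω) (fun n => a n ω) (X.clock k t)

/-- The estimation error `‖Q^k_T - Q*_{μ^k_1}‖_∞` of episode `k` (the norm on `S → A → ℝ` is
the supremum norm). -/
noncomputable def qError {S A : Type*} [Fintype S] [DecidableEq S] [Fintype A] [DecidableEq A]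
    {Ω : Type*} (X : Sandbox S A) (s : ℕ → Ω → S) (a : ℕ → Ω → A) (k : ℕ) (ω : Ω) : ℝ :=
  ‖X.Qtab s a k X.T ω - X.game.optQ (X.meanField s a k 1 ω)‖

end Sandbox

/-! Fix an episode and freeze the MDP at its first mean-field μ, a point of the net. By
`bellman_optQ`, the function Q*_μ is a fixed point of the Bellman operator. By `error_step`, every
coordinate of the error then satisfies e_{l+1} = (1 - v_l) e_l + v_l g_l + ξ_l. Here v_l is the step
size if that state-action pair is the one updated, and 0 otherwise; |g_l| ≤ ρ ‖e_l‖ + ε; and ξ_l is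
a martingale difference. The bias ε comes from later mean-fields moving away from μ. For ζ ≥ 2 this
drift is at most 4 · 2^{1-ζ} (`l1Dist_mfAt_le`), which gives the D-term.

Noise. Adding to e_l the noise still to come, W_l = Σ_{j≥l} ξ_j, makes the recursion noise-free at
the price of |W_l|. Azuma–Hoeffding and a union bound over all windows
(`measure_exists_window_ge_le`) bound these sums by a multiple of u_l = √log(2T/δ) · (l+1)^{1/2-ν}.

Visits. Each pair must be updated often enough on every window, and no mixing estimate is needed for
this. Exploration keeps action probabilities above π₀ = c_π ψ / |A|. If the mean-field stays close
to μ, the true one-step kernel dominates a matrix M with entry κ wherever a transition is possible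
at μ. The function f = Σ_{n<H} M^n(·, z) satisfies f - M f = 1_z - M^H(·, z), and communication
gives M^H ≥ κ^H. So the conditional drift of f counts visits (`le_stepMean_visitPotential`): the
weighted visits on a window are at least π₀ κ^H Σ β, up to a boundary term and a martingale.

Contraction. The lower bound on c_β makes these weights exceed p/(l+1) on every window, up to an
additive constant, with p large compared with 1/(1-ρ). Each coordinate then relaxes faster than u
decays, and `asynchronous_contraction` shows that the error follows u. `episode_bound` combines
these facts; while u is still bounded below, a crude bound on the table suffices.

For ζ ≥ ζ₀ this proves the second claim, and the first follows. For ζ < ζ₀ the first claim is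
deterministic, because 2^{1-ζ} is bounded below. The terms T^{1-2ν} and T^{1-ζ-ν} enter only as
nonnegative slack. -/

set_option linter.unusedSectionVars false

/-! ### Path functions, prefixes and one-step conditional means -/

section PathSpace

variable {S A : Type*}

/-- The path function `f` depends only on `x 0, …, x n` and `y 0, …, y (n - 1)`. -/
def DependsOnPrefix {β : Type*} (n : ℕ) (f : (ℕ → S) → (ℕ → A) → β) : Prop :=
  ∀ x x' y y', (∀ m ≤ n, x m = x' m) → (∀ m < n, y m = y' m) → f x y = f x' y'

theorem DependsOnPrefix.mono {β : Type*} {m n : ℕ} {f : (ℕ → S) → (ℕ → A) → β}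
    (hf : DependsOnPrefix m f) (h : m ≤ n) : DependsOnPrefix n f :=
  fun x x' y y' hx hy => hf x x' y y' (fun l hl => hx l (hl.trans h))
    (fun l hl => hy l (hl.trans_le h))

variable [Fintype S] [DecidableEq S] [Fintype A] [DecidableEq A]

namespace Sandbox

theorem visits_congr (X : Sandbox S A) {n : ℕ} {x x' : ℕ → S} (hx : ∀ m ≤ n + 1, x m = x' m) :
    X.visits x n = X.visits x' n := by
  funext i j
  unfold visits
  congr 1
  apply Finset.filter_congr
  intro l hl
  rw [Finset.mem_Icc] at hl
  rw [hx l (by omega), hx (l + 1) (by omega)]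

theorem mem_dependsOnPrefix (X : Sandbox S A) (n : ℕ) :
    DependsOnPrefix n (fun x y => X.mem x y n) := by
  induction n with
  | zero => intro x x' y y' _ _; rfl
  | succ n ih =>
    intro x x' y y' hx hy
    have hm : X.mem x y n = X.mem x' y' n :=
      ih x x' y y' (fun m hm => hx m (by omega)) (fun m hm => hy m (by omega))
    have hv := X.visits_congr hx
    simp only [mem]
    rw [hm, hv, hx n (by omega), hx (n + 1) le_rfl, hy n (by omega)]

theorem mfAt_dependsOnPrefix (X : Sandbox S A) (n : ℕ) :
    DependsOnPrefix n (fun x y => X.mfAt x y n) := by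
  intro x x' y y' hx hy
  have := X.mem_dependsOnPrefix n x x' y y' hx hy
  simp only [mfAt] at *
  rw [this]

theorem polAt_dependsOnPrefix (X : Sandbox S A) (n : ℕ) :
    DependsOnPrefix n (fun x y => X.polAt x y n) := by
  intro x x' y y' hx hy
  have := X.mem_dependsOnPrefix n x x' y y' hx hy
  simp only [polAt] at *
  rw [this]

/-- Conditional probability of the action `b` and the next state `j` at clock time `n`. -/
noncomputable def stepProb (X : Sandbox S A) (x : ℕ → S) (y : ℕ → A) (n : ℕ) (b : A) (j : S) : ℝ :=
  X.polAt x y n (x n) (X.mfAt x y n) b * X.game.P (x n) b (X.mfAt x y n) j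

theorem stepProb_dependsOnPrefix (X : Sandbox S A) (n : ℕ) :
    DependsOnPrefix n (fun x y => X.stepProb x y n) := by
  intro x x' y y' hx hy
  have h1 := X.mfAt_dependsOnPrefix n x x' y y' hx hy
  have h2 := X.polAt_dependsOnPrefix n x x' y y' hx hy
  funext b j
  simp only at h1 h2
  simp only [stepProb, h1, h2, hx n le_rfl]

theorem pathProb_succ (X : Sandbox S A) (x : ℕ → S) (y : ℕ → A) (n : ℕ) :
    X.pathProb x y (n + 1) = X.pathProb x y n * X.stepProb x y n (y n) (x (n + 1)) := by
  simp only [pathProb, stepProb, Finset.prod_range_succ, mul_assoc]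

theorem pathProb_dependsOnPrefix (X : Sandbox S A) (n : ℕ) :
    DependsOnPrefix n (fun x y => X.pathProb x y n) := by
  induction n with
  | zero => intro x x' y y' hx _; simp [pathProb, hx 0 le_rfl]
  | succ n ih =>
    intro x x' y y' hx hy
    have h1 := ih x x' y y' (fun m hm => hx m (by omega)) (fun m hm => hy m (by omega))
    have h2 := X.stepProb_dependsOnPrefix n x x' y y' (fun m hm => hx m (by omega))
      (fun m hm => hy m (by omega))
    simp only at h1 h2
    simp only [pathProb_succ, h1, h2, hx (n + 1) le_rfl, hy n (by omega)]

/-- The algorithm draws actions and states from probability vectors. -/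
def IsStochastic (X : Sandbox S A) : Prop :=
  ∀ x y n, (∀ b j, 0 ≤ X.stepProb x y n b j) ∧ ∑ b, ∑ j, X.stepProb x y n b j = 1

/-- Conditional expectation of the path function `f` given the past of clock time `n`, when `f`
depends on the path up to the state at time `n + 1`. -/
noncomputable def stepMean (X : Sandbox S A) (n : ℕ) (f : (ℕ → S) → (ℕ → A) → ℝ) (x : ℕ → S)
    (y : ℕ → A) : ℝ :=
  ∑ b, ∑ j, X.stepProb x y n b j * f (Function.update x (n + 1) j) (Function.update y n b)

theorem update_dependsOnPrefix {β : Type*} {n : ℕ} {f : (ℕ → S) → (ℕ → A) → β}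
    (hf : DependsOnPrefix (n + 1) f) (b : A) (j : S) :
    DependsOnPrefix n (fun x y => f (Function.update x (n + 1) j) (Function.update y n b)) := by
  intro x x' y y' hx hy
  apply hf
  · intro m hm
    by_cases h : m = n + 1
    · subst h; simp
    · simp [Function.update_of_ne h, hx m (by omega)]
  · intro m hm
    by_cases h : m = n
    · subst h; simp
    · simp [Function.update_of_ne h, hy m (by omega)]

theorem stepMean_dependsOnPrefix (X : Sandbox S A) {n : ℕ} {f : (ℕ → S) → (ℕ → A) → ℝ}
    (hf : DependsOnPrefix (n + 1) f) : DependsOnPrefix n (X.stepMean n f) := by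
  intro x x' y y' hx hy
  have h2 := X.stepProb_dependsOnPrefix n x x' y y' hx hy
  simp only at h2
  simp only [stepMean, h2]
  refine Finset.sum_congr rfl fun b _ => Finset.sum_congr rfl fun j _ => ?_
  rw [show f (Function.update x (n + 1) j) (Function.update y n b) = _ from
    update_dependsOnPrefix hf b j x x' y y' hx hy]

end Sandbox

section Extension

variable [Nonempty A]

/-- Extension of a state prefix to an infinite sequence. -/
def extendState (n : ℕ) (p : Fin (n + 1) → S) : ℕ → S := fun m => p ⟨min m n, by omega⟩

/-- Extension of an action prefix to an infinite sequence. -/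
noncomputable def extendAction (n : ℕ) (q : Fin n → A) : ℕ → A := fun m =>
  if h : m < n then q ⟨m, h⟩ else Classical.arbitrary A

theorem extendState_restrict (n : ℕ) (x : ℕ → S) (m : ℕ) (hm : m ≤ n) :
    extendState n (fun l : Fin (n + 1) => x l) m = x m := by
  simp [extendState, hm]

theorem extendAction_restrict (n : ℕ) (y : ℕ → A) (m : ℕ) (hm : m < n) :
    extendAction n (fun l : Fin n => y l) m = y m := by
  simp [extendAction, hm]

end Extension

/-! ### Integrals of path functions and the tower property -/

namespace Sandbox.IsRun

variable [Nonempty A] {Ω : Type*} [MeasurableSpace Ω] {X : Sandbox S A} {ℙ : Measure Ω}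
  {s : ℕ → Ω → S} {a : ℕ → Ω → A}

/-- The event that the path has the prefix `x 0, …, x n`, `y 0, …, y (n - 1)`. -/
def cyl {Ω : Type*} (s : ℕ → Ω → S) (a : ℕ → Ω → A) (x : ℕ → S) (y : ℕ → A) (n : ℕ) : Set Ω :=
  {ω | (∀ m ≤ n, s m ω = x m) ∧ ∀ m < n, a m ω = y m}

theorem measurableSet_cyl (hr : X.IsRun ℙ s a) (x : ℕ → S) (y : ℕ → A) (n : ℕ) :
    MeasurableSet (cyl s a x y n) := by
  have : cyl s a x y n = (⋂ m ∈ Finset.range (n + 1), {ω | s m ω = x m}) ∩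
      ⋂ m ∈ Finset.range n, {ω | a m ω = y m} := by
    ext ω
    simp [cyl]
  rw [this]
  exact (Finset.measurableSet_biInter _ fun m _ => hr.meas_s m _).inter
    (Finset.measurableSet_biInter _ fun m _ => hr.meas_a m _)

/-- Exactly one of the finitely many prefixes is realized at ω. This reduces integrals of prefix
functions to finite sums of cylinder probabilities, the only data that `IsRun` provides. -/
theorem indicator_eq_sum {n : ℕ} {G : (ℕ → S) → (ℕ → A) → ℝ} (hG : DependsOnPrefix n G)
    (E : Set Ω) (ω : Ω) :
    E.indicator (fun ω => G (fun m => s m ω) (fun m => a m ω)) ω =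
      ∑ p : (Fin (n + 1) → S) × (Fin n → A),
        (cyl s a (extendState n p.1) (extendAction n p.2) n ∩ E).indicator
          (fun _ => G (extendState n p.1) (extendAction n p.2)) ω := by
  rw [Finset.sum_eq_single (fun l : Fin (n + 1) => s l ω, fun l : Fin n => a l ω)]
  · have hmem : ω ∈ cyl s a (extendState n fun l : Fin (n + 1) => s l ω)
        (extendAction n fun l : Fin n => a l ω) n :=
      ⟨fun m hm => (extendState_restrict n (fun m => s m ω) m hm).symm,
        fun m hm => (extendAction_restrict n (fun m => a m ω) m hm).symm⟩
    by_cases hE : ω ∈ E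
    · rw [Set.indicator_of_mem hE, Set.indicator_of_mem (show _ ∈ _ ∩ _ from ⟨hmem, hE⟩)]
      exact hG _ _ _ _ hmem.1 hmem.2
    · rw [Set.indicator_of_notMem hE, Set.indicator_of_notMem (fun h => hE h.2)]
  · intro p _ hp
    apply Set.indicator_of_notMem
    rintro ⟨⟨h1, h2⟩, -⟩
    apply hp
    refine Prod.ext (funext fun l => ?_) (funext fun l => ?_)
    · have := h1 l (Nat.lt_succ_iff.1 l.2)
      simp only [extendState] at this
      change p.1 l = s l ω
      rw [this]
      exact congrArg p.1 (Fin.ext (by simp [Nat.lt_succ_iff.1 l.2]))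
    · have := h2 l l.2
      simp only [extendAction, l.2, dif_pos] at this
      simp [this]
  · simp

variable [IsProbabilityMeasure ℙ]

theorem integrable_prefix (hr : X.IsRun ℙ s a) {n : ℕ} {G : (ℕ → S) → (ℕ → A) → ℝ}
    (hG : DependsOnPrefix n G) {E : Set Ω} (hE : MeasurableSet E) :
    Integrable (E.indicator fun ω => G (fun m => s m ω) (fun m => a m ω)) ℙ := by
  rw [show (E.indicator fun ω => G (fun m => s m ω) (fun m => a m ω)) = _ from
    funext (indicator_eq_sum hG E)]
  refine integrable_finsetSum _ fun p _ => ?_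
  exact (integrable_const _).indicator ((hr.measurableSet_cyl _ _ _).inter hE)

theorem integral_prefix (hr : X.IsRun ℙ s a) {n : ℕ} {G : (ℕ → S) → (ℕ → A) → ℝ}
    (hG : DependsOnPrefix n G) {E : Set Ω} (hE : MeasurableSet E) :
    ∫ ω, E.indicator (fun ω => G (fun m => s m ω) (fun m => a m ω)) ω ∂ℙ =
      ∑ p : (Fin (n + 1) → S) × (Fin n → A),
        ℙ.real (cyl s a (extendState n p.1) (extendAction n p.2) n ∩ E) *
          G (extendState n p.1) (extendAction n p.2) := by
  rw [integral_congr_ae (Filter.Eventually.of_forall (indicator_eq_sum hG E)),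
    integral_finsetSum]
  · refine Finset.sum_congr rfl fun p _ => ?_
    rw [integral_indicator_const _ ((hr.measurableSet_cyl _ _ _).inter hE), smul_eq_mul]
  · intro p _
    exact (integrable_const _).indicator ((hr.measurableSet_cyl _ _ _).inter hE)

theorem measurableSet_step (hr : X.IsRun ℙ s a) (n : ℕ) (b : A) (j : S) :
    MeasurableSet {ω | a n ω = b ∧ s (n + 1) ω = j} :=
  (hr.meas_a n b).inter (hr.meas_s (n + 1) j)

/-- Intersecting a cylinder with one prescribed step gives a cylinder one step longer, whose
probability picks up the factor `stepProb` by `pathProb_succ`. -/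
theorem integral_step_indicator (hr : X.IsRun ℙ s a) {n : ℕ} {G : (ℕ → S) → (ℕ → A) → ℝ}
    (hG : DependsOnPrefix n G) (b : A) (j : S) :
    ∫ ω, Set.indicator {ω | a n ω = b ∧ s (n + 1) ω = j}
        (fun ω => G (fun m => s m ω) (fun m => a m ω)) ω ∂ℙ =
      ∫ ω, X.stepProb (fun m => s m ω) (fun m => a m ω) n b j *
        G (fun m => s m ω) (fun m => a m ω) ∂ℙ := by
  have hK : DependsOnPrefix n (fun x y => X.stepProb x y n b j * G x y) := by
    intro x x' y y' hx hy
    have h1 := X.stepProb_dependsOnPrefix n x x' y y' hx hy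
    simp only at h1
    simp only [h1, hG x x' y y' hx hy]
  have h2 := hr.integral_prefix hK MeasurableSet.univ
  simp only [Set.indicator_univ, Set.inter_univ] at h2
  rw [h2, hr.integral_prefix hG (hr.measurableSet_step n b j)]
  refine Finset.sum_congr rfl fun p _ => ?_
  set x := extendState n p.1
  set y := extendAction n p.2
  have hu : ∀ m ≤ n, Function.update x (n + 1) j m = x m := fun m hm =>
    Function.update_of_ne (by omega) _ _
  have hv : ∀ m < n, Function.update y n b m = y m := fun m hm =>
    Function.update_of_ne (by omega) _ _
  have hset : cyl s a x y n ∩ {ω | a n ω = b ∧ s (n + 1) ω = j} =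
      cyl s a (Function.update x (n + 1) j) (Function.update y n b) (n + 1) := by
    ext ω
    constructor
    · rintro ⟨⟨h1, h2⟩, h3, h4⟩
      refine ⟨fun m hm => ?_, fun m hm => ?_⟩
      · rcases Nat.lt_or_ge n m with h | h
        · obtain rfl : m = n + 1 := by omega
          simp [h4]
        · rw [hu m h, h1 m h]
      · rcases Nat.lt_or_ge m n with h | h
        · rw [hv m h, h2 m h]
        · obtain rfl : m = n := by omega
          simp [h3]
    · rintro ⟨h1, h2⟩
      refine ⟨⟨fun m hm => ?_, fun m hm => ?_⟩, ?_, ?_⟩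
      · rw [h1 m (by omega), hu m hm]
      · rw [h2 m (by omega), hv m hm]
      · simpa using h2 n (by omega)
      · simpa using h1 (n + 1) le_rfl
  have l1 := hr.law (n + 1) (Function.update x (n + 1) j) (Function.update y n b)
  have l2 := hr.law n x y
  have e1 := X.pathProb_dependsOnPrefix n _ x _ y hu hv
  have e2 := X.stepProb_dependsOnPrefix n _ x _ y hu hv
  simp only at e1 e2
  rw [pathProb_succ, e1, e2, ← l2] at l1
  rw [hset]
  simp only [cyl, Function.update_self] at *
  rw [l1, mul_assoc]

/-- The tower property; it lets finite sums replace measure-theoretic conditional expectations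
throughout. -/
theorem integral_stepMean (hr : X.IsRun ℙ s a) {n : ℕ} {f : (ℕ → S) → (ℕ → A) → ℝ}
    (hf : DependsOnPrefix (n + 1) f) :
    ∫ ω, f (fun m => s m ω) (fun m => a m ω) ∂ℙ =
      ∫ ω, X.stepMean n f (fun m => s m ω) (fun m => a m ω) ∂ℙ := by
  have hK (b : A) (j : S) : Integrable (fun ω =>
      X.stepProb (fun m => s m ω) (fun m => a m ω) n b j *
        f (Function.update (fun m => s m ω) (n + 1) j) (Function.update (fun m => a m ω) n b)) ℙ := by
    have hK : DependsOnPrefix n (fun x y => X.stepProb x y n b j *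
        f (Function.update x (n + 1) j) (Function.update y n b)) := by
      intro x x' y y' hx hy
      have h1 := X.stepProb_dependsOnPrefix n x x' y y' hx hy
      have h2 := update_dependsOnPrefix hf b j x x' y y' hx hy
      simp only at h1 h2
      simp only [h1, h2]
    simpa using hr.integrable_prefix hK MeasurableSet.univ
  have hpt : ∀ ω, f (fun m => s m ω) (fun m => a m ω) =
      ∑ b, ∑ j, Set.indicator {ω | a n ω = b ∧ s (n + 1) ω = j} (fun ω =>
        (fun x y => f (Function.update x (n + 1) j) (Function.update y n b))
          (fun m => s m ω) (fun m => a m ω)) ω := by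
    intro ω
    rw [Finset.sum_eq_single (a n ω), Finset.sum_eq_single (s (n + 1) ω)]
    · rw [Set.indicator_of_mem (show ω ∈ {ω' | a n ω' = a n ω ∧ s (n + 1) ω' = s (n + 1) ω} from
        ⟨rfl, rfl⟩)]
      simp only
      rw [Function.update_eq_self_iff.2 rfl, Function.update_eq_self_iff.2 rfl]
    · intro j _ hj
      exact Set.indicator_of_notMem (fun h => hj h.2.symm) _
    · simp
    · intro b _ hb
      exact Finset.sum_eq_zero fun j _ => Set.indicator_of_notMem (fun h => hb h.1.symm) _
    · simp
  rw [integral_congr_ae (Filter.Eventually.of_forall hpt), integral_finsetSum]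
  · simp only [stepMean]
    rw [integral_finsetSum]
    · refine Finset.sum_congr rfl fun b _ => ?_
      rw [integral_finsetSum, integral_finsetSum]
      · refine Finset.sum_congr rfl fun j _ => ?_
        exact hr.integral_step_indicator (update_dependsOnPrefix hf b j) b j
      · intro j _
        exact hK b j
      · intro j _
        exact hr.integrable_prefix (update_dependsOnPrefix hf b j) (hr.measurableSet_step n b j)
    · intro b _
      refine integrable_finsetSum _ fun j _ => ?_
      exact hK b j
  · intro b _
    refine integrable_finsetSum _ fun j _ => ?_
    exact hr.integrable_prefix (update_dependsOnPrefix hf b j) (hr.measurableSet_step n b j)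

end Sandbox.IsRun

/-! ### Azuma–Hoeffding on path space -/

namespace Sandbox

/-- By convexity the exponential lies below its chord over [-lc, lc]. -/
theorem exp_le_cosh_add_sinh {c u l : ℝ} (hc : 0 < c) (hu : |u| ≤ c) :
    Real.exp (l * u) ≤ Real.cosh (l * c) + u / c * Real.sinh (l * c) := by
  have hu' := abs_le.1 hu
  have h1 : 0 ≤ (1 + u / c) / 2 := by
    have : -1 ≤ u / c := by rw [le_div_iff₀ hc]; linarith
    linarith
  have h2 : 0 ≤ (1 - u / c) / 2 := by
    have : u / c ≤ 1 := by rw [div_le_iff₀ hc]; linarith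
    linarith
  have h := convexOn_exp.2 (Set.mem_univ (l * c)) (Set.mem_univ (-(l * c))) h1 h2 (by ring)
  simp only [smul_eq_mul] at h
  have e : (1 + u / c) / 2 * (l * c) + (1 - u / c) / 2 * -(l * c) = l * u := by
    field_simp
    ring
  rw [e] at h
  rw [Real.cosh_eq, Real.sinh_eq]
  linarith

/-- Hoeffding's lemma for one step: the linear part of the chord has mean zero, and cosh t ≤
exp(t²/2). -/
theorem stepMean_exp_le {X : Sandbox S A} (hX : X.IsStochastic) {n : ℕ}
    {f : (ℕ → S) → (ℕ → A) → ℝ} {c : ℝ} (hc : 0 < c) (hf : ∀ x y, |f x y| ≤ c) (l : ℝ)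
    (x : ℕ → S) (y : ℕ → A) (h0 : X.stepMean n f x y = 0) :
    X.stepMean n (fun x y => Real.exp (l * f x y)) x y ≤ Real.exp (l ^ 2 * c ^ 2 / 2) := by
  obtain ⟨hnn, hsum⟩ := hX x y n
  calc X.stepMean n (fun x y => Real.exp (l * f x y)) x y
      ≤ ∑ b, ∑ j, X.stepProb x y n b j * (Real.cosh (l * c) +
          f (Function.update x (n + 1) j) (Function.update y n b) / c * Real.sinh (l * c)) := by
        unfold stepMean
        exact Finset.sum_le_sum fun b _ => Finset.sum_le_sum fun j _ =>
          mul_le_mul_of_nonneg_left (exp_le_cosh_add_sinh hc (hf _ _)) (hnn b j)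
    _ = (∑ b, ∑ j, X.stepProb x y n b j) * Real.cosh (l * c) +
          X.stepMean n f x y / c * Real.sinh (l * c) := by
        simp only [stepMean, Finset.sum_mul, Finset.sum_div, ← Finset.sum_add_distrib]
        refine Finset.sum_congr rfl fun b _ => Finset.sum_congr rfl fun j _ => ?_
        ring
    _ = Real.cosh (l * c) := by rw [hsum, h0]; simp
    _ ≤ Real.exp (l ^ 2 * c ^ 2 / 2) := by
        have := Real.cosh_le_exp_half_sq (l * c)
        rwa [mul_pow] at this

namespace IsRun
variable [Nonempty A] {Ω : Type*} [MeasurableSpace Ω] {X : Sandbox S A} {ℙ : Measure Ω}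
  {s : ℕ → Ω → S} {a : ℕ → Ω → A} [IsProbabilityMeasure ℙ]

theorem sum_dependsOnPrefix {f : ℕ → (ℕ → S) → (ℕ → A) → ℝ} {m n : ℕ}
    (hf : ∀ l, m ≤ l → l < n → DependsOnPrefix (l + 1) (f l)) :
    DependsOnPrefix n (fun x y => ∑ l ∈ Finset.Ico m n, f l x y) := by
  intro x x' y y' hx hy
  refine Finset.sum_congr rfl fun l hl => ?_
  rw [Finset.mem_Ico] at hl
  exact (hf l hl.1 hl.2).mono hl.2 x x' y y' hx hy

/-- Exponential moments of a martingale with bounded increments. -/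
theorem integral_exp_sum_le (hr : X.IsRun ℙ s a) (hX : X.IsStochastic) (m n : ℕ) (hmn : m ≤ n)
    {f : ℕ → (ℕ → S) → (ℕ → A) → ℝ} {c : ℕ → ℝ}
    (hf : ∀ l, m ≤ l → l < n → DependsOnPrefix (l + 1) (f l))
    (hc : ∀ l, m ≤ l → l < n → 0 < c l) (hfc : ∀ l, m ≤ l → l < n → ∀ x y, |f l x y| ≤ c l)
    (h0 : ∀ l, m ≤ l → l < n → ∀ x y, X.stepMean l (f l) x y = 0) (r : ℝ) :
    ∫ ω, Real.exp (r * ∑ l ∈ Finset.Ico m n, f l (fun m => s m ω) (fun m => a m ω)) ∂ℙ ≤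
      Real.exp (r ^ 2 * (∑ l ∈ Finset.Ico m n, c l ^ 2) / 2) := by
  induction n, hmn using Nat.le_induction with
  | base => simp
  | succ n hmn ih =>
    have ih' := ih (fun l h1 h2 => hf l h1 (by omega)) (fun l h1 h2 => hc l h1 (by omega))
      (fun l h1 h2 => hfc l h1 (by omega)) (fun l h1 h2 => h0 l h1 (by omega))
    have hG : DependsOnPrefix n (fun x y => Real.exp (r * ∑ l ∈ Finset.Ico m n, f l x y)) := by
      intro x x' y y' hx hy
      have := sum_dependsOnPrefix (fun l h1 h2 => hf l h1 (Nat.lt_succ_of_lt h2)) x x' y y' hx hy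
      simp only at this ⊢
      rw [this]
    have hF : DependsOnPrefix (n + 1)
        (fun x y => Real.exp (r * ∑ l ∈ Finset.Ico m (n + 1), f l x y)) := by
      intro x x' y y' hx hy
      have := sum_dependsOnPrefix hf x x' y y' hx hy
      simp only at this ⊢
      rw [this]
    rw [hr.integral_stepMean hF]
    have hpt : ∀ x y, X.stepMean n
        (fun x y => Real.exp (r * ∑ l ∈ Finset.Ico m (n + 1), f l x y)) x y ≤
        Real.exp (r ^ 2 * c n ^ 2 / 2) * Real.exp (r * ∑ l ∈ Finset.Ico m n, f l x y) := by
      intro x y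
      have e : X.stepMean n
          (fun x y => Real.exp (r * ∑ l ∈ Finset.Ico m (n + 1), f l x y)) x y =
          X.stepMean n (fun x y => Real.exp (r * f n x y)) x y *
            Real.exp (r * ∑ l ∈ Finset.Ico m n, f l x y) := by
        simp only [stepMean, Finset.sum_mul]
        refine Finset.sum_congr rfl fun b _ => Finset.sum_congr rfl fun j _ => ?_
        rw [Finset.sum_Ico_succ_top hmn, mul_add, Real.exp_add]
        have := hG (Function.update x (n + 1) j) x (Function.update y n b) y
          (fun l hl => Function.update_of_ne (by omega) _ _)
          (fun l hl => Function.update_of_ne (by omega) _ _)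
        simp only at this
        rw [this]
        ring
      rw [e]
      exact mul_le_mul_of_nonneg_right
        (stepMean_exp_le hX (hc n hmn (Nat.lt_succ_self n)) (hfc n hmn (Nat.lt_succ_self n)) r x y
          (h0 n hmn (Nat.lt_succ_self n) x y)) (Real.exp_nonneg _)
    have hint1 := hr.integrable_prefix (X.stepMean_dependsOnPrefix hF) MeasurableSet.univ
    have hint2 := (hr.integrable_prefix hG MeasurableSet.univ).const_mul
      (Real.exp (r ^ 2 * c n ^ 2 / 2))
    simp only [Set.indicator_univ] at hint1 hint2
    refine (integral_mono hint1 hint2 fun ω => hpt _ _).trans ?_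
    rw [integral_const_mul, Finset.sum_Ico_succ_top hmn]
    calc _ ≤ Real.exp (r ^ 2 * c n ^ 2 / 2) *
          Real.exp (r ^ 2 * (∑ l ∈ Finset.Ico m n, c l ^ 2) / 2) :=
        mul_le_mul_of_nonneg_left ih' (Real.exp_nonneg _)
      _ = _ := by rw [← Real.exp_add]; ring_nf

/-- The Azuma–Hoeffding inequality. -/
theorem measure_sum_ge_le (hr : X.IsRun ℙ s a) (hX : X.IsStochastic) (m n : ℕ) (hmn : m ≤ n)
    {f : ℕ → (ℕ → S) → (ℕ → A) → ℝ} {c : ℕ → ℝ}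
    (hf : ∀ l, m ≤ l → l < n → DependsOnPrefix (l + 1) (f l))
    (hc : ∀ l, m ≤ l → l < n → 0 < c l) (hfc : ∀ l, m ≤ l → l < n → ∀ x y, |f l x y| ≤ c l)
    (h0 : ∀ l, m ≤ l → l < n → ∀ x y, X.stepMean l (f l) x y = 0) {V τ : ℝ} (hV : 0 < V)
    (hcV : ∑ l ∈ Finset.Ico m n, c l ^ 2 ≤ V) (hτ : 0 ≤ τ) :
    ℙ.real {ω | τ ≤ ∑ l ∈ Finset.Ico m n, f l (fun m => s m ω) (fun m => a m ω)} ≤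
      Real.exp (-(τ ^ 2 / (2 * V))) := by
  set Y : Ω → ℝ := fun ω => ∑ l ∈ Finset.Ico m n, f l (fun m => s m ω) (fun m => a m ω) with hY
  have hG : DependsOnPrefix n (fun x y => Real.exp (τ / V * ∑ l ∈ Finset.Ico m n, f l x y)) := by
    intro x x' y y' hx hy
    have := sum_dependsOnPrefix hf x x' y y' hx hy
    simp only at this ⊢
    rw [this]
  have hint := hr.integrable_prefix hG MeasurableSet.univ
  simp only [Set.indicator_univ] at hint
  -- Chernoff's bound at τ / V, the minimizer of -rτ + r²V/2 over r.
  have h1 := ProbabilityTheory.measure_ge_le_exp_mul_mgf (μ := ℙ) (X := Y) τ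
    (div_nonneg hτ hV.le) hint
  refine h1.trans ?_
  have h2 := hr.integral_exp_sum_le hX m n hmn hf hc hfc h0 (τ / V)
  calc _ ≤ Real.exp (-(τ / V) * τ) *
        Real.exp ((τ / V) ^ 2 * (∑ l ∈ Finset.Ico m n, c l ^ 2) / 2) :=
        mul_le_mul_of_nonneg_left h2 (Real.exp_nonneg _)
    _ = Real.exp (-(τ / V) * τ + (τ / V) ^ 2 * (∑ l ∈ Finset.Ico m n, c l ^ 2) / 2) := by
        rw [Real.exp_add]
    _ ≤ _ := by
        apply Real.exp_le_exp.2
        have h3 : (τ / V) ^ 2 * (∑ l ∈ Finset.Ico m n, c l ^ 2) ≤ (τ / V) ^ 2 * V :=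
          mul_le_mul_of_nonneg_left hcV (sq_nonneg _)
        have h4 : (τ / V) ^ 2 * V = τ ^ 2 / V := by field_simp
        have h5 : -(τ / V) * τ = -(τ ^ 2 / V) := by ring
        have h6 : τ ^ 2 / (2 * V) = τ ^ 2 / V / 2 := by field_simp
        rw [h5, h6]
        linarith

end IsRun

end Sandbox

end PathSpace

/-! ### The Bellman equation for the optimal Q-function -/

section Bellman

variable {S A : Type*} [Fintype S] [Fintype A]

theorem abs_apply_le_norm (Q : S → A → ℝ) (s : S) (a : A) : |Q s a| ≤ ‖Q‖ :=
  ((norm_le_pi_norm (Q s) a).trans (norm_le_pi_norm Q s))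

theorem norm_le_of_forall_abs_le {Q : S → A → ℝ} {c : ℝ} (hc : 0 ≤ c) (h : ∀ s a, |Q s a| ≤ c) :
    ‖Q‖ ≤ c :=
  (pi_norm_le_iff_of_nonneg hc).2 fun s => (pi_norm_le_iff_of_nonneg hc).2 fun a => h s a

theorem le_iSup_action (f : A → ℝ) (a : A) : f a ≤ ⨆ a', f a' :=
  le_ciSup (Set.finite_range f).bddAbove a

theorem abs_iSup_le [Nonempty A] {f : A → ℝ} {c : ℝ} (h : ∀ a, |f a| ≤ c) :
    |⨆ a, f a| ≤ c := by
  obtain ⟨a⟩ := ‹Nonempty A›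
  have : Nonempty A := ⟨a⟩
  rw [abs_le]
  exact ⟨(abs_le.1 (h a)).1.trans (le_iSup_action f a), ciSup_le fun a => (abs_le.1 (h a)).2⟩

theorem abs_iSup_sub_iSup_le [Nonempty A] {f g : A → ℝ} {c : ℝ} (h : ∀ a, |f a - g a| ≤ c) :
    |(⨆ a, f a) - ⨆ a, g a| ≤ c := by
  rw [abs_le]
  constructor
  · have : (⨆ a, g a) ≤ (⨆ a, f a) + c := ciSup_le fun a => by
      have h1 := (abs_le.1 (h a)).1
      have h2 := le_iSup_action f a
      linarith
    linarith
  · have : (⨆ a, f a) ≤ (⨆ a, g a) + c := ciSup_le fun a => by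
      have h1 := (abs_le.1 (h a)).2
      have h2 := le_iSup_action g a
      linarith
    linarith

theorem sum_mul_le_of_mem_stdSimplex {ι : Type*} [Fintype ι] {p f : ι → ℝ}
    (hp : p ∈ stdSimplex ℝ ι) {c : ℝ} (h : ∀ i, f i ≤ c) : ∑ i, p i * f i ≤ c :=
  calc ∑ i, p i * f i ≤ ∑ i, p i * c :=
        Finset.sum_le_sum fun i _ => mul_le_mul_of_nonneg_left (h i) (hp.1 i)
    _ = c := by rw [← Finset.sum_mul, hp.2, one_mul]

theorem abs_sum_mul_le_of_mem_stdSimplex {ι : Type*} [Fintype ι] {p f : ι → ℝ}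
    (hp : p ∈ stdSimplex ℝ ι) {c : ℝ} (h : ∀ i, |f i| ≤ c) : |∑ i, p i * f i| ≤ c := by
  rw [abs_le]
  refine ⟨?_, sum_mul_le_of_mem_stdSimplex hp fun i => (abs_le.1 (h i)).2⟩
  have := sum_mul_le_of_mem_stdSimplex hp (f := fun i => -f i) (c := c)
    fun i => by linarith [(abs_le.1 (h i)).1]
  simp only [mul_neg, Finset.sum_neg_distrib] at this
  linarith

namespace MeanFieldGame

variable (G : MeanFieldGame S A) {μ : S → ℝ}

/-- The Bellman optimality operator of the MDP induced by `μ`. -/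
noncomputable def bellman (μ : S → ℝ) (Q : S → A → ℝ) (s : S) (a : A) : ℝ :=
  G.R s a μ + G.ρ * ∑ s', G.P s a μ s' * ⨆ a', Q s' a'

theorem norm_bellman_sub_le [Nonempty A] (hμ : μ ∈ stdSimplex ℝ S) (Q Q' : S → A → ℝ) :
    ‖G.bellman μ Q - G.bellman μ Q'‖ ≤ G.ρ * ‖Q - Q'‖ := by
  refine norm_le_of_forall_abs_le (mul_nonneg G.ρ_mem.1.le (norm_nonneg _)) fun s a => ?_
  have e : (G.bellman μ Q - G.bellman μ Q') s a =
      G.ρ * ∑ s', G.P s a μ s' * ((⨆ a', Q s' a') - ⨆ a', Q' s' a') := by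
    simp only [Pi.sub_apply, bellman, mul_sub, Finset.sum_sub_distrib]
    ring
  rw [e, abs_mul, abs_of_pos G.ρ_mem.1]
  refine mul_le_mul_of_nonneg_left ?_ G.ρ_mem.1.le
  exact abs_sum_mul_le_of_mem_stdSimplex (G.P_mem s a μ hμ) fun s' =>
    abs_iSup_sub_iSup_le fun a' => abs_apply_le_norm (Q - Q') s' a'

theorem exists_bellman_fixedPoint [Nonempty A] (hμ : μ ∈ stdSimplex ℝ S) :
    ∃ q : S → A → ℝ, G.bellman μ q = q := by
  have hc : ContractingWith ⟨G.ρ, G.ρ_mem.1.le⟩ (G.bellman μ) := by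
    refine ⟨by exact_mod_cast G.ρ_mem.2, LipschitzWith.of_dist_le_mul fun Q Q' => ?_⟩
    rw [dist_eq_norm, dist_eq_norm]
    exact G.norm_bellman_sub_le hμ Q Q'
  exact ⟨hc.fixedPoint _, hc.fixedPoint_isFixedPt⟩

theorem expReward_mem (hμ : μ ∈ stdSimplex ℝ S) {π : S → A → ℝ}
    (hπ : ∀ s, π s ∈ stdSimplex ℝ A) (n : ℕ) (s : S) (a : A) :
    |G.expReward μ π n s a| ≤ 1 := by
  induction n generalizing s a with
  | zero =>
    have := G.R_mem s a μ hμ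
    simp only [expReward]
    rw [abs_of_nonneg this.1]
    exact this.2
  | succ n ih =>
    exact abs_sum_mul_le_of_mem_stdSimplex (G.P_mem s a μ hμ) fun s' =>
      abs_sum_mul_le_of_mem_stdSimplex (hπ s') fun a' => ih s' a'

theorem summable_expReward (hμ : μ ∈ stdSimplex ℝ S) {π : S → A → ℝ}
    (hπ : ∀ s, π s ∈ stdSimplex ℝ A) (s : S) (a : A) :
    Summable fun n : ℕ => G.ρ ^ n * G.expReward μ π n s a := by
  refine Summable.of_norm_bounded (summable_geometric_of_lt_one G.ρ_mem.1.le G.ρ_mem.2) fun n => ?_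
  rw [norm_mul, norm_pow, Real.norm_eq_abs, Real.norm_eq_abs, abs_of_pos G.ρ_mem.1]
  exact mul_le_of_le_one_right (pow_nonneg G.ρ_mem.1.le n) (G.expReward_mem hμ hπ n s a)

theorem qPolicy_eq (hμ : μ ∈ stdSimplex ℝ S) {π : S → A → ℝ}
    (hπ : ∀ s, π s ∈ stdSimplex ℝ A) (s : S) (a : A) :
    G.qPolicy μ π s a = G.R s a μ +
      G.ρ * ∑ s', G.P s a μ s' * ∑ a', π s' a' * G.qPolicy μ π s' a' := by
  rw [qPolicy, (G.summable_expReward hμ hπ s a).tsum_eq_zero_add]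
  congr 1
  · simp [expReward]
  · apply HasSum.tsum_eq
    have h : HasSum (fun n : ℕ => G.ρ * ∑ s', G.P s a μ s' * ∑ a', π s' a' *
        (G.ρ ^ n * G.expReward μ π n s' a'))
        (G.ρ * ∑ s', G.P s a μ s' * ∑ a', π s' a' * G.qPolicy μ π s' a') := by
      refine HasSum.mul_left _ (hasSum_sum fun s' _ => HasSum.mul_left _
        (hasSum_sum fun a' _ => HasSum.mul_left _ ?_))
      exact (G.summable_expReward hμ hπ s' a').hasSum
    have e : (fun n : ℕ => G.ρ ^ (n + 1) * G.expReward μ π (n + 1) s a) =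
        fun n : ℕ => G.ρ * ∑ s', G.P s a μ s' * ∑ a', π s' a' *
          (G.ρ ^ n * G.expReward μ π n s' a') := ?_
    · rw [e]
      exact h
    funext n
    simp only [expReward, Finset.mul_sum]
    refine Finset.sum_congr rfl fun s' _ => Finset.sum_congr rfl fun a' _ => ?_
    ring

/-- Maximum principle: at a pair where the difference of the two sides is largest, with value d, one
backup gives d ≤ ρ d, hence d ≤ 0. -/
theorem qPolicy_le_of_bellman_eq [Nonempty A] (hμ : μ ∈ stdSimplex ℝ S) {π : S → A → ℝ}
    (hπ : ∀ s, π s ∈ stdSimplex ℝ A) {q : S → A → ℝ} (hq : G.bellman μ q = q) (s : S) (a : A) :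
    G.qPolicy μ π s a ≤ q s a := by
  have : Nonempty S := ⟨s⟩
  obtain ⟨i, hi⟩ := Finite.exists_max fun i : S × A => G.qPolicy μ π i.1 i.2 - q i.1 i.2
  set d := G.qPolicy μ π i.1 i.2 - q i.1 i.2 with hd
  have key : d ≤ G.ρ * d := by
    have h1 := G.qPolicy_eq hμ hπ i.1 i.2
    have h2 : q i.1 i.2 = _ := (congrFun (congrFun hq i.1) i.2).symm
    rw [bellman] at h2
    have h3 : ∑ s', G.P i.1 i.2 μ s' * (∑ a', π s' a' * G.qPolicy μ π s' a' - ⨆ a', q s' a') ≤ d := by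
      refine sum_mul_le_of_mem_stdSimplex (G.P_mem _ _ μ hμ) fun s' => ?_
      rw [sub_le_iff_le_add]
      refine sum_mul_le_of_mem_stdSimplex (hπ s') fun a' => ?_
      have h4 := hi (s', a')
      have h5 := le_iSup_action (q s') a'
      simp only at h4
      linarith
    simp only [mul_sub, Finset.sum_sub_distrib] at h3
    have h6 := mul_le_mul_of_nonneg_left h3 G.ρ_mem.1.le
    rw [mul_sub] at h6
    linarith
  have hd0 : d ≤ 0 := by
    by_contra h
    push Not at h
    nlinarith [G.ρ_mem.2]
  have := hi (s, a)
  simp only at this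
  linarith

/-- The greedy policy of `q` attains every supremum in the Bellman equation; the same maximum
principle then applies with the sign reversed. -/
theorem exists_policy_ge_of_bellman_eq [DecidableEq A] [Nonempty A] (hμ : μ ∈ stdSimplex ℝ S)
    {q : S → A → ℝ} (hq : G.bellman μ q = q) :
    ∃ π : {π : S → A → ℝ // ∀ s, π s ∈ stdSimplex ℝ A}, ∀ s a, q s a ≤ G.qPolicy μ π.1 s a := by
  choose g hg using fun s => Finite.exists_max (q s)
  have hsup : ∀ s, ⨆ a, q s a = q s (g s) := fun s =>
    le_antisymm (ciSup_le (hg s)) (le_iSup_action _ _)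
  have hπ : ∀ s, (fun s => (Pi.single (g s) 1 : A → ℝ)) s ∈ stdSimplex ℝ A := fun s =>
    single_mem_stdSimplex ℝ (g s)
  refine ⟨⟨fun s => Pi.single (g s) 1, hπ⟩, fun s a => ?_⟩
  have : Nonempty S := ⟨s⟩
  set pol : S → A → ℝ := fun s => Pi.single (g s) 1 with hpol
  obtain ⟨i, hi⟩ := Finite.exists_max fun i : S × A => q i.1 i.2 - G.qPolicy μ pol i.1 i.2
  set d := q i.1 i.2 - G.qPolicy μ pol i.1 i.2 with hd
  have key : d ≤ G.ρ * d := by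
    have h1 := G.qPolicy_eq hμ hπ i.1 i.2
    have h2 : q i.1 i.2 = _ := (congrFun (congrFun hq i.1) i.2).symm
    rw [bellman] at h2
    have h3 : ∑ s', G.P i.1 i.2 μ s' * ((⨆ a', q s' a') - ∑ a', pol s' a' * G.qPolicy μ pol s' a') ≤ d := by
      refine sum_mul_le_of_mem_stdSimplex (G.P_mem _ _ μ hμ) fun s' => ?_
      have h4 := hi (s', g s')
      simp only at h4
      rw [hsup, Finset.sum_eq_single (g s')]
      · simpa [hpol] using h4
      · intro b _ hb
        simp [hpol, Pi.single_eq_of_ne hb]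
      · simp
    simp only [mul_sub, Finset.sum_sub_distrib] at h3
    have h6 := mul_le_mul_of_nonneg_left h3 G.ρ_mem.1.le
    rw [mul_sub] at h6
    simp only [hpol] at *
    linarith
  have hd0 : d ≤ 0 := by
    by_contra h
    push Not at h
    nlinarith [G.ρ_mem.2]
  have := hi (s, a)
  simp only at this
  linarith

/-- The Bellman optimality equation. -/
theorem bellman_optQ [DecidableEq A] [Nonempty A] (hμ : μ ∈ stdSimplex ℝ S) :
    G.bellman μ (G.optQ μ) = G.optQ μ := by
  obtain ⟨q, hq⟩ := G.exists_bellman_fixedPoint hμ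
  obtain ⟨π, hπ⟩ := G.exists_policy_ge_of_bellman_eq hμ hq
  have : G.optQ μ = q := by
    funext s a
    have hle : ∀ π : {π : S → A → ℝ // ∀ s, π s ∈ stdSimplex ℝ A}, G.qPolicy μ π.1 s a ≤ q s a :=
      fun π => G.qPolicy_le_of_bellman_eq hμ π.2 hq s a
    have : Nonempty {π : S → A → ℝ // ∀ s, π s ∈ stdSimplex ℝ A} := ⟨π⟩
    refine le_antisymm (ciSup_le hle) ((hπ s a).trans ?_)
    exact le_ciSup (f := fun π : {π : S → A → ℝ // ∀ s, π s ∈ stdSimplex ℝ A} =>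
      G.qPolicy μ π.1 s a) ⟨q s a, by rintro _ ⟨π, rfl⟩; exact hle π⟩ π
  rw [this, hq]

theorem norm_optQ_le [DecidableEq A] [Nonempty A] (hμ : μ ∈ stdSimplex ℝ S) :
    ‖G.optQ μ‖ ≤ 1 / (1 - G.ρ) := by
  have h1 : ‖G.optQ μ‖ ≤ 1 + G.ρ * ‖G.optQ μ‖ := by
    conv_lhs => rw [← G.bellman_optQ hμ]
    have hρ := G.ρ_mem.1.le
    refine norm_le_of_forall_abs_le (by positivity) fun s a => ?_
    have hR := G.R_mem s a μ hμ
    refine (abs_add_le _ _).trans (add_le_add (abs_le.2 ⟨by linarith [hR.1], hR.2⟩) ?_)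
    rw [abs_mul, abs_of_nonneg hρ]
    refine mul_le_mul_of_nonneg_left ?_ hρ
    exact abs_sum_mul_le_of_mem_stdSimplex (G.P_mem s a μ hμ) fun s' =>
      abs_iSup_le fun a' => abs_apply_le_norm _ s' a'
  rw [le_div_iff₀ (by linarith [G.ρ_mem.2])]
  linarith

end MeanFieldGame

end Bellman

/-! ### Pathwise invariants: simplices, exploration, mean-field drift, size of the table -/

section Invariants

variable {S A : Type*} [Fintype S] [Fintype A]

theorem l1Dist_triangle (μ μ' μ'' : S → ℝ) : l1Dist μ μ'' ≤ l1Dist μ μ' + l1Dist μ' μ'' := by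
  unfold l1Dist
  rw [← Finset.sum_add_distrib]
  exact Finset.sum_le_sum fun s _ => abs_sub_le _ _ _

theorem l1Dist_le_two {μ μ' : S → ℝ} (hμ : μ ∈ stdSimplex ℝ S) (hμ' : μ' ∈ stdSimplex ℝ S) :
    l1Dist μ μ' ≤ 2 := by
  calc l1Dist μ μ' ≤ ∑ s, (μ s + μ' s) := Finset.sum_le_sum fun s _ => by
        have h1 := hμ.1 s
        have h2 := hμ'.1 s
        rw [abs_le]
        constructor <;> linarith
    _ = 2 := by rw [Finset.sum_add_distrib, hμ.2, hμ'.2]; norm_num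

theorem l1Dist_nonneg (μ μ' : S → ℝ) : 0 ≤ l1Dist μ μ' :=
  Finset.sum_nonneg fun _ _ => abs_nonneg _

theorem abs_sub_le_l1Dist (μ μ' : S → ℝ) (s : S) : |μ s - μ' s| ≤ l1Dist μ μ' :=
  Finset.single_le_sum (f := fun s => |μ s - μ' s|) (fun _ _ => abs_nonneg _) (Finset.mem_univ s)

theorem sum_mul_mem_stdSimplex {P : S → S → ℝ} (hP : ∀ i, P i ∈ stdSimplex ℝ S) {μ : S → ℝ}
    (hμ : μ ∈ stdSimplex ℝ S) : (fun s' => ∑ s, P s s' * μ s) ∈ stdSimplex ℝ S := by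
  refine ⟨fun s' => Finset.sum_nonneg fun s _ => mul_nonneg ((hP s).1 s') (hμ.1 s), ?_⟩
  rw [Finset.sum_comm]
  simp only [← Finset.sum_mul, (hP _).2, one_mul, hμ.2]

theorem mix_mem_stdSimplex {ι : Type*} [Fintype ι] {p q : ι → ℝ} (hp : p ∈ stdSimplex ℝ ι)
    (hq : q ∈ stdSimplex ℝ ι) {c : ℝ} (hc : c ∈ Set.Icc (0 : ℝ) 1) :
    (fun i => (1 - c) * p i + c * q i) ∈ stdSimplex ℝ ι :=
  convex_stdSimplex ℝ ι hp hq (by linarith [hc.2]) hc.1 (by ring)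

theorem softmaxPolicy_mem [Nonempty A] (lam : ℝ) (Q : S → A → ℝ) (s : S) :
    softmaxPolicy lam Q s ∈ stdSimplex ℝ A := by
  have hpos : 0 < ∑ a', Real.exp (lam * Q s a') :=
    Finset.sum_pos (fun _ _ => Real.exp_pos _) Finset.univ_nonempty
  refine ⟨fun a => div_nonneg (Real.exp_pos _).le hpos.le, ?_⟩
  simp only [softmaxPolicy]
  rw [← Finset.sum_div, div_self hpos.ne']

theorem uniform_mem_stdSimplex [Nonempty A] :
    (fun _ : A => 1 / (Fintype.card A : ℝ)) ∈ stdSimplex ℝ A := by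
  refine ⟨fun a => by positivity, ?_⟩
  simp

theorem Schedule.Admissible.rateμ_mem {h : Schedule} (hh : h.Admissible) {k t : ℕ} (hk : 1 ≤ k)
    (ht : 1 ≤ t) : 0 ≤ h.rateμ k t ∧ h.rateμ k t ≤ 1 / (t : ℝ) ^ h.ζ := by
  have hk' : (1 : ℝ) ≤ (k : ℝ) ^ h.γ :=
    Real.one_le_rpow (by exact_mod_cast hk) (hh.θ_pos.trans hh.θ_lt).le
  have ht' : (0 : ℝ) ≤ 1 / (t : ℝ) ^ h.ζ := by positivity
  have hc : h.cμ / (k : ℝ) ^ h.γ ≤ 1 := by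
    rw [div_le_one (by linarith)]
    linarith [hh.cμ_mem.2]
  have hc0 : 0 ≤ h.cμ / (k : ℝ) ^ h.γ := div_nonneg hh.cμ_mem.1.le (by linarith)
  exact ⟨mul_nonneg hc0 ht', mul_le_of_le_one_left ht' hc⟩

theorem one_div_rpow_le_one {t : ℕ} (ht : 1 ≤ t) {z : ℝ} (hz : 0 ≤ z) : 1 / (t : ℝ) ^ z ≤ 1 := by
  have : (1 : ℝ) ≤ (t : ℝ) ^ z := Real.one_le_rpow (by exact_mod_cast ht) hz
  rw [div_le_one (by linarith)]
  exact this

theorem Schedule.Admissible.rateμ_mem_Icc {h : Schedule} (hh : h.Admissible) {k t : ℕ}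
    (hk : 1 ≤ k) (ht : 1 ≤ t) : h.rateμ k t ∈ Set.Icc (0 : ℝ) 1 :=
  ⟨(hh.rateμ_mem hk ht).1, (hh.rateμ_mem hk ht).2.trans
    (one_div_rpow_le_one ht (by linarith [hh.ζ_gt]))⟩

theorem Schedule.Admissible.rateπ_mem_Icc {h : Schedule} (hh : h.Admissible) {k t : ℕ}
    (hk : 1 ≤ k) (ht : 1 ≤ t) : h.rateπ k t ∈ Set.Icc (0 : ℝ) 1 := by
  have hk' : (1 : ℝ) ≤ (k : ℝ) ^ h.θ := Real.one_le_rpow (by exact_mod_cast hk) hh.θ_pos.le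
  have ht' : (0 : ℝ) ≤ 1 / (t : ℝ) ^ h.ζ := by positivity
  have hc : h.cπ / (k : ℝ) ^ h.θ ≤ 1 := by
    rw [div_le_one (by linarith)]
    linarith [hh.cπ_mem.2]
  have hc0 : 0 ≤ h.cπ / (k : ℝ) ^ h.θ := div_nonneg hh.cπ_mem.1.le (by linarith)
  exact ⟨mul_nonneg hc0 ht', (mul_le_of_le_one_left ht' hc).trans
    (one_div_rpow_le_one ht (by linarith [hh.ζ_gt]))⟩

namespace Memory

theorem Valid.mix_mem {m : Memory S A} (hm : m.Valid) {c : ℝ} (hc : c ∈ Set.Icc (0 : ℝ) 1) :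
    (fun s' => (1 - c) * m.mf s' + c * ∑ s, m.Phat s s' * m.mf s) ∈ stdSimplex ℝ S :=
  mix_mem_stdSimplex hm.mf_mem (sum_mul_mem_stdSimplex hm.Phat_mem hm.mf_mem) hc

theorem Valid.nextMF_mem {h : Schedule} (hh : h.Admissible) {proj : (S → ℝ) → (S → ℝ)}
    (hproj : ∀ μ ∈ stdSimplex ℝ S, proj μ ∈ stdSimplex ℝ S) {k t : ℕ} (hk : 1 ≤ k) (ht : 1 ≤ t)
    {m : Memory S A} (hm : m.Valid) : m.nextMF h proj k t ∈ stdSimplex ℝ S := by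
  have := hm.mix_mem (hh.rateμ_mem_Icc hk ht)
  unfold nextMF
  split_ifs
  · exact hproj _ this
  · exact this

theorem Valid.nextPol_mem [Nonempty A] {h : Schedule} (hh : h.Admissible) {k t : ℕ} (hk : 1 ≤ k)
    (ht : 1 ≤ t) {m : Memory S A} (hm : m.Valid) (s : S) {μ : S → ℝ} (hμ : μ ∈ stdSimplex ℝ S) :
    m.nextPol h k t s μ ∈ stdSimplex ℝ A := by
  have hψ : h.ψ ∈ Set.Icc (0 : ℝ) 1 :=
    ⟨hh.ψ_mem.1.le, by linarith [hh.ψ_mem.2, hh.cπ_mem.1]⟩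
  exact mix_mem_stdSimplex (hm.pol_mem s μ hμ)
    (mix_mem_stdSimplex (softmaxPolicy_mem h.lam m.Q s) uniform_mem_stdSimplex hψ)
    (hh.rateπ_mem_Icc hk ht)

theorem le_nextPol [Nonempty A] {h : Schedule} (hh : h.Admissible) {k t : ℕ} (hk : 1 ≤ k)
    (ht : 1 ≤ t) {m : Memory S A} (s : S) (μ : S → ℝ) (a : A) {c : ℝ} (hc : c ≤ m.pol s μ a) :
    (1 - h.rateπ k t) * c + h.rateπ k t * (h.ψ * (1 / (Fintype.card A : ℝ))) ≤
      m.nextPol h k t s μ a := by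
  have h1 := hh.rateπ_mem_Icc hk ht
  have h2 := (softmaxPolicy_mem h.lam m.Q s).1 a
  have h3 : 0 ≤ 1 - h.ψ := by linarith [hh.ψ_mem.2, hh.cπ_mem.1]
  unfold nextPol
  refine add_le_add (mul_le_mul_of_nonneg_left hc (by linarith [h1.2])) ?_
  refine mul_le_mul_of_nonneg_left ?_ h1.1
  linarith [mul_nonneg h3 h2]

end Memory

variable [DecidableEq S] [DecidableEq A] [Nonempty S] [Nonempty A]

namespace Sandbox

/-- Standing assumptions on an instance of the algorithm. -/
structure Regular (X : Sandbox S A) (net : Finset (S → ℝ)) : Prop where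
  adm : X.sched.Admissible
  net_mem : ∀ μ ∈ net, μ ∈ stdSimplex ℝ S
  proj_mem : ∀ μ ∈ stdSimplex ℝ S, X.proj μ ∈ net
  valid : X.init.Valid

namespace Regular

variable {X : Sandbox S A} {net : Finset (S → ℝ)} (hX : X.Regular net) (x : ℕ → S) (y : ℕ → A)
include hX

theorem mem_valid (n : ℕ) : (X.mem x y n).Valid := by
  induction n with
  | zero => exact hX.valid
  | succ n ih =>
    refine ⟨?_, fun s μ hμ => ?_, fun i => ?_⟩
    · exact ih.nextMF_mem hX.adm (fun μ hμ => hX.net_mem _ (hX.proj_mem μ hμ))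
        (Nat.le_add_left 1 _) (Nat.le_add_left 1 _)
    · exact ih.nextPol_mem hX.adm (Nat.le_add_left 1 _) (Nat.le_add_left 1 _) s hμ
    · have hpos : (0 : ℝ) < ((∑ j', X.visits x n i j' : ℕ) : ℝ) + 1 := by positivity
      refine ⟨fun j => ?_, ?_⟩
      · simp only [mem]
        positivity
      · simp only [mem]
        rw [← Finset.sum_div, div_eq_one_iff_eq hpos.ne', Finset.sum_add_distrib]
        push_cast
        simp

theorem mfAt_mem (n : ℕ) : X.mfAt x y n ∈ stdSimplex ℝ S :=
  (hX.mem_valid x y n).nextMF_mem hX.adm (fun μ hμ => hX.net_mem _ (hX.proj_mem μ hμ))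
    (Nat.le_add_left 1 _) (Nat.le_add_left 1 _)

theorem polAt_mem (n : ℕ) (s : S) {μ : S → ℝ} (hμ : μ ∈ stdSimplex ℝ S) :
    X.polAt x y n s μ ∈ stdSimplex ℝ A :=
  (hX.mem_valid x y n).nextPol_mem hX.adm (Nat.le_add_left 1 _) (Nat.le_add_left 1 _) s hμ

theorem mfAt_mem_net {n : ℕ} (hn : X.st n = 1) : X.mfAt x y n ∈ net := by
  simp only [mfAt, Memory.nextMF, hn, if_true]
  refine hX.proj_mem _ ((hX.mem_valid x y n).mix_mem ?_)
  exact hX.adm.rateμ_mem_Icc (Nat.le_add_left 1 _) le_rfl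

theorem isStochastic : X.IsStochastic := by
  intro x y n
  have h1 := hX.mfAt_mem x y n
  have h2 := hX.polAt_mem x y n (x n) h1
  have h3 := fun b => X.game.P_mem (x n) b _ h1
  refine ⟨fun b j => mul_nonneg (h2.1 b) ((h3 b).1 j), ?_⟩
  simp only [stepProb, ← Finset.mul_sum, (h3 _).2, mul_one, h2.2]

/-- At clock time 0 the mixing rate is exactly c_π, since k = t = 1, so the floor holds whatever the
initial policy. Later policies mix one above the floor with one that is at least ψ / |A|, which
exceeds the floor because c_π < 1. -/
theorem le_polAt (n : ℕ) (s : S) {μ : S → ℝ} (hμ : μ ∈ stdSimplex ℝ S) (a : A) :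
    X.sched.cπ * X.sched.ψ / (Fintype.card A : ℝ) ≤ X.polAt x y n s μ a := by
  have hA : (0 : ℝ) < Fintype.card A := by exact_mod_cast Fintype.card_pos
  have hc := hX.adm.cπ_mem
  have hψ := hX.adm.ψ_mem.1
  induction n with
  | zero =>
    have h := Memory.le_nextPol hX.adm (k := X.ep 0) (t := X.st 0) (Nat.le_add_left 1 _)
      (Nat.le_add_left 1 _) s μ a ((hX.valid.pol_mem s μ hμ).1 a)
    have e : X.sched.rateπ (X.ep 0) (X.st 0) = X.sched.cπ := by
      simp [Schedule.rateπ, ep, st]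
    rw [e] at h
    simp only [polAt, mem]
    calc _ = _ := ?_
      _ ≤ _ := h
    ring
  | succ n ih =>
    have h := Memory.le_nextPol hX.adm (k := X.ep (n + 1)) (t := X.st (n + 1))
      (Nat.le_add_left 1 _) (Nat.le_add_left 1 _) (m := X.mem x y (n + 1)) s μ a ih
    refine le_trans ?_ h
    have h1 := hX.adm.rateπ_mem_Icc (k := X.ep (n + 1)) (t := X.st (n + 1))
      (Nat.le_add_left 1 _) (Nat.le_add_left 1 _)
    have h2 : X.sched.cπ * X.sched.ψ / (Fintype.card A : ℝ) ≤
        X.sched.ψ * (1 / (Fintype.card A : ℝ)) := by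
      rw [mul_one_div]
      gcongr
      nlinarith [hc.2]
    nlinarith [mul_le_mul_of_nonneg_left h2 h1.1]

/-- Away from the first step of an episode there is no projection, and the update moves a fraction
at most t^{-ζ} of a distance at most 2. -/
theorem l1Dist_mfAt_succ_le {n : ℕ} (hn : X.st (n + 1) ≠ 1) :
    l1Dist (X.mfAt x y (n + 1)) (X.mfAt x y n) ≤ 2 * (1 / (X.st (n + 1) : ℝ) ^ X.sched.ζ) := by
  set m := X.mem x y (n + 1) with hm
  have hmf : m.mf = X.mfAt x y n := rfl
  have hv := hX.mem_valid x y (n + 1)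
  set c := X.sched.rateμ (X.ep (n + 1)) (X.st (n + 1)) with hc
  have hcm := hX.adm.rateμ_mem (k := X.ep (n + 1)) (t := X.st (n + 1))
      (Nat.le_add_left 1 _) (Nat.le_add_left 1 _)
  have e : l1Dist (X.mfAt x y (n + 1)) (X.mfAt x y n) =
      c * l1Dist (fun s' => ∑ s, m.Phat s s' * m.mf s) m.mf := by
    have e0 : X.mfAt x y (n + 1) =
        fun s' => (1 - c) * m.mf s' + c * ∑ s, m.Phat s s' * m.mf s := by
      simp only [mfAt, Memory.nextMF, hn, if_false, hm, hc]
    rw [e0, ← hmf]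
    unfold l1Dist
    rw [Finset.mul_sum]
    refine Finset.sum_congr rfl fun s' _ => ?_
    rw [← abs_of_nonneg (show 0 ≤ c from hcm.1), ← abs_mul, abs_of_nonneg (show 0 ≤ c from hcm.1)]
    congr 1
    ring
  rw [e, mul_comm]
  exact mul_le_mul (l1Dist_le_two (sum_mul_mem_stdSimplex hv.Phat_mem hv.mf_mem) hv.mf_mem) hcm.2
    hcm.1 (by norm_num)

end Regular

variable (X : Sandbox S A)

theorem st_add {n₀ k : ℕ} (hk : n₀ = k * X.T) {j : ℕ} (hj : j < X.T) : X.st (n₀ + j) = j + 1 := by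
  simp [st, hk, Nat.mod_eq_of_lt hj]

end Sandbox

/-- For z ≥ 2 one has ((j+2)/2)^z ≥ ((j+2)/2)², so the terms are at most 4 · 2^{-z} / ((j+1)(j+2)),
which telescopes. -/
theorem sum_one_div_rpow_le {z : ℝ} (hz : 2 ≤ z) (n : ℕ) :
    ∑ j ∈ Finset.range n, 1 / ((j : ℝ) + 2) ^ z ≤ 2 * (2 : ℝ) ^ (1 - z) := by
  have h1 : ∀ j : ℕ, 1 / ((j : ℝ) + 2) ^ z ≤
      2 * (2 : ℝ) ^ (1 - z) * (1 / ((j : ℝ) + 1) - 1 / ((j : ℝ) + 2)) := by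
    intro j
    have hj : (0 : ℝ) ≤ j := Nat.cast_nonneg j
    have e1 : (2 : ℝ) ^ (1 - z) = 2 / 2 ^ z := by
      rw [Real.rpow_sub (by norm_num), Real.rpow_one]
    have e2 : (((j : ℝ) + 2) / 2) ^ (2 : ℝ) ≤ (((j : ℝ) + 2) / 2) ^ z :=
      Real.rpow_le_rpow_of_exponent_le (by linarith) hz
    rw [Real.rpow_two, Real.div_rpow (by linarith) (by norm_num)] at e2
    have e3 : 1 / ((j : ℝ) + 1) - 1 / ((j : ℝ) + 2) = 1 / (((j : ℝ) + 1) * ((j : ℝ) + 2)) := by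
      field_simp
      ring
    have hp : (0 : ℝ) < (2 : ℝ) ^ z := by positivity
    have hq : (0 : ℝ) < ((j : ℝ) + 2) ^ z := by positivity
    rw [le_div_iff₀ hp] at e2
    rw [e3, e1, div_le_iff₀ hq]
    have e4 : 2 * (2 / (2 : ℝ) ^ z) * (1 / (((j : ℝ) + 1) * ((j : ℝ) + 2))) * ((j : ℝ) + 2) ^ z =
        4 * ((j : ℝ) + 2) ^ z / ((2 : ℝ) ^ z * (((j : ℝ) + 1) * ((j : ℝ) + 2))) := by
      field_simp
      ring
    rw [e4, le_div_iff₀ (by positivity)]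
    nlinarith [mul_nonneg hj hp.le]
  calc _ ≤ ∑ j ∈ Finset.range n,
        2 * (2 : ℝ) ^ (1 - z) * (1 / ((j : ℝ) + 1) - 1 / ((j : ℝ) + 2)) :=
        Finset.sum_le_sum fun j _ => h1 j
    _ = 2 * (2 : ℝ) ^ (1 - z) * (1 - 1 / ((n : ℝ) + 1)) := by
        rw [← Finset.mul_sum]
        congr 1
        have := Finset.sum_range_sub' (fun j : ℕ => 1 / ((j : ℝ) + 1)) n
        simp only [Nat.cast_add, Nat.cast_one, Nat.cast_zero, zero_add, div_one] at this
        rw [← this]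
        refine Finset.sum_congr rfl fun j _ => ?_
        rw [add_assoc]
        norm_num
    _ ≤ 2 * (2 : ℝ) ^ (1 - z) * 1 := by
        have : (0 : ℝ) ≤ 1 / ((n : ℝ) + 1) := by positivity
        have h2 : (0 : ℝ) ≤ 2 * (2 : ℝ) ^ (1 - z) := by positivity
        exact mul_le_mul_of_nonneg_left (by linarith) h2
    _ = _ := mul_one _

/-- The increments after the projection start at t = 2; this is where the decay 2^{1-ζ} originates.
-/
theorem Sandbox.Regular.l1Dist_mfAt_le {X : Sandbox S A} {net : Finset (S → ℝ)}
    (hX : X.Regular net) (x : ℕ → S) (y : ℕ → A) (hζ : 2 ≤ X.sched.ζ) {n₀ k : ℕ}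
    (hk : n₀ = k * X.T) {j : ℕ} (hj : j < X.T) :
    l1Dist (X.mfAt x y (n₀ + j)) (X.mfAt x y n₀) ≤ 4 * (2 : ℝ) ^ (1 - X.sched.ζ) := by
  have h : l1Dist (X.mfAt x y (n₀ + j)) (X.mfAt x y n₀) ≤
      2 * ∑ i ∈ Finset.range j, 1 / ((i : ℝ) + 2) ^ X.sched.ζ := by
    induction j with
    | zero => simp [l1Dist]
    | succ j ih =>
      have h1 := ih (by omega)
      have hst : X.st (n₀ + j + 1) = j + 2 := by
        rw [add_assoc, X.st_add hk hj]
      have h2 := hX.l1Dist_mfAt_succ_le x y (n := n₀ + j) (by omega)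
      rw [hst] at h2
      push_cast at h2
      rw [Finset.sum_range_succ, mul_add]
      refine (l1Dist_triangle _ (X.mfAt x y (n₀ + j)) _).trans ?_
      rw [← add_assoc]
      linarith
  have := sum_one_div_rpow_le hζ j
  linarith

/-- The floor 1/(1-ρ) makes B = max(‖Q‖, 1/(1-ρ)) satisfy 1 + ρ B ≤ B, so the target of the update
is again bounded by B. The factor is 1 as soon as β ≤ 1, so the table can grow only while the step
size exceeds 1. -/
theorem norm_qUpdate_le {ρ β : ℝ} (hρ : ρ ∈ Set.Ioo (0 : ℝ) 1) (hβ : 0 ≤ β) (Q : S → A → ℝ)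
    (s : S) (a : A) {r : ℝ} (hr : r ∈ Set.Icc (0 : ℝ) 1) (s' : S) :
    max ‖qUpdate ρ β Q s a r s'‖ (1 / (1 - ρ)) ≤ (|1 - β| + β) * max ‖Q‖ (1 / (1 - ρ)) := by
  set B := max ‖Q‖ (1 / (1 - ρ)) with hB
  have h1ρ : 0 < 1 - ρ := by linarith [hρ.2]
  have hBρ : 1 / (1 - ρ) ≤ B := le_max_right _ _
  have hB1 : 1 + ρ * B ≤ B := by
    rw [div_le_iff₀ h1ρ] at hBρ
    linarith
  have hB0 : 0 ≤ B := le_trans (by positivity) hBρ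
  have hf : 1 ≤ |1 - β| + β := by linarith [le_abs_self (1 - β)]
  have hBf : B ≤ (|1 - β| + β) * B := le_mul_of_one_le_left hB0 hf
  refine max_le (norm_le_of_forall_abs_le (hB0.trans hBf) fun i b => ?_) (hBρ.trans hBf)
  have hQ : ∀ i b, |Q i b| ≤ B := fun i b => (abs_apply_le_norm Q i b).trans (le_max_left _ _)
  unfold qUpdate
  split_ifs
  · have h2 : |r + ρ * ⨆ a', Q s' a'| ≤ B := by
      refine (abs_add_le _ _).trans (le_trans (add_le_add (abs_le.2 ⟨by linarith [hr.1], hr.2⟩)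
        ?_) hB1)
      rw [abs_mul, abs_of_pos hρ.1]
      exact mul_le_mul_of_nonneg_left (abs_iSup_le fun a' => hQ s' a') hρ.1.le
    refine (abs_add_le _ _).trans ?_
    rw [abs_mul, abs_mul, abs_of_nonneg hβ, add_mul]
    exact add_le_add (mul_le_mul_of_nonneg_left (hQ s a) (abs_nonneg _))
      (mul_le_mul_of_nonneg_left h2 hβ)
  · exact (hQ i b).trans hBf

end Invariants

/-! ### Deterministic contraction of asynchronous recursions -/

section Recursion

/-- The solution `d` of `d (k + 1) = exp (-w k) * d k + Δ k` with `d m = D`. -/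
noncomputable def expConv (D : ℝ) (Δ w : ℕ → ℝ) (m n : ℕ) : ℝ :=
  D * Real.exp (-∑ l ∈ Finset.Ico m n, w l) +
    ∑ k ∈ Finset.Ico m n, Δ k * Real.exp (-∑ l ∈ Finset.Ico (k + 1) n, w l)

theorem expConv_self (D : ℝ) (Δ w : ℕ → ℝ) (m : ℕ) : expConv D Δ w m m = D := by
  simp [expConv]

theorem expConv_succ (D : ℝ) (Δ w : ℕ → ℝ) {m n : ℕ} (hmn : m ≤ n) :
    expConv D Δ w m (n + 1) = Real.exp (-w n) * expConv D Δ w m n + Δ n := by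
  have h : ∀ k ≤ n, Real.exp (-∑ l ∈ Finset.Ico k (n + 1), w l) =
      Real.exp (-w n) * Real.exp (-∑ l ∈ Finset.Ico k n, w l) := by
    intro k hk
    rw [Finset.sum_Ico_succ_top hk, ← Real.exp_add]
    ring_nf
  unfold expConv
  rw [h m hmn, Finset.sum_Ico_succ_top hmn, Finset.Ico_self, Finset.sum_empty, neg_zero,
    Real.exp_zero, mul_add, Finset.mul_sum]
  have e : ∑ k ∈ Finset.Ico m n, Δ k * Real.exp (-∑ l ∈ Finset.Ico (k + 1) (n + 1), w l) =
      ∑ k ∈ Finset.Ico m n,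
        Real.exp (-w n) * (Δ k * Real.exp (-∑ l ∈ Finset.Ico (k + 1) n, w l)) := by
    refine Finset.sum_congr rfl fun k hk => ?_
    rw [h (k + 1) (Finset.mem_Ico.1 hk).2]
    ring
  rw [e]
  ring

/-- Only accumulated weights enter the solution, so irregular weights `v` may be replaced by regular
ones `w` if their sums compare on all windows ending at `n`; the slack costs the factor exp η. -/
theorem expConv_le_of_window {D : ℝ} (hD : 0 ≤ D) {Δ v w : ℕ → ℝ} {m n : ℕ} (hmn : m ≤ n)
    (hΔ : ∀ k, m ≤ k → k < n → 0 ≤ Δ k) {η : ℝ}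
    (hw : ∀ i, m ≤ i → i ≤ n → ∑ l ∈ Finset.Ico i n, w l ≤ ∑ l ∈ Finset.Ico i n, v l + η) :
    expConv D Δ v m n ≤ Real.exp η * expConv D Δ w m n := by
  have h : ∀ i, m ≤ i → i ≤ n → Real.exp (-∑ l ∈ Finset.Ico i n, v l) ≤
      Real.exp η * Real.exp (-∑ l ∈ Finset.Ico i n, w l) := by
    intro i hi hin
    rw [← Real.exp_add]
    exact Real.exp_le_exp.2 (by linarith [hw i hi hin])
  unfold expConv
  rw [mul_add, Finset.mul_sum]
  refine add_le_add ?_ (Finset.sum_le_sum fun k hk => ?_)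
  · rw [mul_left_comm]
    exact mul_le_mul_of_nonneg_left (h m le_rfl hmn) hD
  · rw [Finset.mem_Ico] at hk
    rw [mul_left_comm]
    exact mul_le_mul_of_nonneg_left (h (k + 1) (by omega) hk.2) (hΔ k hk.1 hk.2)

theorem le_expConv {d Δ v : ℕ → ℝ} {m n : ℕ} (hmn : m ≤ n) {D : ℝ} (hD : 0 ≤ D) (hdm : d m ≤ D)
    (hΔ : ∀ k, m ≤ k → k < n → 0 ≤ Δ k) (hv : ∀ k, m ≤ k → k < n → v k ≤ 1)
    (hd : ∀ k, m ≤ k → k < n → d (k + 1) ≤ (1 - v k) * d k + Δ k) :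
    d n ≤ expConv D Δ v m n := by
  have : d n ≤ expConv D Δ v m n ∧ 0 ≤ expConv D Δ v m n := by
    induction n, hmn using Nat.le_induction with
    | base => rw [expConv_self]; exact ⟨hdm, hD⟩
    | succ n hmn ih =>
      obtain ⟨h1, h2⟩ := ih (fun k a b => hΔ k a (by omega)) (fun k a b => hv k a (by omega))
        (fun k a b => hd k a (by omega))
      have h3 := hd n hmn (Nat.lt_succ_self n)
      have h4 := hΔ n hmn (Nat.lt_succ_self n)
      have h5 := hv n hmn (Nat.lt_succ_self n)
      rw [expConv_succ D Δ v hmn]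
      have h6 : 1 - v n ≤ Real.exp (-v n) := by linarith [Real.add_one_le_exp (-v n)]
      refine ⟨h3.trans (add_le_add ?_ le_rfl), by positivity⟩
      exact (mul_le_mul_of_nonneg_left h1 (by linarith)).trans (mul_le_mul_of_nonneg_right h6 h2)
  exact this.1

/-- The homogeneous part contracts at least like n^{-p} and u decays no faster than 1/n, so forcing
by the increments of u yields again a multiple of u. The multiple κ of K becomes small when p is
large; this lets the bootstrap below close. -/
theorem expConv_le_envelope {u : ℕ → ℝ} {m n : ℕ} (hmn : m ≤ n) {p κ K K0 : ℝ} (hp : 2 ≤ p)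
    (hκ : 2 ≤ κ * (p - 2)) (hm : p + 1 ≤ m) (hK : 0 ≤ K) (hK0 : 0 ≤ K0)
    (hu0 : ∀ k, m ≤ k → 0 ≤ u k) (hu1 : ∀ k, m ≤ k → u k ≤ (1 + 1 / (k : ℝ)) * u (k + 1)) :
    expConv (K0 * u m) (fun k => K * (u k - u (k + 1))) (fun l => p / ((l : ℝ) + 1)) m n ≤
      (κ * K + K0) * u n := by
  have hκ0 : 0 ≤ κ := by
    by_contra h
    push Not at h
    nlinarith
  induction n, hmn using Nat.le_induction with
  | base =>
    rw [expConv_self]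
    have := mul_nonneg (mul_nonneg hκ0 hK) (hu0 m le_rfl)
    linarith
  | succ n hmn ih =>
    rw [expConv_succ _ _ _ hmn]
    have hn : p + 1 ≤ (n : ℝ) := hm.trans (by exact_mod_cast hmn)
    have hn0 : (0 : ℝ) < n := by linarith
    set t : ℝ := (n : ℝ) with ht
    have h1 : Real.exp (-(p / (t + 1))) ≤ (t + 1) / (t + 1 + p) := by
      rw [Real.exp_neg, inv_le_comm₀ (Real.exp_pos _) (by positivity), inv_div]
      have := Real.add_one_le_exp (p / (t + 1))
      calc (t + 1 + p) / (t + 1) = p / (t + 1) + 1 := by field_simp; ring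
        _ ≤ _ := this
    have hun := hu0 n hmn
    have hun1 := hu0 (n + 1) (by omega)
    have hθ := hu1 n hmn
    rw [← ht] at hθ
    set κ' := κ * K + K0 with hκ'
    have hκ'0 : 0 ≤ κ' := by positivity
    have h2 : Real.exp (-(p / (t + 1))) *
        expConv (K0 * u m) (fun k => K * (u k - u (k + 1))) (fun l => p / ((l : ℝ) + 1)) m n ≤
        (t + 1) / (t + 1 + p) * (κ' * ((1 + 1 / t) * u (n + 1))) := by
      refine (mul_le_mul_of_nonneg_left ih (Real.exp_nonneg _)).trans ?_
      refine mul_le_mul h1 (mul_le_mul_of_nonneg_left hθ hκ'0) (by positivity) (by positivity)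
    have h3 : K * (u n - u (n + 1)) ≤ K * (1 / t * u (n + 1)) :=
      mul_le_mul_of_nonneg_left (by linarith) hK
    -- The gain equals (t(p-1) - 1) / (t(t+1+p)). Since t ≥ p + 1 it is at least (p-2)/(2t), and
    -- κ(p-2) ≥ 2 then covers 1/t.
    have h4 : K * (1 / t) ≤ κ' * (1 - (t + 1) / (t + 1 + p) * (1 + 1 / t)) := by
      have h5 : 1 / t ≤ κ * (1 - (t + 1) / (t + 1 + p) * (1 + 1 / t)) := by
        have e : κ * (1 - (t + 1) / (t + 1 + p) * (1 + 1 / t)) =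
            κ * (t * (p - 1) - 1) / (t * (t + 1 + p)) := by
          field_simp
          ring
        rw [e, div_le_div_iff₀ hn0 (by positivity)]
        have h6 : t * (p - 2) ≤ t * (p - 1) - 1 := by linarith
        have h7 : 2 * t ≤ κ * (t * (p - 1) - 1) := by
          calc 2 * t ≤ κ * (p - 2) * t := mul_le_mul_of_nonneg_right hκ hn0.le
            _ = κ * (t * (p - 2)) := by ring
            _ ≤ _ := mul_le_mul_of_nonneg_left h6 hκ0
        nlinarith
      have h8 : 0 ≤ 1 - (t + 1) / (t + 1 + p) * (1 + 1 / t) := by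
        by_contra h
        push Not at h
        have : 0 < 1 / t := by positivity
        nlinarith
      calc K * (1 / t) ≤ K * (κ * (1 - (t + 1) / (t + 1 + p) * (1 + 1 / t))) :=
            mul_le_mul_of_nonneg_left h5 hK
        _ = (κ * K) * (1 - (t + 1) / (t + 1 + p) * (1 + 1 / t)) := by ring
        _ ≤ _ := mul_le_mul_of_nonneg_right (by linarith) h8
    have h9 := mul_le_mul_of_nonneg_right h4 hun1
    calc _ ≤ (t + 1) / (t + 1 + p) * (κ' * ((1 + 1 / t) * u (n + 1))) +
          K * (1 / t * u (n + 1)) := add_le_add h2 h3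
      _ = κ' * u (n + 1) + (K * (1 / t) * u (n + 1) -
          κ' * (1 - (t + 1) / (t + 1 + p) * (1 + 1 / t)) * u (n + 1)) := by ring
      _ ≤ _ := by linarith

/-- Asynchronous contraction: if every coordinate is updated sufficiently often, then the
iterates decay at the rate of the perturbation `u`. -/
theorem asynchronous_contraction {ι : Type*} {y v : ℕ → ι → ℝ} {u : ℕ → ℝ} {m T : ℕ}
    {ρ ε g K0 p : ℝ} (hρ : ρ ∈ Set.Ioo (0 : ℝ) 1) (hg : 0 ≤ g) (hK0 : 0 ≤ K0)
    (hp : 2 + 12 / (1 - ρ) ≤ p) (hm : p + 1 ≤ m)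
    (hu0 : ∀ k, m ≤ k → 0 ≤ u k) (hu2 : ∀ k, m ≤ k → u (k + 1) ≤ u k)
    (hu1 : ∀ k, m ≤ k → u k ≤ (1 + 1 / (k : ℝ)) * u (k + 1))
    (hv1 : ∀ k, m ≤ k → k < T → ∀ i, v k i ≤ 1)
    (hw : ∀ i a b, m ≤ a → a ≤ b → b ≤ T →
      ∑ l ∈ Finset.Ico a b, p / ((l : ℝ) + 1) ≤ ∑ l ∈ Finset.Ico a b, v l i + 1)
    (hy : ∀ k, m ≤ k → k < T → ∀ B, (∀ j, y k j ≤ B) → ∀ i,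
      y (k + 1) i ≤ (1 - v k i) * y k i + v k i * (ρ * B + ε + g * u k))
    (hym : ∀ i, y m i ≤ ε / (1 - ρ) + K0 * u m) {n : ℕ} (hmn : m ≤ n) (hnT : n ≤ T) (i : ι) :
    y n i ≤ ε / (1 - ρ) + 2 / (1 - ρ) * (3 * K0 + 2 * g) * u n := by
  have h1ρ : 0 < 1 - ρ := by linarith [hρ.2]
  have hp2 : 2 ≤ p := by
    have : 0 ≤ 12 / (1 - ρ) := by positivity
    linarith
  set K := 2 / (1 - ρ) * (3 * K0 + 2 * g) with hK
  have hKeq : (1 - ρ) / 2 * K = 3 * K0 + 2 * g := by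
    rw [hK]
    field_simp
  have hKnn : 0 ≤ K := by positivity
  set K' := ρ * K + g with hK'
  have hK'nn : 0 ≤ K' := add_nonneg (mul_nonneg hρ.1.le hKnn) hg
  have hκ : 2 ≤ (1 - ρ) / 6 * (p - 2) := by
    have : (1 - ρ) / 6 * (12 / (1 - ρ)) = 2 := by field_simp; norm_num
    rw [← this]
    exact mul_le_mul_of_nonneg_left (by linarith) (by linarith)
  -- The bound at all earlier times and all coordinates feeds the term ρ B of the recursion.
  induction n using Nat.strong_induction_on generalizing i with
  | _ n ih =>
    -- Distance to the moving target ε/(1-ρ) + K' u; since the target moves, its decrements K'(u_k -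
    -- u_{k+1}) appear as forcing.
    set d : ℕ → ℝ := fun k => y k i - ε / (1 - ρ) - K' * u k with hd
    have hK0u := mul_nonneg hK0 (hu0 m le_rfl)
    have hΔ : ∀ k, m ≤ k → k < n → 0 ≤ K' * (u k - u (k + 1)) := fun k hk _ =>
      mul_nonneg hK'nn (by linarith [hu2 k hk])
    have h1 : d n ≤ expConv (K0 * u m) (fun k => K' * (u k - u (k + 1))) (fun k => v k i) m n := by
      refine le_expConv hmn hK0u ?_ hΔ (fun k h1 h2 => hv1 k h1 (by omega) i) fun k h1 h2 => ?_
      · have := mul_nonneg hK'nn (hu0 m le_rfl)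
        simp only [hd]
        linarith [hym i]
      · have h3 := hy k h1 (by omega) _ (fun j => ih k h2 h1 (by omega) j) i
        have e : ρ * (ε / (1 - ρ) + K * u k) + ε + g * u k = ε / (1 - ρ) + K' * u k := by
          rw [hK']
          field_simp
          ring
        rw [e] at h3
        simp only [hd]
        linarith
    have h2 := expConv_le_of_window (v := fun k => v k i) hK0u hmn hΔ
      (fun a ha han => hw i a n ha han hnT)
    have h3 := expConv_le_envelope hmn hp2 hκ hm hK'nn hK0 hu0 hu1
    have h4 : d n ≤ 3 * (((1 - ρ) / 6 * K' + K0) * u n) := by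
      refine h1.trans (h2.trans ?_)
      have he : Real.exp 1 ≤ 3 := by linarith [Real.exp_one_lt_d9]
      have hnn : 0 ≤ ((1 - ρ) / 6 * K' + K0) * u n :=
        mul_nonneg (by positivity) (hu0 n hmn)
      exact (mul_le_mul_of_nonneg_left h3 (Real.exp_nonneg _)).trans
        (mul_le_mul_of_nonneg_right he hnn)
    -- The bootstrap closes: exp 1 ≤ 3 times (1-ρ)/6 costs (1-ρ)/2, and ρ(1 + (1-ρ)/2) ≤ (1+ρ)/2 is
    -- (1-ρ)² ≥ 0. The remaining (1-ρ)/2 · K equals 3 K0 + 2 g by the choice of K.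
    have h5 : K' + 3 * ((1 - ρ) / 6 * K' + K0) ≤ K := by
      have h6 : K' * (1 + (1 - ρ) / 2) ≤ (1 + ρ) / 2 * K + 2 * g := by
        rw [hK']
        nlinarith [hρ.1, mul_nonneg hKnn h1ρ.le, mul_nonneg hg hρ.1.le,
          mul_nonneg (mul_nonneg hKnn h1ρ.le) h1ρ.le]
      linarith
    have h7 := mul_le_mul_of_nonneg_right h5 (hu0 n hmn)
    simp only [hd] at h4
    linarith

end Recursion

/-! ### A Lyapunov function from communication -/

section Communicating

theorem exists_pos_le_of_pos {ι : Type*} [Finite ι] (f : ι → ℝ) :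
    ∃ c : ℝ, 0 < c ∧ ∀ i, 0 < f i → c ≤ f i := by
  classical
  rcases isEmpty_or_nonempty ι with h | h
  · exact ⟨1, one_pos, fun i => (h.false i).elim⟩
  · obtain ⟨i, hi⟩ := Finite.exists_min fun i => if 0 < f i then f i else 1
    refine ⟨if 0 < f i then f i else 1, by split_ifs <;> first | assumption | norm_num,
      fun j hj => ?_⟩
    have := hi j
    rwa [if_pos hj] at this

variable {S A : Type*} [Fintype S] [DecidableEq S] [Fintype A]

namespace MeanFieldGame

variable (G : MeanFieldGame S A)

open Classical in
/-- The matrix with entry `κ` where a transition is possible under some action. -/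
noncomputable def supportKernel (κ : ℝ) (μ : S → ℝ) : Matrix S S ℝ := fun s j =>
  if ∃ a, 0 < G.P s a μ j then κ else 0

theorem supportKernel_nonneg {κ : ℝ} (hκ : 0 ≤ κ) (μ : S → ℝ) (s j : S) :
    0 ≤ G.supportKernel κ μ s j := by
  unfold supportKernel
  split_ifs <;> simp [hκ]

theorem supportKernel_pow_nonneg {κ : ℝ} (hκ : 0 ≤ κ) (μ : S → ℝ) (n : ℕ) (s j : S) :
    0 ≤ (G.supportKernel κ μ ^ n) s j := by
  induction n generalizing s j with
  | zero =>
    rw [pow_zero, Matrix.one_apply]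
    split_ifs <;> simp
  | succ n ih =>
    rw [pow_succ, Matrix.mul_apply]
    exact Finset.sum_nonneg fun i _ => mul_nonneg (ih s i) (G.supportKernel_nonneg hκ μ i j)

theorem reachProb_nonneg {μ : S → ℝ} (hμ : μ ∈ stdSimplex ℝ S) (b : ℕ → A) (s : S) (n : ℕ)
    (j : S) : 0 ≤ G.reachProb μ b s n j := by
  induction n generalizing j with
  | zero =>
    simp only [reachProb]
    split_ifs <;> simp
  | succ n ih => exact Finset.sum_nonneg fun i _ => mul_nonneg (ih i) ((G.P_mem _ _ _ hμ).1 j)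

/-- A path of positive probability exists under `b`, and `supportKernel` gives each of its
transitions weight κ. The matrix records possible transitions only, so it does not depend on which
actions realize them. -/
theorem pow_le_supportKernel_pow {κ : ℝ} (hκ : 0 ≤ κ) {μ : S → ℝ} (hμ : μ ∈ stdSimplex ℝ S)
    (b : ℕ → A) (s : S) (n : ℕ) (j : S) (h : 0 < G.reachProb μ b s n j) :
    κ ^ n ≤ (G.supportKernel κ μ ^ n) s j := by
  induction n generalizing j with
  | zero =>
    simp only [reachProb] at h
    split_ifs at h with hj
    · simp [hj]
    · exact absurd h (lt_irrefl _)
  | succ n ih =>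
    simp only [reachProb] at h
    obtain ⟨i, -, hi⟩ := Finset.exists_lt_of_sum_lt (s := Finset.univ) (f := fun _ => (0 : ℝ))
      (g := fun i => G.reachProb μ b s n i * G.P i (b n) μ j) (by simpa using h)
    have h1 := G.reachProb_nonneg hμ b s n i
    have h2 := (G.P_mem i (b n) μ hμ).1 j
    have h3 : 0 < G.reachProb μ b s n i := pos_of_mul_pos_left hi h2
    have h4 : 0 < G.P i (b n) μ j := pos_of_mul_pos_right hi h1
    rw [pow_succ, pow_succ, Matrix.mul_apply]
    have h5 : G.supportKernel κ μ i j = κ := if_pos ⟨b n, h4⟩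
    calc κ ^ n * κ ≤ (G.supportKernel κ μ ^ n) s i * G.supportKernel κ μ i j := by
          rw [h5]
          exact mul_le_mul_of_nonneg_right (ih i h3) hκ
      _ ≤ _ := Finset.single_le_sum
          (f := fun i => (G.supportKernel κ μ ^ n) s i * G.supportKernel κ μ i j)
          (fun i _ => mul_nonneg (G.supportKernel_pow_nonneg hκ μ n s i)
            (G.supportKernel_nonneg hκ μ i j)) (Finset.mem_univ i)

/-- Weighted occupation of the state `z` before the horizon `H`, started from `s`. -/
noncomputable def lyapunov (κ : ℝ) (H : ℕ) (μ : S → ℝ) (z s : S) : ℝ :=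
  ∑ n ∈ Finset.range H, (G.supportKernel κ μ ^ n) s z

theorem lyapunov_nonneg {κ : ℝ} (hκ : 0 ≤ κ) (H : ℕ) (μ : S → ℝ) (z s : S) :
    0 ≤ G.lyapunov κ H μ z s :=
  Finset.sum_nonneg fun n _ => G.supportKernel_pow_nonneg hκ μ n s z

/-- Multiplication by the matrix shifts the truncated Neumann series by one: the term of order 0 is
lost and that of order H is gained. -/
theorem sum_supportKernel_mul_lyapunov (κ : ℝ) (H : ℕ) (μ : S → ℝ) (z s : S) :
    ∑ j, G.supportKernel κ μ s j * G.lyapunov κ H μ z j =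
      G.lyapunov κ H μ z s + (G.supportKernel κ μ ^ H) s z - if s = z then 1 else 0 := by
  have h1 : ∑ j, G.supportKernel κ μ s j * G.lyapunov κ H μ z j =
      ∑ n ∈ Finset.range H, (G.supportKernel κ μ ^ (n + 1)) s z := by
    simp only [lyapunov, Finset.mul_sum]
    rw [Finset.sum_comm]
    refine Finset.sum_congr rfl fun n _ => ?_
    rw [pow_succ', Matrix.mul_apply]
  have h2 := Finset.sum_range_succ (fun n => (G.supportKernel κ μ ^ n) s z) H
  rw [Finset.sum_range_succ', pow_zero, Matrix.one_apply] at h2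
  rw [h1, lyapunov]
  linarith

/-- The net and the state space are finite, so one H serves all triples (μ, s, z). This needs
positive reachability at every large time, not only at some time. -/
theorem Communicating.exists_lyapunov {G : MeanFieldGame S A} {net : Finset (S → ℝ)}
    (hnet : ∀ μ ∈ net, μ ∈ stdSimplex ℝ S) (hcomm : G.Communicating net) {κ : ℝ} (hκ : 0 ≤ κ) :
    ∃ (H : ℕ) (F : ℝ), 0 ≤ F ∧ ∀ μ ∈ net, ∀ z s, G.lyapunov κ H μ z s ≤ F ∧
      (G.lyapunov κ H μ z s + κ ^ H - if s = z then 1 else 0) ≤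
        ∑ j, G.supportKernel κ μ s j * G.lyapunov κ H μ z j := by
  choose N hN using fun i : net × S × S => hcomm i.1.1 i.1.2 i.2.1 i.2.2
  obtain ⟨H, hH⟩ := (Set.finite_range N).bddAbove
  obtain ⟨F, hF⟩ := (Set.finite_range fun i : net × S × S =>
    G.lyapunov κ H i.1.1 i.2.1 i.2.2).bddAbove
  refine ⟨H, max F 0, le_max_right _ _, fun μ hμ z s => ⟨?_, ?_⟩⟩
  · exact (hF ⟨(⟨μ, hμ⟩, z, s), rfl⟩).trans (le_max_left _ _)
  · obtain ⟨b, hb⟩ := hN (⟨μ, hμ⟩, s, z) H (hH ⟨_, rfl⟩)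
    have := G.pow_le_supportKernel_pow hκ (hnet μ hμ) b s H z hb
    rw [G.sum_supportKernel_mul_lyapunov]
    linarith

end MeanFieldGame

end Communicating

/-! ### Noise, visit counts and table growth within an episode -/

section EpisodeProcesses

variable {S A : Type*} [Fintype S] [DecidableEq S] [Nonempty S] [Fintype A] [DecidableEq A]
  [Nonempty A]

namespace Sandbox

variable {X : Sandbox S A} {net : Finset (S → ℝ)}

theorem abs_stepMean_le (hX : X.IsStochastic) {n : ℕ} {f : (ℕ → S) → (ℕ → A) → ℝ} {c : ℝ}
    (hf : ∀ x y, |f x y| ≤ c) (x : ℕ → S) (y : ℕ → A) : |X.stepMean n f x y| ≤ c := by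
  obtain ⟨h1, h2⟩ := hX x y n
  unfold stepMean
  refine (Finset.abs_sum_le_sum_abs _ _).trans ?_
  calc _ ≤ ∑ b, ∑ j, X.stepProb x y n b j * c := by
        refine Finset.sum_le_sum fun b _ => (Finset.abs_sum_le_sum_abs _ _).trans
          (Finset.sum_le_sum fun j _ => ?_)
        rw [abs_mul, abs_of_nonneg (h1 b j)]
        exact mul_le_mul_of_nonneg_left (hf _ _) (h1 b j)
    _ = c := by simp only [← Finset.sum_mul, h2, one_mul]

theorem stepMean_mul_left {n : ℕ} {f g : (ℕ → S) → (ℕ → A) → ℝ} (hg : DependsOnPrefix n g)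
    (x : ℕ → S) (y : ℕ → A) :
    X.stepMean n (fun x y => g x y * f x y) x y = g x y * X.stepMean n f x y := by
  simp only [stepMean, Finset.mul_sum]
  refine Finset.sum_congr rfl fun b _ => Finset.sum_congr rfl fun j _ => ?_
  rw [hg _ x _ y (fun m hm => Function.update_of_ne (by omega) _ _)
    (fun m hm => Function.update_of_ne (by omega) _ _)]
  ring

theorem stepMean_sub_self (hX : X.IsStochastic) {n : ℕ} {f : (ℕ → S) → (ℕ → A) → ℝ}
    (hf : DependsOnPrefix (n + 1) f) (x : ℕ → S) (y : ℕ → A) :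
    X.stepMean n (fun x y => f x y - X.stepMean n f x y) x y = 0 := by
  have h1 : X.stepMean n (fun x y => f x y - X.stepMean n f x y) x y =
      X.stepMean n f x y - (∑ b, ∑ j, X.stepProb x y n b j) * X.stepMean n f x y := by
    conv_lhs => rw [stepMean]
    conv_rhs => enter [1]; rw [stepMean]
    simp only [Finset.sum_mul, ← Finset.sum_sub_distrib]
    refine Finset.sum_congr rfl fun b _ => Finset.sum_congr rfl fun j _ => ?_
    rw [X.stepMean_dependsOnPrefix hf _ x _ y (fun m hm => Function.update_of_ne (by omega) _ _)
      (fun m hm => Function.update_of_ne (by omega) _ _)]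
    ring
  rw [h1, (hX x y n).2, one_mul, sub_self]

/-- Indicator of the pair `(z, c)` being updated at clock time `n`. -/
def hit (z : S) (c : A) (n : ℕ) (x : ℕ → S) (y : ℕ → A) : ℝ :=
  if x n = z ∧ y n = c then 1 else 0

theorem hit_mem (z : S) (c : A) (n : ℕ) (x : ℕ → S) (y : ℕ → A) :
    0 ≤ hit z c n x y ∧ hit z c n x y ≤ 1 := by
  unfold hit
  split_ifs <;> simp

theorem hit_dependsOnPrefix (z : S) (c : A) (n : ℕ) : DependsOnPrefix (n + 1) (hit z c n) := by
  intro x x' y y' hx hy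
  simp only [hit, hx n (by omega), hy n (by omega)]

/-- The value of the state `j` for the table held at clock time `n`. -/
noncomputable def stateValue (X : Sandbox S A) (x : ℕ → S) (y : ℕ → A) (n : ℕ) (j : S) : ℝ :=
  ⨆ a', (X.mem x y n).Q j a'

theorem stateValue_dependsOnPrefix (X : Sandbox S A) (n : ℕ) :
    DependsOnPrefix n (fun x y => X.stateValue x y n) := by
  intro x x' y y' hx hy
  have := X.mem_dependsOnPrefix n x x' y y' hx hy
  simp only at this
  funext j
  simp only [stateValue, this]

theorem abs_stateValue_le (X : Sandbox S A) (x : ℕ → S) (y : ℕ → A) (n : ℕ) (j : S) :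
    |X.stateValue x y n j| ≤ ‖(X.mem x y n).Q‖ :=
  abs_iSup_le fun a' => abs_apply_le_norm _ j a'

/-- The sampling noise in the update of `(z, c)` at clock time `n`. -/
noncomputable def noise (X : Sandbox S A) (z : S) (c : A) (n : ℕ) (x : ℕ → S) (y : ℕ → A) : ℝ :=
  hit z c n x y * (X.game.ρ * (X.stateValue x y n (x (n + 1)) -
    ∑ j, X.game.P z c (X.mfAt x y n) j * X.stateValue x y n j))

theorem noise_dependsOnPrefix (X : Sandbox S A) (z : S) (c : A) (n : ℕ) :
    DependsOnPrefix (n + 1) (X.noise z c n) := by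
  intro x x' y y' hx hy
  have h1 := hit_dependsOnPrefix z c n x x' y y' hx hy
  have h2 := (X.stateValue_dependsOnPrefix n).mono (Nat.le_succ n) x x' y y' hx hy
  have h3 := (X.mfAt_dependsOnPrefix n).mono (Nat.le_succ n) x x' y y' hx hy
  simp only at h2 h3
  simp only [noise, h1, h2, h3, hx (n + 1) le_rfl]

theorem Regular.abs_noise_le (hX : X.Regular net) (z : S) (c : A) (n : ℕ) (x : ℕ → S)
    (y : ℕ → A) : |X.noise z c n x y| ≤ 2 * ‖(X.mem x y n).Q‖ := by
  have hρ := X.game.ρ_mem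
  have h1 := hit_mem z c n x y
  have h2 := X.abs_stateValue_le x y n
  have h3 := abs_sum_mul_le_of_mem_stdSimplex (X.game.P_mem z c _ (hX.mfAt_mem x y n)) h2
  unfold noise
  rw [abs_mul, abs_mul, abs_of_nonneg h1.1, abs_of_pos hρ.1]
  have h4 : |X.stateValue x y n (x (n + 1)) -
      ∑ j, X.game.P z c (X.mfAt x y n) j * X.stateValue x y n j| ≤ 2 * ‖(X.mem x y n).Q‖ := by
    refine (abs_sub _ _).trans ?_
    linarith [h2 (x (n + 1))]
  have h5 := (mul_le_of_le_one_left (abs_nonneg _) hρ.2.le).trans h4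
  exact (mul_le_of_le_one_left (mul_nonneg hρ.1.le (abs_nonneg _)) h1.2).trans h5

/-- Once the pair (z, c) is played, the next state has law P(· ∣ z, c, μ_n) with the current
mean-field, and the table is already determined by the past. -/
theorem Regular.stepMean_noise (hX : X.Regular net) (z : S) (c : A) (n : ℕ) (x : ℕ → S)
    (y : ℕ → A) : X.stepMean n (X.noise z c n) x y = 0 := by
  unfold stepMean
  refine Finset.sum_eq_zero fun b _ => ?_
  have hu : ∀ j, ∀ m ≤ n, Function.update x (n + 1) j m = x m := fun j m hm =>
    Function.update_of_ne (by omega) _ _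
  have hv : ∀ m < n, Function.update y n b m = y m := fun m hm =>
    Function.update_of_ne (by omega) _ _
  have e : ∀ j, X.noise z c n (Function.update x (n + 1) j) (Function.update y n b) =
      (if x n = z ∧ b = c then 1 else 0) * (X.game.ρ * (X.stateValue x y n j -
        ∑ j, X.game.P z c (X.mfAt x y n) j * X.stateValue x y n j)) := by
    intro j
    have h2 := X.stateValue_dependsOnPrefix n _ x _ y (hu j) hv
    have h3 := X.mfAt_dependsOnPrefix n _ x _ y (hu j) hv
    simp only at h2 h3
    simp only [noise, hit, h2, h3, hu j n le_rfl, Function.update_self]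
  simp only [e]
  split_ifs with h
  · obtain ⟨h1, rfl⟩ := h
    simp only [stepProb, h1]
    set v := X.stateValue x y n
    set p := X.game.P z b (X.mfAt x y n) with hp
    have hs : ∑ j, p j = 1 := (X.game.P_mem z b _ (hX.mfAt_mem x y n)).2
    set m := ∑ j, p j * v j with hm
    calc _ = X.polAt x y n z (X.mfAt x y n) b * X.game.ρ *
          (∑ j, p j * v j - (∑ j, p j) * m) := by
          rw [Finset.sum_mul, ← Finset.sum_sub_distrib, Finset.mul_sum]
          exact Finset.sum_congr rfl fun j _ => by ring
      _ = 0 := by rw [hs, ← hm]; ring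
  · simp

/-- Lower bound for the action probabilities. -/
noncomputable def minProb (X : Sandbox S A) : ℝ :=
  X.sched.cπ * X.sched.ψ / (Fintype.card A : ℝ)

theorem Regular.minProb_mem (hX : X.Regular net) : 0 < X.minProb ∧ X.minProb ≤ 1 := by
  have hc := hX.adm.cπ_mem
  have hψ := hX.adm.ψ_mem
  have hA : (1 : ℝ) ≤ Fintype.card A := by exact_mod_cast Fintype.card_pos
  unfold minProb
  refine ⟨div_pos (mul_pos hc.1 hψ.1) (by linarith), ?_⟩
  rw [div_le_one (by linarith)]
  nlinarith [hc.1, hc.2, hψ.1, hψ.2]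

/-- The function whose conditional drift counts the visits of `(z, c)`. -/
noncomputable def visitPotential (X : Sandbox S A) (κ : ℝ) (H n₀ : ℕ) (z : S) (c : A) (n : ℕ)
    (x : ℕ → S) (y : ℕ → A) : ℝ :=
  hit z c n x y + X.minProb * X.game.lyapunov κ H (X.mfAt x y n₀) z (x (n + 1))

theorem visitPotential_dependsOnPrefix (X : Sandbox S A) (κ : ℝ) (H : ℕ) {n₀ : ℕ} (z : S) (c : A)
    {n : ℕ} (hn : n₀ ≤ n) : DependsOnPrefix (n + 1) (X.visitPotential κ H n₀ z c n) := by
  intro x x' y y' hx hy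
  have h1 := hit_dependsOnPrefix z c n x x' y y' hx hy
  have h3 := (X.mfAt_dependsOnPrefix n₀).mono (hn.trans (Nat.le_succ n)) x x' y y' hx hy
  simp only at h3
  simp only [visitPotential, h1, h3, hx (n + 1) le_rfl]

/-- The conditional probability of a hit is at least π₀ 1_z. Where a transition is possible at the
frozen mean-field, the current kernel is still at least p₀ - p₀/2; together with the exploration
floor the one-step law dominates `supportKernel` with κ = π₀ p₀/2. Inserting the Lyapunov inequality
cancels the term 1_z. -/
theorem Regular.le_stepMean_visitPotential (hX : X.Regular net) {κ p₀ : ℝ} {H n₀ n : ℕ}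
    (hn : n₀ ≤ n) {z : S} {c : A} {x : ℕ → S} {y : ℕ → A} (hp₀ : 0 ≤ p₀)
    (hκ : κ = X.minProb * (p₀ / 2))
    (hP : ∀ s a s', 0 < X.game.P s a (X.mfAt x y n₀) s' → p₀ ≤ X.game.P s a (X.mfAt x y n₀) s')
    (hclose : ∀ s a, l1Dist (X.game.P s a (X.mfAt x y n)) (X.game.P s a (X.mfAt x y n₀)) ≤ p₀ / 2)
    (hL : (X.game.lyapunov κ H (X.mfAt x y n₀) z (x n) + κ ^ H - if x n = z then 1 else 0) ≤
      ∑ j, X.game.supportKernel κ (X.mfAt x y n₀) (x n) j *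
        X.game.lyapunov κ H (X.mfAt x y n₀) z j) :
    X.minProb * (X.game.lyapunov κ H (X.mfAt x y n₀) z (x n) + κ ^ H) ≤
      X.stepMean n (X.visitPotential κ H n₀ z c n) x y := by
  set μ := X.mfAt x y n₀ with hμ
  set μn := X.mfAt x y n with hμn
  set f := X.game.lyapunov κ H μ z with hf
  set π := X.polAt x y n (x n) μn with hπ
  have hκ0 : 0 ≤ κ := hκ ▸ mul_nonneg hX.minProb_mem.1.le (by linarith)
  have hf0 : ∀ j, 0 ≤ f j := fun j => X.game.lyapunov_nonneg hκ0 H μ z j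
  have hμm := hX.mfAt_mem x y n
  have hPm := fun b => X.game.P_mem (x n) b _ hμm
  have hπge : ∀ b, X.minProb ≤ π b := fun b => hX.le_polAt x y n (x n) hμm b
  have e : X.stepMean n (X.visitPotential κ H n₀ z c n) x y =
      (if x n = z then π c else 0) +
        X.minProb * ∑ j, (∑ b, π b * X.game.P (x n) b μn j) * f j := by
    have e1 : ∀ b j, X.visitPotential κ H n₀ z c n (Function.update x (n + 1) j)
        (Function.update y n b) = (if x n = z ∧ b = c then 1 else 0) + X.minProb * f j := by
      intro b j
      have h3 := X.mfAt_dependsOnPrefix n₀ (Function.update x (n + 1) j) x (Function.update y n b) y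
        (fun m hm => Function.update_of_ne (by omega) _ _)
        (fun m hm => Function.update_of_ne (by omega) _ _)
      simp only at h3
      simp only [visitPotential, hit, h3, Function.update_self,
        Function.update_of_ne (show n ≠ n + 1 by omega), hf, hμ]
    have e2 : ∑ b, ∑ j, π b * X.game.P (x n) b μn j * (if x n = z ∧ b = c then (1 : ℝ) else 0) =
        if x n = z then π c else 0 := by
      rw [Finset.sum_eq_single c]
      · rw [← Finset.sum_mul, ← Finset.mul_sum, (hPm c).2]
        split_ifs <;> simp_all
      · intro b _ hb
        simp [hb]
      · simp
    simp only [stepMean, e1, stepProb, mul_add, Finset.sum_add_distrib]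
    rw [← e2]
    congr 1
    rw [Finset.sum_comm, Finset.mul_sum]
    refine Finset.sum_congr rfl fun j _ => ?_
    rw [Finset.sum_mul, Finset.mul_sum]
    exact Finset.sum_congr rfl fun b _ => by ring
  have h1 : X.minProb * (if x n = z then 1 else 0) ≤ if x n = z then π c else 0 := by
    split_ifs
    · simpa using hπge c
    · simp
  have h2 : ∑ j, X.game.supportKernel κ μ (x n) j * f j ≤
      ∑ j, (∑ b, π b * X.game.P (x n) b μn j) * f j := by
    refine Finset.sum_le_sum fun j _ => mul_le_mul_of_nonneg_right ?_ (hf0 j)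
    have hnn : ∀ b, 0 ≤ π b * X.game.P (x n) b μn j := fun b =>
      mul_nonneg (hX.minProb_mem.1.le.trans (hπge b)) ((hPm b).1 j)
    unfold MeanFieldGame.supportKernel
    split_ifs with h
    · obtain ⟨b, hb⟩ := h
      have h3 := hP _ _ _ hb
      have h4 := (abs_sub_le_l1Dist (X.game.P (x n) b μn) (X.game.P (x n) b μ) j).trans
        (hclose (x n) b)
      have h5 := (abs_le.1 h4).1
      refine le_trans ?_ (Finset.single_le_sum (fun b _ => hnn b) (Finset.mem_univ b))
      rw [hκ]
      exact mul_le_mul (hπge b) (by linarith) (by linarith) (hX.minProb_mem.1.le.trans (hπge b))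
    · exact Finset.sum_nonneg fun b _ => hnn b
  rw [e]
  have h3 := mul_le_mul_of_nonneg_left (hL.trans h2) hX.minProb_mem.1.le
  rw [mul_sub] at h3
  linarith

theorem Regular.abs_visitPotential_le (hX : X.Regular net) {κ F : ℝ} {H n₀ : ℕ} (hκ0 : 0 ≤ κ)
    {z : S} {c : A} (hF : ∀ x y s, X.game.lyapunov κ H (X.mfAt x y n₀) z s ≤ F) (n : ℕ)
    (x : ℕ → S) (y : ℕ → A) : |X.visitPotential κ H n₀ z c n x y| ≤ 1 + F := by
  have h1 := hit_mem z c n x y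
  have h2 := X.game.lyapunov_nonneg hκ0 H (X.mfAt x y n₀) z (x (n + 1))
  have h3 := hF x y (x (n + 1))
  have h4 := hX.minProb_mem
  have h5 := (mul_le_of_le_one_left h2 h4.2).trans h3
  have h6 := mul_nonneg h4.1.le h2
  unfold visitPotential
  rw [abs_of_nonneg (add_nonneg h1.1 h6)]
  linarith [h1.2]

end Sandbox

/-- The step size at the `j`-th update of an episode, counted from `0`. -/
noncomputable def stepSize (cβ ν : ℝ) (j : ℕ) : ℝ := cβ / ((j : ℝ) + 2) ^ ν

theorem Schedule.rateβ_succ (h : Schedule) (j : ℕ) : h.rateβ (j + 1) = stepSize h.cβ h.ν j := by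
  unfold Schedule.rateβ stepSize
  push_cast
  rw [add_assoc]
  norm_num

theorem stepSize_pos {cβ ν : ℝ} (hc : 0 < cβ) (j : ℕ) : 0 < stepSize cβ ν j := by
  unfold stepSize
  positivity

theorem stepSize_antitone {cβ ν : ℝ} (hc : 0 < cβ) (hν : 0 ≤ ν) (j : ℕ) :
    stepSize cβ ν (j + 1) ≤ stepSize cβ ν j := by
  unfold stepSize
  push_cast
  gcongr
  linarith

theorem stepSize_le {cβ ν : ℝ} (hc : 0 < cβ) (hν : 0 ≤ ν) (j : ℕ) : stepSize cβ ν j ≤ cβ := by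
  unfold stepSize
  exact div_le_self hc.le (Real.one_le_rpow (by linarith [Nat.cast_nonneg (α := ℝ) j]) hν)

theorem Sandbox.mem_Q_succ (X : Sandbox S A) (x : ℕ → S) (y : ℕ → A) {n₀ k : ℕ}
    (hk : n₀ = k * X.T) {l : ℕ} (hl : l < X.T) :
    (X.mem x y (n₀ + l + 1)).Q = qUpdate X.game.ρ (stepSize X.sched.cβ X.sched.ν l)
      (X.mem x y (n₀ + l)).Q (x (n₀ + l)) (y (n₀ + l))
      (X.game.R (x (n₀ + l)) (y (n₀ + l)) (X.mfAt x y (n₀ + l))) (x (n₀ + l + 1)) := by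
  rw [← Schedule.rateβ_succ]
  conv_rhs => rw [← X.st_add hk hl]
  rfl

/-- At most t₀ steps per episode have step size above 1, each costing a factor at most 1 + 2 c_β.
Hence the bound does not involve T. -/
theorem Sandbox.Regular.norm_Q_le {X : Sandbox S A} {net : Finset (S → ℝ)} (hX : X.Regular net)
    (hc : 0 < X.sched.cβ) {t₀ : ℕ} (ht₀ : ∀ j ≥ t₀, stepSize X.sched.cβ X.sched.ν j ≤ 1)
    (x : ℕ → S) (y : ℕ → A) {n₀ k : ℕ} (hk : n₀ = k * X.T) {l : ℕ} (hl : l ≤ X.T) :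
    ‖(X.mem x y (n₀ + l)).Q‖ ≤
      (1 + 2 * X.sched.cβ) ^ t₀ / (1 - X.game.ρ) * (1 + ‖(X.mem x y n₀).Q‖) := by
  have hρ := X.game.ρ_mem
  have h1ρ : 0 < 1 - X.game.ρ := by linarith [hρ.2]
  have hν : 0 ≤ X.sched.ν := by linarith [hX.adm.ν_mem.1]
  set B : ℕ → ℝ := fun l => max ‖(X.mem x y (n₀ + l)).Q‖ (1 / (1 - X.game.ρ)) with hB
  have hBnn : ∀ l, 0 ≤ B l := fun l => (norm_nonneg _).trans (le_max_left _ _)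
  have key : B l ≤ (1 + 2 * X.sched.cβ) ^ (min l t₀) * B 0 := by
    induction l with
    | zero => simp
    | succ l ih =>
      have ih' := ih (by omega)
      have hβ := stepSize_pos hc (ν := X.sched.ν) l
      have h1 := norm_qUpdate_le (A := A) hρ hβ.le (X.mem x y (n₀ + l)).Q (x (n₀ + l)) (y (n₀ + l))
        (X.game.R_mem (x (n₀ + l)) (y (n₀ + l)) _ (hX.mfAt_mem x y (n₀ + l))) (x (n₀ + l + 1))
      have e := X.mem_Q_succ x y hk (show l < X.T by omega)
      rw [← e] at h1
      change B (l + 1) ≤ _ at h1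
      refine h1.trans ?_
      rcases Nat.lt_or_ge l t₀ with h | h
      · rw [show min (l + 1) t₀ = min l t₀ + 1 by omega, pow_succ, mul_comm _ (1 + _), mul_assoc]
        refine mul_le_mul ?_ ih' (hBnn l) (by positivity)
        have := stepSize_le hc hν l
        have h2 : |1 - stepSize X.sched.cβ X.sched.ν l| ≤ 1 + stepSize X.sched.cβ X.sched.ν l := by
          rw [abs_le]
          constructor <;> linarith
        linarith
      · rw [show min (l + 1) t₀ = min l t₀ by omega, abs_of_nonneg (by linarith [ht₀ l h])]
        rw [sub_add_cancel, one_mul]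
        exact ih'
  have h2 : (1 + 2 * X.sched.cβ) ^ (min l t₀) ≤ (1 + 2 * X.sched.cβ) ^ t₀ :=
    pow_le_pow_right₀ (by linarith) (min_le_right _ _)
  have h3 : B 0 ≤ 1 / (1 - X.game.ρ) * (1 + ‖(X.mem x y n₀).Q‖) := by
    have hq := norm_nonneg (X.mem x y n₀).Q
    have h4 : 1 ≤ 1 / (1 - X.game.ρ) := by rw [le_div_iff₀ h1ρ]; linarith [hρ.1]
    have h5 : 0 ≤ 1 / (1 - X.game.ρ) := by positivity
    refine max_le ?_ ?_
    · rw [add_zero]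
      nlinarith
    · nlinarith
  calc _ ≤ B l := le_max_left _ _
    _ ≤ (1 + 2 * X.sched.cβ) ^ t₀ * (1 / (1 - X.game.ρ) * (1 + ‖(X.mem x y n₀).Q‖)) :=
        key.trans (mul_le_mul h2 h3 (hBnn 0) (by positivity))
    _ = _ := by ring

end EpisodeProcesses

/-! ### The deterministic error bound for one episode, and polynomial envelopes -/

section EpisodeBound

/-- Everything is pathwise here: on the event that noise and visit deviations are small on all
windows, the recursion reduces to `asynchronous_contraction`, started at the first time when step
sizes and u are small enough. -/
theorem episode_bound {ι : Type*} {e v ξ : ℕ → ι → ℝ} {b u : ℕ → ℝ} {N t₀ : ℕ}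
    {ρ ε R R₀ C₁ C₂ σ p c : ℝ} (hρ : ρ ∈ Set.Ioo (0 : ℝ) 1) (hε : 0 ≤ ε) (hR : 0 ≤ R)
    (hR₀ : 0 ≤ R₀) (hc : 0 < c) (hC₁ : 0 < C₁) (hp : 2 + 12 / (1 - ρ) ≤ p) (ht₀ : 2 ≤ t₀)
    (hpt : p + 1 ≤ t₀) (hb1 : ∀ k ≥ t₀, b k ≤ 1) (hb2 : ∀ k ≥ t₀, C₂ * b k ≤ 1 / 2)
    (hbp : ∀ k : ℕ, p / ((k : ℝ) + 1) ≤ σ * b k) (hu0 : ∀ k, 0 ≤ u k)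
    (hu2 : ∀ k, u (k + 1) ≤ u k) (hu1 : ∀ k, 1 ≤ k → u k ≤ (1 + 1 / (k : ℝ)) * u (k + 1))
    (hcu : ∀ k < t₀, c ≤ u k) (hcC : c ≤ 1 / (2 * C₁))
    (hv : ∀ k < N, ∀ i, 0 ≤ v k i ∧ v k i ≤ b k)
    (he : ∀ k < N, ∀ i, ∃ g, e (k + 1) i = (1 - v k i) * e k i + v k i * g + ξ k i ∧
      ∀ B, (∀ j, |e k j| ≤ B) → |g| ≤ ρ * B + ε)
    (heR : ∀ k ≤ N, ∀ i, |e k i| ≤ R₀)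
    (hξ : ∀ i m n, m ≤ n → n ≤ N → |∑ l ∈ Finset.Ico m n, ξ l i| ≤ R * u m)
    (hvis : ∀ i m n, m ≤ n → n ≤ N →
      σ * ∑ l ∈ Finset.Ico m n, b l - C₂ * b m - C₁ * u m ≤ ∑ l ∈ Finset.Ico m n, v l i) (i : ι) :
    |e N i| ≤ ε / (1 - ρ) + 2 / (1 - ρ) * (6 * (R₀ / c) + 7 * R) * u N := by
  have h1ρ : 0 < 1 - ρ := by linarith [hρ.2]
  have hRc : 0 ≤ R₀ / c := by positivity
  -- Before the contraction regime u is at least c, so the crude bound R₀ is at most (R₀/c) u.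
  have hbad : ∀ k, ¬(t₀ ≤ k ∧ C₁ * u k ≤ 1 / 2) → c ≤ u k := by
    intro k hk
    by_cases h : t₀ ≤ k
    · have h2 : 1 / 2 < C₁ * u k := by
        by_contra h3
        exact hk ⟨h, not_lt.1 h3⟩
      refine hcC.trans ?_
      rw [div_le_iff₀ (by positivity)]
      linarith
    · exact hcu k (not_le.1 h)
  by_cases hN : t₀ ≤ N ∧ C₁ * u N ≤ 1 / 2
  swap
  · have h1 := hbad N hN
    have h2 := heR N le_rfl i
    have h3 : R₀ ≤ R₀ / c * u N := by
      rw [div_mul_eq_mul_div, le_div_iff₀ hc]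
      exact mul_le_mul_of_nonneg_left h1 hR₀
    have h4 : R₀ / c ≤ 2 / (1 - ρ) * (6 * (R₀ / c) + 7 * R) := by
      have : 1 ≤ 2 / (1 - ρ) := by rw [le_div_iff₀ h1ρ]; linarith [hρ.1]
      have h5 : 0 ≤ 6 * (R₀ / c) + 7 * R := by positivity
      calc R₀ / c ≤ 6 * (R₀ / c) + 7 * R := by linarith
        _ ≤ _ := le_mul_of_one_le_left h5 this
    have h6 := mul_le_mul_of_nonneg_right h4 (hu0 N)
    have h7 : 0 ≤ ε / (1 - ρ) := by positivity
    linarith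
  classical
  have hex : ∃ k, t₀ ≤ k ∧ C₁ * u k ≤ 1 / 2 := ⟨N, hN⟩
  -- At the first good time u is still comparable to c: the time before it is bad and, because t₀ ≥
  -- 2, is at least 1, so u drops by at most a factor 2 in between.
  obtain ⟨m, hm, hmin, hmN⟩ : ∃ m, (t₀ ≤ m ∧ C₁ * u m ≤ 1 / 2) ∧
      (∀ k < m, ¬(t₀ ≤ k ∧ C₁ * u k ≤ 1 / 2)) ∧ m ≤ N :=
    ⟨Nat.find hex, Nat.find_spec hex, fun k hk => Nat.find_min hex hk, Nat.find_min' hex hN⟩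
  have hum : c / 2 ≤ u m := by
    have h1 := hbad (m - 1) (hmin (m - 1) (by omega))
    have h2 := hu1 (m - 1) (by omega)
    rw [show m - 1 + 1 = m by omega] at h2
    have h3 : (1 : ℝ) / ((m - 1 : ℕ) : ℝ) ≤ 1 := by
      have : (1 : ℝ) ≤ ((m - 1 : ℕ) : ℝ) := by exact_mod_cast (show 1 ≤ m - 1 by omega)
      rw [div_le_one (by linarith)]
      exact this
    nlinarith [hu0 m]
  have hanti : ∀ k, m ≤ k → u k ≤ u m := by
    intro k hk
    induction k, hk using Nat.le_induction with
    | base => exact le_rfl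
    | succ k _ ih => exact (hu2 k).trans ih
  -- The noise still to come. It vanishes at time N, so the bound for e + W is there a bound for e.
  set W : ℕ → ι → ℝ := fun k i => ∑ l ∈ Finset.Ico k N, ξ l i with hW
  have hmt : (t₀ : ℝ) ≤ m := by exact_mod_cast hm.1
  have key := asynchronous_contraction (ι := ι) (y := fun k i => |e k i + W k i|) (v := v) (u := u)
    (m := m) (T := N) (ρ := ρ) (ε := ε) (g := 2 * R) (K0 := 2 * (R₀ / c) + R) (p := p)
    hρ (by positivity) (by positivity) hp (by linarith) (fun k _ => hu0 k) (fun k _ => hu2 k)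
    (fun k hk => hu1 k (by omega)) (fun k hk hkN i => ((hv k hkN i).2).trans (hb1 k (by omega)))
    ?_ ?_ ?_ hmN le_rfl i
  · simp only [hW, Finset.Ico_self, Finset.sum_empty, add_zero] at key
    refine key.trans (le_of_eq ?_)
    ring
  -- From m on, each of the two defects in the visit count is at most 1/2; together they use up the
  -- allowed slack 1.
  · intro i x y hx hxy hyN
    have h1 := hvis i x y hxy hyN
    have h2 := hb2 x (by omega)
    have h3 : C₁ * u x ≤ 1 / 2 := (mul_le_mul_of_nonneg_left (hanti x hx) hC₁.le).trans hm.2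
    have h4 : ∑ l ∈ Finset.Ico x y, p / ((l : ℝ) + 1) ≤ σ * ∑ l ∈ Finset.Ico x y, b l := by
      rw [Finset.mul_sum]
      exact Finset.sum_le_sum fun l _ => hbp l
    linarith
  · intro k hk hkN B hB i
    obtain ⟨g, hg1, hg2⟩ := he k hkN i
    have h1 := hv k hkN i
    have h2 := hb1 k (by omega)
    have hWk : ∀ j, |W k j| ≤ R * u k := fun j => hξ j k N hkN.le le_rfl
    have h3 : |g| ≤ ρ * (B + R * u k) + ε := by
      refine hg2 _ fun j => ?_
      have h4 : e k j = (e k j + W k j) - W k j := by ring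
      rw [h4]
      refine (abs_sub _ _).trans (add_le_add (hB j) (hWk j))
    have h5 : W k i = ξ k i + W (k + 1) i := by
      simp only [hW]
      rw [Finset.sum_eq_sum_Ico_succ_bot hkN]
    have h6 : e (k + 1) i + W (k + 1) i =
        (1 - v k i) * (e k i + W k i) + v k i * (g + W k i) := by
      rw [hg1, h5]
      ring
    have h7 : |g + W k i| ≤ ρ * B + ε + 2 * R * u k := by
      refine (abs_add_le _ _).trans ?_
      have h8 : ρ * (R * u k) ≤ R * u k :=
        mul_le_of_le_one_left (mul_nonneg hR (hu0 k)) hρ.2.le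
      linarith [hWk i]
    rw [h6]
    refine (abs_add_le _ _).trans ?_
    rw [abs_mul, abs_mul, abs_of_nonneg h1.1, abs_of_nonneg (by linarith [h1.2] : 0 ≤ 1 - v k i)]
    exact add_le_add le_rfl (mul_le_mul_of_nonneg_left h7 h1.1)
  · intro i
    have h1 : |e m i + W m i| ≤ R₀ + R * u m :=
      (abs_add_le _ _).trans (add_le_add (heR m hmN i) (hξ i m N hmN le_rfl))
    have h2 : R₀ ≤ 2 * (R₀ / c) * u m := by
      have : R₀ = 2 * (R₀ / c) * (c / 2) := by field_simp
      calc R₀ = 2 * (R₀ / c) * (c / 2) := this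
        _ ≤ _ := mul_le_mul_of_nonneg_left hum (by positivity)
    have h7 : 0 ≤ ε / (1 - ρ) := by positivity
    linarith

/-- Abel summation; because the weights decrease, the Lyapunov differences cost only a boundary term
at the left end of the window. -/
theorem neg_le_sum_mul_sub {b f : ℕ → ℝ} {F : ℝ} (hb0 : ∀ k, 0 ≤ b k)
    (hb : ∀ k, b (k + 1) ≤ b k) (hf : ∀ k, f k ≤ F) (hf0 : ∀ k, 0 ≤ f k) {m n : ℕ} (hmn : m ≤ n) :
    -(F * b m) ≤ ∑ l ∈ Finset.Ico m n, b l * (f l - f (l + 1)) := by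
  have key : -(F * (b m - b n)) - b n * f n ≤
      ∑ l ∈ Finset.Ico m n, b l * (f l - f (l + 1)) := by
    induction n, hmn using Nat.le_induction with
    | base => simpa using mul_nonneg (hb0 m) (hf0 m)
    | succ n hmn ih =>
      rw [Finset.sum_Ico_succ_top hmn]
      nlinarith [mul_nonneg (sub_nonneg.2 (hb n)) (sub_nonneg.2 (hf (n + 1)))]
  nlinarith [mul_nonneg (hb0 n) (sub_nonneg.2 (hf n))]

/-- The polynomial envelope `(k + 1)^(-a)`. -/
noncomputable def envelope (a : ℝ) (k : ℕ) : ℝ := ((k : ℝ) + 1) ^ (-a)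

theorem envelope_pos (a : ℝ) (k : ℕ) : 0 < envelope a k := by
  unfold envelope
  positivity

theorem envelope_antitone {a : ℝ} (ha : 0 ≤ a) (k : ℕ) : envelope a (k + 1) ≤ envelope a k := by
  unfold envelope
  push_cast
  exact Real.rpow_le_rpow_of_nonpos (by positivity) (by linarith) (by linarith)

theorem envelope_le {a : ℝ} (ha : a ≤ 1) {k : ℕ} (hk : 1 ≤ k) :
    envelope a k ≤ (1 + 1 / (k : ℝ)) * envelope a (k + 1) := by
  have hk' : (1 : ℝ) ≤ k := by exact_mod_cast hk
  unfold envelope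
  push_cast
  have h1 : (((k : ℝ) + 1 + 1) / ((k : ℝ) + 1)) ^ a ≤ 1 + 1 / (k : ℝ) := by
    have h2 : 1 ≤ ((k : ℝ) + 1 + 1) / ((k : ℝ) + 1) := by
      rw [le_div_iff₀ (by positivity)]
      linarith
    calc _ ≤ (((k : ℝ) + 1 + 1) / ((k : ℝ) + 1)) ^ (1 : ℝ) :=
          Real.rpow_le_rpow_of_exponent_le h2 ha
      _ = 1 + 1 / ((k : ℝ) + 1) := by rw [Real.rpow_one]; field_simp
      _ ≤ _ := by gcongr; linarith
  have h3 : ((k : ℝ) + 1) ^ (-a) =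
      (((k : ℝ) + 1 + 1) / ((k : ℝ) + 1)) ^ a * ((k : ℝ) + 1 + 1) ^ (-a) := by
    rw [Real.div_rpow (by positivity) (by positivity), Real.rpow_neg (by positivity),
      Real.rpow_neg (by positivity)]
    have : ((k : ℝ) + 1 + 1) ^ a ≠ 0 := by positivity
    field_simp
  rw [h3]
  exact mul_le_mul_of_nonneg_right h1 (by positivity)

/-- Bernoulli's inequality in the concave range of exponents; it replaces the comparison of a tail
sum with an integral. -/
theorem rpow_neg_add_one_le {y q : ℝ} (hy : 1 < y) (hq0 : 0 < q) (hq1 : q ≤ 1) :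
    q * y ^ (-(q + 1)) ≤ (y - 1) ^ (-q) - y ^ (-q) := by
  have hy0 : 0 < y := by linarith
  have h1 : (1 - 1 / y) ^ q ≤ 1 - q / y := by
    have h := rpow_one_add_le_one_add_mul_self (s := -(1 / y)) (p := q)
      (by rw [neg_le_neg_iff, div_le_one hy0]; linarith) hq0.le hq1
    calc (1 - 1 / y) ^ q = (1 + -(1 / y)) ^ q := by rw [sub_eq_add_neg]
      _ ≤ _ := h
      _ = _ := by ring
  have h2 : 0 < 1 - 1 / y := by
    rw [sub_pos, div_lt_one hy0]
    exact hy
  have h3 : 1 + q / y ≤ ((1 - 1 / y) ^ q)⁻¹ := by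
    rw [le_inv_comm₀ (by positivity) (by positivity)]
    refine h1.trans ?_
    rw [← one_div, le_div_iff₀ (by positivity)]
    nlinarith [sq_nonneg (q / y)]
  have h4 : (y - 1) ^ (-q) = y ^ (-q) * ((1 - 1 / y) ^ q)⁻¹ := by
    rw [show y - 1 = y * (1 - 1 / y) by field_simp, Real.mul_rpow hy0.le h2.le,
      Real.rpow_neg h2.le]
  have h5 : y ^ (-(q + 1)) = y ^ (-q) * (1 / y) := by
    rw [neg_add, Real.rpow_add hy0, Real.rpow_neg_one, one_div]
  rw [h4, h5]
  have h6 := mul_le_mul_of_nonneg_left h3 (Real.rpow_nonneg hy0.le (-q))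
  calc _ = y ^ (-q) * (1 + q / y) - y ^ (-q) := by ring
    _ ≤ _ := by linarith

/-- The variance of a window depends only on its left end, and ν > 1/2 makes the tail summable; the
square root of this bound is the envelope with exponent ν - 1/2. -/
theorem sum_stepSize_sq_le {cβ ν : ℝ} (hν : ν ∈ Set.Ioc (1 / 2 : ℝ) 1) {m n : ℕ} (hmn : m ≤ n) :
    ∑ l ∈ Finset.Ico m n, stepSize cβ ν l ^ 2 ≤
      cβ ^ 2 / (2 * ν - 1) * envelope (ν - 1 / 2) m ^ 2 := by
  have hq : 0 < 2 * ν - 1 := by linarith [hν.1]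
  have henv : ∀ k, envelope (ν - 1 / 2) k ^ 2 = ((k : ℝ) + 1) ^ (-(2 * ν - 1)) := by
    intro k
    unfold envelope
    rw [← Real.rpow_natCast, ← Real.rpow_mul (by positivity)]
    congr 1
    push_cast
    ring
  have h1 : ∀ l, stepSize cβ ν l ^ 2 ≤ cβ ^ 2 / (2 * ν - 1) *
      (envelope (ν - 1 / 2) l ^ 2 - envelope (ν - 1 / 2) (l + 1) ^ 2) := by
    intro l
    have hl : (0 : ℝ) ≤ l := Nat.cast_nonneg l
    have h2 := rpow_neg_add_one_le (y := (l : ℝ) + 2) (by linarith) hq (by linarith [hν.2])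
    have e1 : stepSize cβ ν l ^ 2 = cβ ^ 2 * ((l : ℝ) + 2) ^ (-(2 * ν - 1 + 1)) := by
      unfold stepSize
      rw [div_pow, ← Real.rpow_natCast (((l : ℝ) + 2) ^ ν), ← Real.rpow_mul (by positivity),
        Real.rpow_neg (by positivity), div_eq_mul_inv]
      congr 3
      push_cast
      ring
    rw [henv, henv, e1]
    have e2 : (((l + 1 : ℕ) : ℝ) + 1) = (l : ℝ) + 2 := by push_cast; ring
    have e3 : (l : ℝ) + 1 = (l : ℝ) + 2 - 1 := by ring
    rw [e2, e3, div_mul_eq_mul_div, le_div_iff₀ hq]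
    nlinarith [mul_le_mul_of_nonneg_left h2 (sq_nonneg cβ)]
  refine (Finset.sum_le_sum fun l _ => h1 l).trans ?_
  rw [← Finset.mul_sum]
  refine mul_le_mul_of_nonneg_left ?_ (by positivity)
  have h3 := Finset.sum_Ico_sub (fun l => -envelope (ν - 1 / 2) l ^ 2) hmn
  have h4 : ∑ l ∈ Finset.Ico m n,
      (envelope (ν - 1 / 2) l ^ 2 - envelope (ν - 1 / 2) (l + 1) ^ 2) =
      envelope (ν - 1 / 2) m ^ 2 - envelope (ν - 1 / 2) n ^ 2 := by
    rw [show envelope (ν - 1 / 2) m ^ 2 - envelope (ν - 1 / 2) n ^ 2 =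
      -envelope (ν - 1 / 2) n ^ 2 - -envelope (ν - 1 / 2) m ^ 2 by ring, ← h3]
    exact Finset.sum_congr rfl fun l _ => by ring
  rw [h4]
  linarith [sq_nonneg (envelope (ν - 1 / 2) n)]

theorem exists_stepSize_le {ν : ℝ} (hν : 0 < ν) (cβ : ℝ) {c : ℝ} (hc : 0 < c) :
    ∃ t₀, ∀ j ≥ t₀, stepSize cβ ν j ≤ c := by
  have h1 : Filter.Tendsto (fun j : ℕ => ((j : ℝ) + 2) ^ ν) Filter.atTop Filter.atTop :=
    (tendsto_rpow_atTop hν).comp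
      (Filter.tendsto_atTop_add_const_right _ _ tendsto_natCast_atTop_atTop)
  have h2 : Filter.Tendsto (fun j => stepSize cβ ν j) Filter.atTop (nhds 0) :=
    h1.const_div_atTop cβ
  obtain ⟨t₀, h⟩ := Filter.eventually_atTop.1 (h2.eventually_le_const hc)
  exact ⟨t₀, h⟩

end EpisodeBound

/-! ### The one-step recursion for the error -/

section ErrorStep

variable {S A : Type*} [Fintype S] [DecidableEq S] [Nonempty S] [Fintype A] [DecidableEq A]
  [Nonempty A]

namespace Sandbox.Regular

variable {X : Sandbox S A} {net : Finset (S → ℝ)}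

/-- Subtracting the Bellman equation at the frozen mean-field leaves a ρ-contraction plus the change
of reward and kernel. The latter acts on Q*_μ, of norm at most 1/(1-ρ). Absolute values appear
because `LP` and `LR` are not assumed nonnegative. -/
theorem error_step (hX : X.Regular net) {LP LR d : ℝ} (hP : X.game.KernelLipschitz LP)
    (hR : X.game.RewardLipschitz LR) (x : ℕ → S) (y : ℕ → A) {n₀ k : ℕ} (hk : n₀ = k * X.T)
    {l : ℕ} (hl : l < X.T) (hd : l1Dist (X.mfAt x y (n₀ + l)) (X.mfAt x y n₀) ≤ d) (z : S) (c : A) :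
    ∃ g, (X.mem x y (n₀ + l + 1)).Q z c - X.game.optQ (X.mfAt x y n₀) z c =
        (1 - stepSize X.sched.cβ X.sched.ν l * hit z c (n₀ + l) x y) *
          ((X.mem x y (n₀ + l)).Q z c - X.game.optQ (X.mfAt x y n₀) z c) +
        stepSize X.sched.cβ X.sched.ν l * hit z c (n₀ + l) x y * g +
        stepSize X.sched.cβ X.sched.ν l * X.noise z c (n₀ + l) x y ∧
      ∀ B, (∀ j : S × A, |(X.mem x y (n₀ + l)).Q j.1 j.2 -
        X.game.optQ (X.mfAt x y n₀) j.1 j.2| ≤ B) →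
        |g| ≤ X.game.ρ * B + (|LR| + |LP| / (1 - X.game.ρ)) * d := by
  have hρ := X.game.ρ_mem
  have h1ρ : 0 < 1 - X.game.ρ := by linarith [hρ.2]
  have hμ := hX.mfAt_mem x y n₀
  have hμn := hX.mfAt_mem x y (n₀ + l)
  set μ := X.mfAt x y n₀
  set μn := X.mfAt x y (n₀ + l) with hμn'
  set V := X.stateValue x y (n₀ + l) with hV
  set q := X.game.optQ μ with hq
  have hd0 := (l1Dist_nonneg μn μ).trans hd
  have hbell : q z c = X.game.R z c μ + X.game.ρ * ∑ j, X.game.P z c μ j * ⨆ a', q j a' :=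
    (congrFun (congrFun (X.game.bellman_optQ hμ) z) c).symm
  refine ⟨X.game.R z c μn - X.game.R z c μ + X.game.ρ *
    (∑ j, X.game.P z c μn j * V j - ∑ j, X.game.P z c μ j * ⨆ a', q j a'), ?_, fun B hB => ?_⟩
  · rw [X.mem_Q_succ x y hk hl]
    simp only [qUpdate, noise, hit]
    by_cases h : z = x (n₀ + l) ∧ c = y (n₀ + l)
    · have h' : x (n₀ + l) = z ∧ y (n₀ + l) = c := ⟨h.1.symm, h.2.symm⟩
      rw [if_pos h, if_pos h', h'.1, h'.2, ← hμn']
      have hVe : ⨆ a', (X.mem x y (n₀ + l)).Q (x (n₀ + l + 1)) a' = V (x (n₀ + l + 1)) := rfl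
      rw [hVe]
      linear_combination (-(stepSize X.sched.cβ X.sched.ν l)) * hbell
    · have h' : ¬(x (n₀ + l) = z ∧ y (n₀ + l) = c) := fun h' => h ⟨h'.1.symm, h'.2.symm⟩
      rw [if_neg h, if_neg h']
      ring
  · have h1 : |X.game.R z c μn - X.game.R z c μ| ≤ |LR| * d :=
      (hR z c μn hμn μ hμ).trans (mul_le_mul (le_abs_self _) hd (l1Dist_nonneg _ _) (abs_nonneg _))
    have h2 : |∑ j, X.game.P z c μn j * (V j - ⨆ a', q j a')| ≤ B :=
      abs_sum_mul_le_of_mem_stdSimplex (X.game.P_mem z c μn hμn) fun j =>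
        abs_iSup_sub_iSup_le fun a' => hB (j, a')
    have h3 : |∑ j, (X.game.P z c μn j - X.game.P z c μ j) * ⨆ a', q j a'| ≤
        |LP| * d * (1 / (1 - X.game.ρ)) := by
      refine (Finset.abs_sum_le_sum_abs _ _).trans ?_
      calc _ ≤ ∑ j, |X.game.P z c μn j - X.game.P z c μ j| * (1 / (1 - X.game.ρ)) := by
            refine Finset.sum_le_sum fun j _ => ?_
            rw [abs_mul]
            refine mul_le_mul_of_nonneg_left ?_ (abs_nonneg _)
            exact (abs_iSup_le fun a' => abs_apply_le_norm q j a').trans (X.game.norm_optQ_le hμ)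
        _ = l1Dist (X.game.P z c μn) (X.game.P z c μ) * (1 / (1 - X.game.ρ)) := by
            rw [← Finset.sum_mul, l1Dist]
        _ ≤ _ := by
            refine mul_le_mul_of_nonneg_right ?_ (by positivity)
            exact (hP z c μn hμn μ hμ).trans
              (mul_le_mul (le_abs_self _) hd (l1Dist_nonneg _ _) (abs_nonneg _))
    have e : ∑ j, X.game.P z c μn j * V j - ∑ j, X.game.P z c μ j * ⨆ a', q j a' =
        ∑ j, X.game.P z c μn j * (V j - ⨆ a', q j a') +
          ∑ j, (X.game.P z c μn j - X.game.P z c μ j) * ⨆ a', q j a' := by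
      rw [← Finset.sum_sub_distrib, ← Finset.sum_add_distrib]
      exact Finset.sum_congr rfl fun j _ => by ring
    rw [e]
    refine (abs_add_le _ _).trans ?_
    rw [abs_mul, abs_of_pos hρ.1]
    have h4 := mul_le_mul_of_nonneg_left ((abs_add_le _ _).trans (add_le_add h2 h3)) hρ.1.le
    have h5 : X.game.ρ * (|LP| * d * (1 / (1 - X.game.ρ))) ≤ |LP| * d * (1 / (1 - X.game.ρ)) :=
      mul_le_of_le_one_left (by positivity) hρ.2.le
    have h6 : |LP| / (1 - X.game.ρ) * d = |LP| * d * (1 / (1 - X.game.ρ)) := by ring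
    rw [add_mul, h6]
    linarith

end Sandbox.Regular

end ErrorStep

/-! ### From small martingales on all windows to a small error -/

section EpisodeError

variable {S A : Type*} [Fintype S] [DecidableEq S] [Nonempty S] [Fintype A] [DecidableEq A]
  [Nonempty A]

/-- A maximal inequality over all windows of an episode, for a family of martingales. -/
theorem Sandbox.IsRun.measure_exists_window_ge_le {X : Sandbox S A} {Ω : Type*}
    [MeasurableSpace Ω] {ℙ : Measure Ω} [IsProbabilityMeasure ℙ] {s : ℕ → Ω → S} {a : ℕ → Ω → A}
    (hr : X.IsRun ℙ s a) (hX : X.IsStochastic) {ι : Type*} [Fintype ι] {n₀ N : ℕ}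
    {g : ι → ℕ → (ℕ → S) → (ℕ → A) → ℝ} {b U : ℕ → ℝ} {c B K L : ℝ} (hc : 0 < c) (hB : 0 < B)
    (hKL : 0 ≤ K * L) (hb : ∀ l, 0 < b l) (hU : ∀ l, 0 < U l)
    (hbU : ∀ m n, m ≤ n → ∑ l ∈ Finset.Ico m n, b l ^ 2 ≤ B * U m ^ 2)
    (hg : ∀ i l, l < N → DependsOnPrefix (n₀ + l + 1) (g i l))
    (hgb : ∀ i l, l < N → ∀ x y, |g i l x y| ≤ c * b l)
    (hg0 : ∀ i l, l < N → ∀ x y, X.stepMean (n₀ + l) (g i l) x y = 0) :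
    ℙ.real {ω | ∃ i m n, m ≤ n ∧ n ≤ N ∧ c * √(2 * B * (K * L)) * U m ≤
        ∑ l ∈ Finset.Ico m n, g i l (fun m => s m ω) (fun m => a m ω)} ≤
      Fintype.card ι * ((N : ℝ) + 1) ^ 2 * Real.exp (-(K * L)) := by
  classical
  set E : ι × ℕ × ℕ → Set Ω := fun j => {ω | j.2.1 ≤ j.2.2 ∧ j.2.2 ≤ N ∧
    c * √(2 * B * (K * L)) * U j.2.1 ≤
      ∑ l ∈ Finset.Ico j.2.1 j.2.2, g j.1 l (fun m => s m ω) (fun m => a m ω)} with hE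
  set J : Finset (ι × ℕ × ℕ) := Finset.univ ×ˢ Finset.range (N + 1) ×ˢ Finset.range (N + 1)
  have hsub : {ω | ∃ i m n, m ≤ n ∧ n ≤ N ∧ c * √(2 * B * (K * L)) * U m ≤
        ∑ l ∈ Finset.Ico m n, g i l (fun m => s m ω) (fun m => a m ω)} ⊆ ⋃ j ∈ J, E j := by
    rintro ω ⟨i, m, n, hmn, hn, h⟩
    simp only [Set.mem_iUnion]
    refine ⟨(i, m, n), ?_, hmn, hn, h⟩
    simp only [J, Finset.mem_product, Finset.mem_univ, Finset.mem_range, true_and]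
    omega
  have hEj : ∀ j ∈ J, ℙ.real (E j) ≤ Real.exp (-(K * L)) := by
    rintro ⟨i, m, n⟩ -
    by_cases hmn : m ≤ n ∧ n ≤ N
    swap
    · have : E (i, m, n) = ∅ := by
        ext ω
        simp only [hE, Set.mem_ofPred_eq, Set.mem_empty_iff_false, iff_false]
        exact fun h => hmn ⟨h.1, h.2.1⟩
      rw [this]
      simpa using Real.exp_nonneg _
    have hV : 0 < c ^ 2 * (B * U m ^ 2) := by
      have := hU m
      positivity
    have h := hr.measure_sum_ge_le hX (n₀ + m) (n₀ + n) (by omega)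
      (f := fun l => g i (l - n₀)) (c := fun l => c * b (l - n₀))
      (V := c ^ 2 * (B * U m ^ 2)) (τ := c * √(2 * B * (K * L)) * U m)
      (fun l h1 h2 => by
        have := hg i (l - n₀) (by omega)
        rwa [show n₀ + (l - n₀) + 1 = l + 1 by omega] at this)
      (fun l _ _ => mul_pos hc (hb _))
      (fun l h1 h2 => hgb i (l - n₀) (by omega))
      (fun l h1 h2 => by
        have := hg0 i (l - n₀) (by omega)
        rwa [show n₀ + (l - n₀) = l by omega] at this)
      hV ?_ (by have := hU m; positivity)
    · have hset : E (i, m, n) = {ω | c * √(2 * B * (K * L)) * U m ≤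
          ∑ l ∈ Finset.Ico (n₀ + m) (n₀ + n), g i (l - n₀) (fun m => s m ω) (fun m => a m ω)} := by
        ext ω
        have h2 := Finset.sum_Ico_add (fun l => g i (l - n₀) (fun m => s m ω) (fun m => a m ω))
          m n n₀
        simp only [Nat.add_sub_cancel_left] at h2
        rw [add_comm m, add_comm n] at h2
        simp only [hE, Set.mem_ofPred_eq, hmn, true_and, h2]
      rw [hset]
      refine h.trans (le_of_eq ?_)
      congr 2
      have h3 : √(2 * B * (K * L)) ^ 2 = 2 * B * (K * L) := Real.sq_sqrt (by positivity)
      have h4 := (hU m).ne'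
      rw [mul_pow, mul_pow, h3]
      field_simp
    · have h2 := Finset.sum_Ico_add (fun l => (c * b (l - n₀)) ^ 2) m n n₀
      simp only [Nat.add_sub_cancel_left] at h2
      rw [add_comm m, add_comm n] at h2
      rw [← h2]
      simp only [mul_pow]
      rw [← Finset.mul_sum]
      exact mul_le_mul_of_nonneg_left (hbU m n hmn.1) (sq_nonneg c)
  calc _ ≤ ℙ.real (⋃ j ∈ J, E j) := measureReal_mono hsub (measure_ne_top _ _)
    _ ≤ ∑ j ∈ J, ℙ.real (E j) := measureReal_biUnion_finset_le _ _
    _ ≤ ∑ j ∈ J, Real.exp (-(K * L)) := Finset.sum_le_sum hEj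
    _ = _ := by
        simp only [J, Finset.sum_const, Finset.card_product, Finset.card_univ, Finset.card_range,
          nsmul_eq_mul]
        push_cast
        ring

theorem MeanFieldGame.KernelLipschitz.l1Dist_le {G : MeanFieldGame S A} {LP : ℝ}
    (hP : G.KernelLipschitz LP) {μ μ' : S → ℝ} (hμ : μ ∈ stdSimplex ℝ S)
    (hμ' : μ' ∈ stdSimplex ℝ S) {d : ℝ} (hd : l1Dist μ μ' ≤ d) (s : S) (a : A) :
    l1Dist (G.P s a μ) (G.P s a μ') ≤ |LP| * d :=
  (hP s a μ hμ μ' hμ').trans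
    (mul_le_mul (le_abs_self _) hd (l1Dist_nonneg _ _) (abs_nonneg _))

namespace Sandbox.Regular

variable {X : Sandbox S A} {net : Finset (S → ℝ)}

/-- If every martingale of the episode is small on all windows, then the table is close to the
optimal one at the end of the episode. -/
theorem error_le_of_windows (hX : X.Regular net) {LP LR d : ℝ} (hP : X.game.KernelLipschitz LP)
    (hR : X.game.RewardLipschitz LR) {p₀ κ F p M₀ C₁ c r : ℝ} {H t₀ k n₀ : ℕ} (hp₀ : 0 < p₀)
    (hpos : ∀ μ ∈ net, ∀ s a s', 0 < X.game.P s a μ s' → p₀ ≤ X.game.P s a μ s')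
    (hκ : κ = X.minProb * (p₀ / 2)) (hF : 0 ≤ F)
    (hlyap : ∀ μ ∈ net, ∀ z s, X.game.lyapunov κ H μ z s ≤ F ∧
      (X.game.lyapunov κ H μ z s + κ ^ H - if s = z then 1 else 0) ≤
        ∑ j, X.game.supportKernel κ μ s j * X.game.lyapunov κ H μ z j)
    (hdclose : |LP| * d ≤ p₀ / 2) (hk : n₀ = k * X.T) (hT : 1 ≤ X.T)
    (hd : ∀ x y, ∀ l < X.T, l1Dist (X.mfAt x y (n₀ + l)) (X.mfAt x y n₀) ≤ d)
    (hp : 2 + 12 / (1 - X.game.ρ) ≤ p) (hσ : 2 * p ≤ X.minProb * κ ^ H * X.sched.cβ)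
    (ht₀ : 2 ≤ t₀) (hpt : p + 1 ≤ t₀)
    (hb : ∀ j ≥ t₀, stepSize X.sched.cβ X.sched.ν j ≤ 1 / (2 * (1 + F)))
    (hβ : 0 < X.sched.cβ) (hM₀ : 0 ≤ M₀)
    (hQ : ∀ x y, ∀ l ≤ X.T, ‖(X.mem x y (n₀ + l)).Q‖ ≤ M₀ * (1 + ‖(X.mem x y n₀).Q‖))
    (hC₁ : 0 < C₁) (hc : 0 < c) (hcC : c ≤ 1 / (2 * C₁)) (hr : 0 ≤ r)
    (hcu : c ≤ r * envelope (X.sched.ν - 1 / 2) t₀) {x : ℕ → S} {y : ℕ → A}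
    (hξ : ∀ z b m n, m ≤ n → n ≤ X.T - 1 →
      |∑ l ∈ Finset.Ico m n, stepSize X.sched.cβ X.sched.ν l * X.noise z b (n₀ + l) x y| ≤
        C₁ * (1 + ‖(X.mem x y n₀).Q‖) * (r * envelope (X.sched.ν - 1 / 2) m))
    (hvis : ∀ z b m n, m ≤ n → n ≤ X.T - 1 → -(C₁ * (r * envelope (X.sched.ν - 1 / 2) m)) ≤
      ∑ l ∈ Finset.Ico m n, stepSize X.sched.cβ X.sched.ν l *
        (X.visitPotential κ H n₀ z b (n₀ + l) x y -
          X.stepMean (n₀ + l) (X.visitPotential κ H n₀ z b (n₀ + l)) x y)) :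
    ‖(X.mem x y (n₀ + (X.T - 1))).Q - X.game.optQ (X.mfAt x y n₀)‖ ≤
      (|LR| + |LP| / (1 - X.game.ρ)) * d / (1 - X.game.ρ) +
        2 / (1 - X.game.ρ) * (6 * ((M₀ + 1 / (1 - X.game.ρ)) / c) + 7 * C₁) *
          (1 + ‖(X.mem x y n₀).Q‖) * (r * envelope (X.sched.ν - 1 / 2) (X.T - 1)) := by
  have hρ := X.game.ρ_mem
  have h1ρ : 0 < 1 - X.game.ρ := by linarith [hρ.2]
  have hν := hX.adm.ν_mem
  have hν0 : 0 ≤ X.sched.ν := by linarith [hν.1]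
  have hπ := hX.minProb_mem
  have hκ0 : 0 ≤ κ := hκ ▸ mul_nonneg hπ.1.le (by linarith)
  have hd0 : 0 ≤ d := (l1Dist_nonneg _ _).trans (hd x y 0 (by omega))
  set q := ‖(X.mem x y n₀).Q‖ with hq
  have hq0 : 0 ≤ q := norm_nonneg _
  have hnet : X.mfAt x y n₀ ∈ net := hX.mfAt_mem_net x y (by
    have := X.st_add hk (j := 0) (by omega)
    simpa using this)
  have hμ := hX.mfAt_mem x y n₀
  set ε := (|LR| + |LP| / (1 - X.game.ρ)) * d with hε
  have hε0 : 0 ≤ ε := by positivity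
  set a := X.sched.ν - 1 / 2 with ha
  have ha0 : 0 ≤ a := by linarith [hν.1]
  have hp0 : 0 ≤ p := by
    have : 0 ≤ 12 / (1 - X.game.ρ) := by positivity
    linarith
  -- Only T - 1 updates separate Q^k_1 from Q^k_T.
  have key := episode_bound (ι := S × A)
    (e := fun l i => (X.mem x y (n₀ + l)).Q i.1 i.2 - X.game.optQ (X.mfAt x y n₀) i.1 i.2)
    (v := fun l i => stepSize X.sched.cβ X.sched.ν l * hit i.1 i.2 (n₀ + l) x y)
    (ξ := fun l i => stepSize X.sched.cβ X.sched.ν l * X.noise i.1 i.2 (n₀ + l) x y)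
    (b := stepSize X.sched.cβ X.sched.ν) (u := fun l => r * envelope a l) (N := X.T - 1)
    (t₀ := t₀) (ρ := X.game.ρ) (ε := ε) (R := C₁ * (1 + q))
    (R₀ := (M₀ + 1 / (1 - X.game.ρ)) * (1 + q)) (C₁ := C₁) (C₂ := X.minProb * F)
    (σ := X.minProb * κ ^ H) (p := p) (c := c) hρ hε0 (by positivity) (by positivity) hc hC₁ hp ht₀
    hpt ?_ ?_ ?_ (fun l => mul_nonneg hr (envelope_pos a l).le)
    (fun l => mul_le_mul_of_nonneg_left (envelope_antitone ha0 l) hr) ?_ ?_ hcC ?_ ?_ ?_ ?_ ?_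
  · refine norm_le_of_forall_abs_le ?_ fun z b => ?_
    · have := envelope_pos a (X.T - 1)
      positivity
    · refine (key (z, b)).trans (le_of_eq ?_)
      ring
  · intro j hj
    refine (hb j hj).trans ?_
    rw [div_le_one (by positivity)]
    linarith
  · intro j hj
    have h1 : X.minProb * F ≤ F := mul_le_of_le_one_left hF hπ.2
    have h2 := stepSize_pos hβ (ν := X.sched.ν) j
    calc _ ≤ F * (1 / (2 * (1 + F))) := mul_le_mul h1 (hb j hj) h2.le hF
      _ ≤ 1 / 2 := by
        rw [mul_one_div, div_le_div_iff₀ (by positivity) (by norm_num)]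
        linarith
  -- The factor 2 in `hσ` pays for (j+2)^ν ≤ j + 2 ≤ 2(j+1).
  · intro j
    unfold stepSize
    have hj : (0 : ℝ) ≤ j := Nat.cast_nonneg j
    have h1 : ((j : ℝ) + 2) ^ X.sched.ν ≤ (j : ℝ) + 2 := by
      calc _ ≤ ((j : ℝ) + 2) ^ (1 : ℝ) :=
            Real.rpow_le_rpow_of_exponent_le (by linarith) hν.2
        _ = _ := Real.rpow_one _
    rw [mul_div_assoc', div_le_div_iff₀ (by positivity) (by positivity)]
    calc p * ((j : ℝ) + 2) ^ X.sched.ν ≤ p * ((j : ℝ) + 2) := mul_le_mul_of_nonneg_left h1 hp0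
      _ ≤ 2 * p * ((j : ℝ) + 1) := by nlinarith
      _ ≤ _ := mul_le_mul_of_nonneg_right hσ (by positivity)
  · intro j hj
    have := mul_le_mul_of_nonneg_left (envelope_le (a := a) (by linarith [hν.2]) hj) hr
    linarith
  · intro j hj
    refine hcu.trans (mul_le_mul_of_nonneg_left ?_ hr)
    exact (antitone_nat_of_succ_le fun l => envelope_antitone ha0 l) hj.le
  · intro l _ i
    have h1 := hit_mem i.1 i.2 (n₀ + l) x y
    have h2 := stepSize_pos hβ (ν := X.sched.ν) l
    exact ⟨mul_nonneg h2.le h1.1, mul_le_of_le_one_right h2.le h1.2⟩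
  · intro l hl i
    exact hX.error_step hP hR x y hk (by omega) (hd x y l (by omega)) i.1 i.2
  · intro l hl i
    have h1 := (abs_apply_le_norm (X.mem x y (n₀ + l)).Q i.1 i.2).trans (hQ x y l (by omega))
    have h2 := (abs_apply_le_norm (X.game.optQ (X.mfAt x y n₀)) i.1 i.2).trans
      (X.game.norm_optQ_le hμ)
    refine (abs_sub _ _).trans ((add_le_add h1 h2).trans ?_)
    rw [add_mul]
    have : 1 / (1 - X.game.ρ) ≤ 1 / (1 - X.game.ρ) * (1 + q) :=
      le_mul_of_one_le_right (by positivity) (by linarith)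
    linarith
  · intro i m n hmn hn
    exact hξ i.1 i.2 m n hmn hn
  · rintro ⟨z, b⟩ m n hmn hn
    set f : ℕ → ℝ := fun l => X.game.lyapunov κ H (X.mfAt x y n₀) z (x (n₀ + l)) with hf
    -- The drift inequality rearranged: a hit is at least a constant plus a Lyapunov difference plus
    -- a martingale increment.
    have hpt : ∀ l < X.T - 1, X.minProb * κ ^ H + X.minProb * (f l - f (l + 1)) +
        (X.visitPotential κ H n₀ z b (n₀ + l) x y -
          X.stepMean (n₀ + l) (X.visitPotential κ H n₀ z b (n₀ + l)) x y) ≤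
        hit z b (n₀ + l) x y := by
      intro l hl
      have h1 := hX.le_stepMean_visitPotential (H := H) (c := b) (Nat.le_add_right n₀ l) hp₀.le hκ
        (fun s a s' => hpos _ hnet s a s')
        (fun s a => (hP.l1Dist_le (hX.mfAt_mem x y (n₀ + l)) hμ (hd x y l (by omega)) s a).trans
          hdclose) ((hlyap _ hnet z (x (n₀ + l))).2)
      have h2 : X.visitPotential κ H n₀ z b (n₀ + l) x y =
        hit z b (n₀ + l) x y + X.minProb * f (l + 1) := rfl
      rw [h2]
      change X.minProb * (f l + κ ^ H) ≤ _ at h1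
      linarith
    have h3 := hvis z b m n hmn hn
    have h4 := neg_le_sum_mul_sub (f := f) (fun j => (stepSize_pos hβ (ν := X.sched.ν) j).le)
      (stepSize_antitone hβ hν0) (fun l => (hlyap _ hnet z (x (n₀ + l))).1)
      (fun l => X.game.lyapunov_nonneg hκ0 H _ z _) hmn
    have h5 : ∑ l ∈ Finset.Ico m n, stepSize X.sched.cβ X.sched.ν l *
        (X.minProb * κ ^ H + X.minProb * (f l - f (l + 1)) +
        (X.visitPotential κ H n₀ z b (n₀ + l) x y -
          X.stepMean (n₀ + l) (X.visitPotential κ H n₀ z b (n₀ + l)) x y)) ≤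
        ∑ l ∈ Finset.Ico m n, stepSize X.sched.cβ X.sched.ν l * hit z b (n₀ + l) x y := by
      refine Finset.sum_le_sum fun l hl => mul_le_mul_of_nonneg_left (hpt l ?_)
        (stepSize_pos hβ l).le
      have := (Finset.mem_Ico.1 hl).2
      omega
    have h6 : ∑ l ∈ Finset.Ico m n, stepSize X.sched.cβ X.sched.ν l *
        (X.minProb * κ ^ H + X.minProb * (f l - f (l + 1)) +
        (X.visitPotential κ H n₀ z b (n₀ + l) x y -
          X.stepMean (n₀ + l) (X.visitPotential κ H n₀ z b (n₀ + l)) x y)) =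
        X.minProb * κ ^ H * ∑ l ∈ Finset.Ico m n, stepSize X.sched.cβ X.sched.ν l +
        X.minProb * ∑ l ∈ Finset.Ico m n, stepSize X.sched.cβ X.sched.ν l * (f l - f (l + 1)) +
        ∑ l ∈ Finset.Ico m n, stepSize X.sched.cβ X.sched.ν l *
        (X.visitPotential κ H n₀ z b (n₀ + l) x y -
          X.stepMean (n₀ + l) (X.visitPotential κ H n₀ z b (n₀ + l)) x y) := by
      rw [Finset.mul_sum, Finset.mul_sum, ← Finset.sum_add_distrib, ← Finset.sum_add_distrib]
      exact Finset.sum_congr rfl fun l _ => by ring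
    rw [h6] at h5
    have h7 := mul_le_mul_of_nonneg_left h4 hπ.1.le
    linarith

end Sandbox.Regular

end EpisodeError

/-! ### The union bound and the high-probability estimate -/

section HighProbability

/-- The exponential is (δ/2T)^{J+2}: two of the factors beat the number of windows, the other J beat
the number of martingales. -/
theorem card_mul_exp_le {T δ : ℝ} {N J : ℕ} (hT : 1 ≤ T) (hδ : δ ∈ Set.Ioo (0 : ℝ) 1)
    (hJ : N ≤ 2 ^ J) :
    (N : ℝ) * T ^ 2 * Real.exp (-(((J : ℝ) + 2) * Real.log (2 * T / δ))) ≤ δ := by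
  have hδ0 := hδ.1
  have hx : 0 < 2 * T / δ := by positivity
  have e1 : Real.exp (-(((J : ℝ) + 2) * Real.log (2 * T / δ))) = (δ / (2 * T)) ^ (J + 2) := by
    rw [← mul_neg, ← Real.log_inv, inv_div]
    have : ((J : ℝ) + 2) = ((J + 2 : ℕ) : ℝ) := by push_cast; ring
    rw [this, Real.exp_nat_mul, Real.exp_log (by positivity)]
  have h1 : δ / (2 * T) ≤ 1 / 2 := by
    rw [div_le_div_iff₀ (by positivity) (by norm_num)]
    linarith [hδ.2]
  have h2 : (N : ℝ) ≤ 2 ^ J := by exact_mod_cast hJ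
  rw [e1, pow_add]
  calc (N : ℝ) * T ^ 2 * ((δ / (2 * T)) ^ J * (δ / (2 * T)) ^ 2)
      ≤ 2 ^ J * T ^ 2 * ((1 / 2) ^ J * (δ / (2 * T)) ^ 2) := by gcongr
    _ = (2 * (1 / 2)) ^ J * (δ ^ 2 / 4) := by
        rw [mul_pow, div_pow]
        field_simp
        norm_num
    _ ≤ δ := by
        norm_num
        nlinarith [hδ.2]

theorem one_sub_le_measureReal_of_compl_subset {Ω : Type*} [MeasurableSpace Ω] {ℙ : Measure Ω}
    [IsProbabilityMeasure ℙ] {E F : Set Ω} {δ : ℝ} (h : Eᶜ ⊆ F) (hF : ℙ.real F ≤ δ) :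
    1 - δ ≤ ℙ.real E := by
  have h1 : (1 : ℝ) ≤ ℙ.real E + ℙ.real F := by
    calc (1 : ℝ) = ℙ.real Set.univ := by simp
      _ ≤ ℙ.real (E ∪ F) := measureReal_mono (fun ω _ => by
          by_cases hω : ω ∈ E
          · exact Or.inl hω
          · exact Or.inr (h hω)) (measure_ne_top _ _)
      _ ≤ _ := measureReal_union_le _ _
  linarith

variable {S A : Type*} [Fintype S] [DecidableEq S] [Nonempty S] [Fintype A] [DecidableEq A]
  [Nonempty A]

namespace Sandbox

/-- The normalized martingale increments of an episode: sampling noises, their negatives, and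
negative visit deviations. -/
noncomputable def increment (X : Sandbox S A) (κ : ℝ) (H n₀ : ℕ) :
    (S × A) ⊕ (S × A) ⊕ (S × A) → ℕ → (ℕ → S) → (ℕ → A) → ℝ
  | Sum.inl i, l => fun x y => (stepSize X.sched.cβ X.sched.ν l * (1 + ‖(X.mem x y n₀).Q‖)⁻¹) *
      X.noise i.1 i.2 (n₀ + l) x y
  | Sum.inr (Sum.inl i), l => fun x y =>
      (-(stepSize X.sched.cβ X.sched.ν l * (1 + ‖(X.mem x y n₀).Q‖)⁻¹)) *
        X.noise i.1 i.2 (n₀ + l) x y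
  | Sum.inr (Sum.inr i), l => fun x y => (-stepSize X.sched.cβ X.sched.ν l) *
      (X.visitPotential κ H n₀ i.1 i.2 (n₀ + l) x y -
        X.stepMean (n₀ + l) (X.visitPotential κ H n₀ i.1 i.2 (n₀ + l)) x y)

variable {X : Sandbox S A} {net : Finset (S → ℝ)}

theorem norm_mem_Q_dependsOnPrefix (X : Sandbox S A) (n : ℕ) :
    DependsOnPrefix n (fun x y => ‖(X.mem x y n).Q‖) := by
  intro x x' y y' hx hy
  have := X.mem_dependsOnPrefix n x x' y y' hx hy
  simp only at this ⊢
  rw [this]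

theorem increment_dependsOnPrefix (X : Sandbox S A) (κ : ℝ) (H n₀ : ℕ)
    (i : (S × A) ⊕ (S × A) ⊕ (S × A)) (l : ℕ) :
    DependsOnPrefix (n₀ + l + 1) (X.increment κ H n₀ i l) := by
  intro x x' y y' hx hy
  have h1 := (X.norm_mem_Q_dependsOnPrefix n₀).mono (show n₀ ≤ n₀ + l + 1 by omega) x x' y y' hx hy
  simp only at h1
  rcases i with i | i | i
  · simp only [increment, h1, X.noise_dependsOnPrefix i.1 i.2 (n₀ + l) x x' y y' hx hy]
  · simp only [increment, h1, X.noise_dependsOnPrefix i.1 i.2 (n₀ + l) x x' y y' hx hy]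
  · have h2 := X.visitPotential_dependsOnPrefix κ H i.1 i.2 (Nat.le_add_right n₀ l)
    have h3 := (X.stepMean_dependsOnPrefix h2).mono (Nat.le_succ _) x x' y y' hx hy
    simp only [increment, h2 x x' y y' hx hy, h3]

theorem Regular.stepMean_increment (hX : X.Regular net) (κ : ℝ) (H n₀ : ℕ)
    (i : (S × A) ⊕ (S × A) ⊕ (S × A)) (l : ℕ) (x : ℕ → S) (y : ℕ → A) :
    X.stepMean (n₀ + l) (X.increment κ H n₀ i l) x y = 0 := by
  have hq : ∀ φ : ℝ → ℝ, DependsOnPrefix (n₀ + l) fun x y => φ ‖(X.mem x y n₀).Q‖ := by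
    intro φ x x' y y' hx hy
    have h1 := (X.norm_mem_Q_dependsOnPrefix n₀).mono (show n₀ ≤ n₀ + l by omega) x x' y y' hx hy
    simp only at h1 ⊢
    rw [h1]
  rcases i with i | i | i
  · have := stepMean_mul_left (X := X) (f := X.noise i.1 i.2 (n₀ + l))
      (hq fun t => stepSize X.sched.cβ X.sched.ν l * (1 + t)⁻¹) x y
    rw [hX.stepMean_noise, mul_zero] at this
    exact this
  · have := stepMean_mul_left (X := X) (f := X.noise i.1 i.2 (n₀ + l))
      (hq fun t => -(stepSize X.sched.cβ X.sched.ν l * (1 + t)⁻¹)) x y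
    rw [hX.stepMean_noise, mul_zero] at this
    exact this
  · have h2 := X.visitPotential_dependsOnPrefix κ H i.1 i.2 (Nat.le_add_right n₀ l)
    have := stepMean_mul_left (X := X) (f := fun x y =>
      X.visitPotential κ H n₀ i.1 i.2 (n₀ + l) x y -
        X.stepMean (n₀ + l) (X.visitPotential κ H n₀ i.1 i.2 (n₀ + l)) x y)
      (hq fun _ => -stepSize X.sched.cβ X.sched.ν l) x y
    rw [stepMean_sub_self hX.isStochastic h2, mul_zero] at this
    exact this

/-- Dividing the noise by 1 + ‖Q‖ at the start of the episode, a quantity fixed by the past, makes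
the bound uniform in the initial table. The increments stay martingale differences. -/
theorem Regular.abs_increment_le (hX : X.Regular net) {κ F M₀ : ℝ} {H n₀ : ℕ} (hκ : 0 ≤ κ)
    (hF0 : 0 ≤ F) (hM₀ : 0 ≤ M₀) (hβ : 0 < X.sched.cβ)
    (hF : ∀ x y z s, X.game.lyapunov κ H (X.mfAt x y n₀) z s ≤ F) {l : ℕ}
    (hQ : ∀ x y, ‖(X.mem x y (n₀ + l)).Q‖ ≤ M₀ * (1 + ‖(X.mem x y n₀).Q‖))
    (i : (S × A) ⊕ (S × A) ⊕ (S × A)) (x : ℕ → S) (y : ℕ → A) :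
    |X.increment κ H n₀ i l x y| ≤
      (2 * M₀ + 2 * (1 + F)) * stepSize X.sched.cβ X.sched.ν l := by
  have hb := stepSize_pos hβ (ν := X.sched.ν) l
  have hq : 0 < 1 + ‖(X.mem x y n₀).Q‖ := by positivity
  have hnoise : ∀ i : S × A, |stepSize X.sched.cβ X.sched.ν l * (1 + ‖(X.mem x y n₀).Q‖)⁻¹ *
      X.noise i.1 i.2 (n₀ + l) x y| ≤
      (2 * M₀ + 2 * (1 + F)) * stepSize X.sched.cβ X.sched.ν l := by
    intro i
    have h1 := (hX.abs_noise_le i.1 i.2 (n₀ + l) x y).trans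
      (mul_le_mul_of_nonneg_left (hQ x y) (by norm_num))
    rw [abs_mul, abs_of_pos (by positivity)]
    calc _ ≤ stepSize X.sched.cβ X.sched.ν l * (1 + ‖(X.mem x y n₀).Q‖)⁻¹ *
          (2 * (M₀ * (1 + ‖(X.mem x y n₀).Q‖))) :=
          mul_le_mul_of_nonneg_left h1 (by positivity)
      _ = 2 * M₀ * stepSize X.sched.cβ X.sched.ν l := by field_simp
      _ ≤ _ := mul_le_mul_of_nonneg_right (by linarith) hb.le
  rcases i with i | i | i
  · exact hnoise i
  · simp only [increment]
    rw [neg_mul, abs_neg]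
    exact hnoise i
  · simp only [increment]
    have h1 := fun x y => hX.abs_visitPotential_le (c := i.2) hκ (fun x y => hF x y i.1) (n₀ + l) x y
    have h2 := abs_stepMean_le hX.isStochastic (n := n₀ + l) h1 x y
    rw [abs_mul, abs_neg, abs_of_pos hb, mul_comm]
    refine mul_le_mul_of_nonneg_right ?_ hb.le
    refine (abs_sub _ _).trans ?_
    linarith [h1 x y]

variable {Ω : Type*} [MeasurableSpace Ω] {ℙ : Measure Ω} [IsProbabilityMeasure ℙ]
  {s : ℕ → Ω → S} {a : ℕ → Ω → A}

theorem Regular.measure_error_ge (hX : X.Regular net) (hrun : X.IsRun ℙ s a) {LP LR d : ℝ}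
    (hP : X.game.KernelLipschitz LP) (hR : X.game.RewardLipschitz LR)
    {p₀ κ F p M₀ C₁ c δ : ℝ} {H t₀ k n₀ J : ℕ} (hp₀ : 0 < p₀)
    (hpos : ∀ μ ∈ net, ∀ s a s', 0 < X.game.P s a μ s' → p₀ ≤ X.game.P s a μ s')
    (hκ : κ = X.minProb * (p₀ / 2)) (hF : 0 ≤ F)
    (hlyap : ∀ μ ∈ net, ∀ z s, X.game.lyapunov κ H μ z s ≤ F ∧
      (X.game.lyapunov κ H μ z s + κ ^ H - if s = z then 1 else 0) ≤
        ∑ j, X.game.supportKernel κ μ s j * X.game.lyapunov κ H μ z j)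
    (hdclose : |LP| * d ≤ p₀ / 2) (hk : n₀ = k * X.T) (hT : 1 ≤ X.T)
    (hd : ∀ x y, ∀ l < X.T, l1Dist (X.mfAt x y (n₀ + l)) (X.mfAt x y n₀) ≤ d)
    (hp : 2 + 12 / (1 - X.game.ρ) ≤ p) (hσ : 2 * p ≤ X.minProb * κ ^ H * X.sched.cβ)
    (ht₀ : 2 ≤ t₀) (hpt : p + 1 ≤ t₀)
    (hb : ∀ j ≥ t₀, stepSize X.sched.cβ X.sched.ν j ≤ 1 / (2 * (1 + F)))
    (hβ : 0 < X.sched.cβ) (hM₀ : 0 ≤ M₀)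
    (hQ : ∀ x y, ∀ l ≤ X.T, ‖(X.mem x y (n₀ + l)).Q‖ ≤ M₀ * (1 + ‖(X.mem x y n₀).Q‖))
    (hJ : 3 * Fintype.card (S × A) ≤ 2 ^ J)
    (hC₁ : C₁ = (2 * M₀ + 2 * (1 + F)) *
      √(2 * (X.sched.cβ ^ 2 / (2 * X.sched.ν - 1)) * ((J : ℝ) + 2)))
    (hc : 0 < c) (hcC : c ≤ 1 / (2 * C₁))
    (hcu : c ≤ √(Real.log 2) * envelope (X.sched.ν - 1 / 2) t₀) (hδ : δ ∈ Set.Ioo (0 : ℝ) 1) :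
    1 - δ ≤ ℙ.real {ω | X.qError s a (k + 1) ω ≤
      (|LR| + |LP| / (1 - X.game.ρ)) * d / (1 - X.game.ρ) +
        2 / (1 - X.game.ρ) * (6 * ((M₀ + 1 / (1 - X.game.ρ)) / c) + 7 * C₁) *
          (1 + ‖X.Qtab s a (k + 1) 1 ω‖) *
          (√(Real.log (2 * X.T / δ)) * (X.T : ℝ) ^ (1 / 2 - X.sched.ν))} := by
  have hν := hX.adm.ν_mem
  have hq : 0 < 2 * X.sched.ν - 1 := by linarith [hν.1]
  have hT' : (1 : ℝ) ≤ X.T := by exact_mod_cast hT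
  have hδ0 := hδ.1
  -- This lower bound on L lets c be chosen independently of T and δ.
  have hL2 : Real.log 2 ≤ Real.log (2 * X.T / δ) := by
    refine Real.log_le_log (by norm_num) ?_
    rw [le_div_iff₀ hδ0]
    nlinarith [hδ.2]
  have hlog2 : 0 < Real.log 2 := Real.log_pos (by norm_num)
  set L := Real.log (2 * X.T / δ) with hL
  have hL0 : 0 < L := hlog2.trans_le hL2
  have hκ0 : 0 ≤ κ := hκ ▸ mul_nonneg hX.minProb_mem.1.le (by linarith)
  set B := X.sched.cβ ^ 2 / (2 * X.sched.ν - 1) with hB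
  have hB0 : 0 < B := by positivity
  set c₀ := 2 * M₀ + 2 * (1 + F) with hc₀
  have hc₀0 : 0 < c₀ := by positivity
  have hC₁0 : 0 < C₁ := by rw [hC₁]; positivity
  have hst : X.st n₀ = 1 := by
    have := X.st_add hk (j := 0) (by omega)
    simpa using this
  have hbad := hrun.measure_exists_window_ge_le hX.isStochastic (n₀ := n₀) (N := X.T - 1)
    (g := X.increment κ H n₀) (b := stepSize X.sched.cβ X.sched.ν)
    (U := envelope (X.sched.ν - 1 / 2)) (c := c₀) (B := B) (K := (J : ℝ) + 2) (L := L) hc₀0 hB0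
    (by positivity) (stepSize_pos hβ) (envelope_pos _) (fun m n hmn => sum_stepSize_sq_le hν hmn)
    (fun i l _ => X.increment_dependsOnPrefix κ H n₀ i l)
    (fun i l hl x y => hX.abs_increment_le hκ0 hF hM₀ hβ
      (fun x y z s => (hlyap _ (hX.mfAt_mem_net x y hst) z s).1)
      (fun x y => hQ x y l (by omega)) i x y)
    (fun i l _ x y => hX.stepMean_increment κ H n₀ i l x y)
  have hcard : Fintype.card ((S × A) ⊕ (S × A) ⊕ (S × A)) = 3 * Fintype.card (S × A) := by
    rw [Fintype.card_sum, Fintype.card_sum]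
    ring
  have hTs : ((X.T - 1 : ℕ) : ℝ) + 1 = X.T := by
    have : X.T - 1 + 1 = X.T := by omega
    exact_mod_cast this
  rw [hcard, hTs] at hbad
  refine one_sub_le_measureReal_of_compl_subset (fun ω hω => ?_)
    (hbad.trans (card_mul_exp_le hT' hδ hJ))
  by_contra hgood
  apply hω
  have hgood' : ∀ i m n, m ≤ n → n ≤ X.T - 1 →
      ∑ l ∈ Finset.Ico m n, X.increment κ H n₀ i l (fun m => s m ω) (fun m => a m ω) ≤
        C₁ * (√L * envelope (X.sched.ν - 1 / 2) m) := by
    intro i m n hmn hn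
    by_contra h
    refine hgood ⟨i, m, n, hmn, hn, le_of_lt (lt_of_le_of_lt (le_of_eq ?_) (not_le.1 h))⟩
    rw [hC₁, ← mul_assoc (2 * B), Real.sqrt_mul (by positivity)]
    ring
  clear hgood
  have hq1 : 0 < 1 + ‖(X.mem (fun m => s m ω) (fun m => a m ω) n₀).Q‖ := by positivity
  have key := hX.error_le_of_windows hP hR hp₀ hpos hκ hF hlyap hdclose hk hT hd hp hσ ht₀ hpt hb hβ
    hM₀ hQ hC₁0 hc hcC (Real.sqrt_nonneg L) (hcu.trans (mul_le_mul_of_nonneg_right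
      (Real.sqrt_le_sqrt hL2) (envelope_pos _ _).le)) (x := fun m => s m ω) (y := fun m => a m ω)
    ?_ ?_
  · have e1 : envelope (X.sched.ν - 1 / 2) (X.T - 1) = (X.T : ℝ) ^ (1 / 2 - X.sched.ν) := by
      unfold envelope
      rw [hTs, neg_sub]
    rw [e1] at key
    simp only [Set.mem_ofPred_eq, qError, Qtab, meanField, clock, Nat.add_sub_cancel, ← hk,
      Nat.sub_self, add_zero]
    exact key
  · intro z b m n hmn hn
    have h1 := hgood' (Sum.inl (z, b)) m n hmn hn
    have h2 := hgood' (Sum.inr (Sum.inl (z, b))) m n hmn hn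
    have e : ∑ l ∈ Finset.Ico m n, stepSize X.sched.cβ X.sched.ν l *
        X.noise z b (n₀ + l) (fun m => s m ω) (fun m => a m ω) =
        (1 + ‖(X.mem (fun m => s m ω) (fun m => a m ω) n₀).Q‖) * ∑ l ∈ Finset.Ico m n,
          X.increment κ H n₀ (Sum.inl (z, b)) l (fun m => s m ω) (fun m => a m ω) := by
      rw [Finset.mul_sum]
      refine Finset.sum_congr rfl fun l _ => ?_
      simp only [increment]
      field_simp
    have e2 : ∑ l ∈ Finset.Ico m n,
        X.increment κ H n₀ (Sum.inr (Sum.inl (z, b))) l (fun m => s m ω) (fun m => a m ω) =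
        -∑ l ∈ Finset.Ico m n,
          X.increment κ H n₀ (Sum.inl (z, b)) l (fun m => s m ω) (fun m => a m ω) := by
      rw [← Finset.sum_neg_distrib]
      refine Finset.sum_congr rfl fun l _ => ?_
      simp only [increment, neg_mul]
    rw [e2] at h2
    rw [e, abs_mul, abs_of_pos hq1, mul_comm C₁, mul_assoc]
    exact mul_le_mul_of_nonneg_left (abs_le.2 ⟨by linarith, h1⟩) hq1.le
  · intro z b m n hmn hn
    have h1 := hgood' (Sum.inr (Sum.inr (z, b))) m n hmn hn
    simp only [increment, neg_mul, Finset.sum_neg_distrib] at h1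
    linarith

end Sandbox

end HighProbability

/-! ### Choice of constants and the main theorem -/

section Main

theorem exists_forall_two_rpow_le {ε : ℝ} (hε : 0 < ε) :
    ∃ ζ₀ : ℝ, 2 ≤ ζ₀ ∧ ∀ ζ ≥ ζ₀, (2 : ℝ) ^ (1 - ζ) ≤ ε := by
  obtain ⟨n, hn⟩ := exists_pow_lt_of_lt_one hε (show (1 / 2 : ℝ) < 1 by norm_num)
  refine ⟨(n : ℝ) + 2, by linarith [Nat.cast_nonneg (α := ℝ) n], fun ζ hζ => ?_⟩
  calc (2 : ℝ) ^ (1 - ζ) ≤ (2 : ℝ) ^ (-(n : ℝ)) :=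
        Real.rpow_le_rpow_of_exponent_le (by norm_num) (by linarith)
    _ = (1 / 2) ^ n := by rw [Real.rpow_neg (by norm_num), Real.rpow_natCast]; simp
    _ ≤ ε := hn.le

variable {S A : Type*} [Fintype S] [DecidableEq S] [Nonempty S] [Fintype A] [DecidableEq A]
  [Nonempty A]

theorem Sandbox.Regular.one_add_norm_Qtab_le {X : Sandbox S A} {net : Finset (S → ℝ)}
    (hX : X.Regular net) (hβ : 0 < X.sched.cβ) {t₀ : ℕ}
    (ht₀ : ∀ j ≥ t₀, stepSize X.sched.cβ X.sched.ν j ≤ 1) {M : ℝ}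
    (hM : M = 1 + (1 + 2 * X.sched.cβ) ^ t₀ / (1 - X.game.ρ)) (x : ℕ → S) (y : ℕ → A) (k : ℕ) :
    1 + ‖(X.mem x y (k * X.T)).Q‖ ≤ M ^ k * (1 + ‖X.init.Q‖) := by
  have h1ρ : 0 < 1 - X.game.ρ := by linarith [X.game.ρ_mem.2]
  have hM0 : 0 ≤ M := by rw [hM]; positivity
  induction k with
  | zero => simp [mem]
  | succ k ih =>
    have h1 := hX.norm_Q_le hβ ht₀ x y (n₀ := k * X.T) rfl le_rfl
    have h2 : 1 + ‖(X.mem x y ((k + 1) * X.T)).Q‖ ≤ M * (1 + ‖(X.mem x y (k * X.T)).Q‖) := by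
      rw [add_mul k, one_mul, hM, add_mul, one_mul]
      linarith [norm_nonneg (X.mem x y (k * X.T)).Q]
    calc _ ≤ M * (1 + ‖(X.mem x y (k * X.T)).Q‖) := h2
      _ ≤ M * (M ^ k * (1 + ‖X.init.Q‖)) := mul_le_mul_of_nonneg_left ih hM0
      _ = _ := by ring

/-- The core result for genuine parameters. The deterministic bound on the error is kept alongside
the probabilistic one because small ζ is handled by it alone. -/
theorem exists_error_bound_of_pos (G : MeanFieldGame S A) (LP LR : ℝ) (hP : G.KernelLipschitz LP)
    (hR : G.RewardLipschitz LR) (net : Finset (S → ℝ)) (hnet : ∀ μ ∈ net, μ ∈ stdSimplex ℝ S)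
    (hcomm : G.Communicating net) {cπ ψ : ℝ} (hcπ : 0 < cπ) (hψ : 0 < ψ) :
    ∃ σ ∈ Set.Ioo (0 : ℝ) 1, ∃ ζ₀ D : ℝ, 1 < ζ₀ ∧ 0 < D ∧
      ∀ ν ∈ Set.Ioc (1 / 2 : ℝ) 1, ∀ cβ : ℝ, 1 / (σ * (1 - √G.ρ)) ≤ cβ →
        ∃ C M : ℝ, 0 < C ∧ 1 ≤ M ∧
          ∀ X : Sandbox S A, X.game = G → X.Regular net → X.sched.cπ = cπ → X.sched.ψ = ψ →
            X.sched.ν = ν → X.sched.cβ = cβ → 1 ≤ X.T →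
          ∀ (Ω : Type*) [MeasurableSpace Ω] (ℙ : Measure Ω) [IsProbabilityMeasure ℙ]
            (s : ℕ → Ω → S) (a : ℕ → Ω → A), X.IsRun ℙ s a → ∀ k : ℕ,
            (∀ ω, 1 + ‖X.Qtab s a (k + 1) 1 ω‖ ≤ M ^ k * (1 + ‖X.init.Q‖)) ∧
            (∀ ω, X.qError s a (k + 1) ω ≤ C * (1 + ‖X.Qtab s a (k + 1) 1 ω‖)) ∧
            (ζ₀ ≤ X.sched.ζ → ∀ δ ∈ Set.Ioo (0 : ℝ) 1,
              1 - δ ≤ ℙ.real {ω | X.qError s a (k + 1) ω ≤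
                C * (1 + ‖X.Qtab s a (k + 1) 1 ω‖) *
                  (√(Real.log (2 * X.T / δ)) * (X.T : ℝ) ^ (1 / 2 - ν))
                  + D * (2 : ℝ) ^ (1 - X.sched.ζ)}) := by
  have hρ := G.ρ_mem
  have h1ρ : 0 < 1 - G.ρ := by linarith [hρ.2]
  have hsq1 : 0 ≤ √G.ρ := Real.sqrt_nonneg _
  have hsq2 : √G.ρ < 1 := by rw [Real.sqrt_lt' one_pos]; simpa using hρ.2
  obtain ⟨p₀, hp₀, hp₀'⟩ := exists_pos_le_of_pos fun i : net × S × A × S =>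
    G.P i.2.1 i.2.2.1 i.1.1 i.2.2.2
  have hpos : ∀ μ ∈ net, ∀ s a s', 0 < G.P s a μ s' → p₀ ≤ G.P s a μ s' :=
    fun μ hμ s a s' h => hp₀' (⟨μ, hμ⟩, s, a, s') h
  have hA : (0 : ℝ) < Fintype.card A := by exact_mod_cast Fintype.card_pos
  set π₀ := cπ * ψ / (Fintype.card A : ℝ) with hπ₀
  have hπ₀pos : 0 < π₀ := by positivity
  set κ := π₀ * (p₀ / 2) with hκ
  have hκpos : 0 < κ := by positivity
  obtain ⟨H, F, hF, hlyap⟩ := hcomm.exists_lyapunov hnet hκpos.le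
  set p := 2 + 12 / (1 - G.ρ) with hp
  have hppos : 0 < p := by positivity
  set σ₁ := π₀ * κ ^ H with hσ₁
  have hσ₁pos : 0 < σ₁ := by positivity
  -- Chosen so that a mean-field drift of 4 · 2^{1-ζ} changes the kernel by at most p₀/2; adding 1
  -- to |LP| avoids a zero denominator.
  obtain ⟨ζ₀, hζ₀, hζ₀'⟩ := exists_forall_two_rpow_le
    (show 0 < p₀ / 2 / (4 * (|LP| + 1)) by positivity)
  have hσpos : 0 < min (1 / 2) (σ₁ / (2 * p)) := by positivity
  -- The minimum with 1/2 only keeps σ below 1; the other entry turns the lower bound on c_β into 2p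
  -- ≤ σ₁ c_β, using 1 - √ρ ≤ 1. The summand 1 in D keeps it positive when the Lipschitz constants
  -- vanish.
  refine ⟨min (1 / 2) (σ₁ / (2 * p)), ⟨hσpos, lt_of_le_of_lt (min_le_left _ _) (by norm_num)⟩, ζ₀,
    (|LR| + |LP| / (1 - G.ρ)) * 4 / (1 - G.ρ) + 1, by linarith, by positivity,
    fun ν hν cβ hcβ => ?_⟩
  have hσ : 2 * p ≤ σ₁ * cβ := by
    have h1 : 2 * p / σ₁ ≤ cβ := by
      refine le_trans ?_ hcβ
      rw [div_le_div_iff₀ hσ₁pos (mul_pos hσpos (by linarith)), one_mul]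
      have h2 : min (1 / 2) (σ₁ / (2 * p)) * (1 - √G.ρ) ≤ σ₁ / (2 * p) :=
        (mul_le_of_le_one_right hσpos.le (by linarith)).trans (min_le_right _ _)
      calc _ ≤ 2 * p * (σ₁ / (2 * p)) := mul_le_mul_of_nonneg_left h2 (by positivity)
        _ = σ₁ := by field_simp
    rw [div_le_iff₀ hσ₁pos] at h1
    linarith
  have hβ : 0 < cβ := by
    by_contra h
    nlinarith [mul_nonneg hσ₁pos.le (neg_nonneg.2 (not_lt.1 h))]
  obtain ⟨t₁, ht₁⟩ := exists_stepSize_le (show 0 < ν by linarith [hν.1]) cβ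
    (show 0 < 1 / (2 * (1 + F)) by positivity)
  set t₀ := max t₁ (max 2 ⌈p + 1⌉₊) with ht₀
  have hb : ∀ j ≥ t₀, stepSize cβ ν j ≤ 1 / (2 * (1 + F)) := fun j hj =>
    ht₁ j ((le_max_left _ _).trans hj)
  have hb1 : ∀ j ≥ t₀, stepSize cβ ν j ≤ 1 := fun j hj => (hb j hj).trans (by
    rw [div_le_one (by positivity)]
    linarith)
  have ht₀2 : 2 ≤ t₀ := (le_max_left _ _).trans (le_max_right _ _)
  have hpt : p + 1 ≤ t₀ := (Nat.le_ceil _).trans (by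
    exact_mod_cast (le_max_right _ _).trans (le_max_right _ _))
  set M₀ := (1 + 2 * cβ) ^ t₀ / (1 - G.ρ) with hM₀
  have hM₀pos : 0 < M₀ := by positivity
  -- Any J with 3 |S × A| ≤ 2^J works, and n ≤ 2^n.
  set J := 3 * Fintype.card (S × A) with hJ
  have hq : 0 < 2 * ν - 1 := by linarith [hν.1]
  set C₁ := (2 * M₀ + 2 * (1 + F)) * √(2 * (cβ ^ 2 / (2 * ν - 1)) * ((J : ℝ) + 2)) with hC₁
  have hC₁pos : 0 < C₁ := by positivity
  have hlog2 : 0 < Real.log 2 := Real.log_pos (by norm_num)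
  have henv := envelope_pos (ν - 1 / 2) t₀
  set c := min (1 / (2 * C₁)) (√(Real.log 2) * envelope (ν - 1 / 2) t₀) with hc
  have hcpos : 0 < c := by positivity
  set K := 2 / (1 - G.ρ) * (6 * ((M₀ + 1 / (1 - G.ρ)) / c) + 7 * C₁) with hK
  have hKpos : 0 < K := by positivity
  refine ⟨K + (M₀ + 1 / (1 - G.ρ)), 1 + M₀, by positivity, by linarith, ?_⟩
  rintro X rfl hX hXπ hXψ hXν hXβ hT Ω _ ℙ _ s a hrun k
  have hmin : X.minProb = π₀ := by rw [Sandbox.minProb, hXπ, hXψ]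
  have hQ : ∀ x y, ∀ l ≤ X.T, ‖(X.mem x y (k * X.T + l)).Q‖ ≤
      M₀ * (1 + ‖(X.mem x y (k * X.T)).Q‖) := by
    intro x y l hl
    have := hX.norm_Q_le (t₀ := t₀) (by rw [hXβ]; exact hβ) (by rw [hXβ, hXν]; exact hb1) x y
      (n₀ := k * X.T) rfl hl
    rwa [hXβ] at this
  refine ⟨fun ω => ?_, fun ω => ?_, fun hζ δ hδ => ?_⟩
  · have := hX.one_add_norm_Qtab_le (t₀ := t₀) (by rw [hXβ]; exact hβ)
      (by rw [hXβ, hXν]; exact hb1) rfl (fun n => s n ω) (fun n => a n ω) k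
    rw [hXβ] at this
    simpa [Sandbox.Qtab, Sandbox.clock] using this
  · have h1 := hQ (fun n => s n ω) (fun n => a n ω) (X.T - 1) (by omega)
    have h2 := X.game.norm_optQ_le (hX.mfAt_mem (fun n => s n ω) (fun n => a n ω) (k * X.T))
    simp only [Sandbox.qError, Sandbox.Qtab, Sandbox.meanField, Sandbox.clock, Nat.add_sub_cancel,
      Nat.sub_self, add_zero]
    set q := ‖(X.mem (fun n => s n ω) (fun n => a n ω) (k * X.T)).Q‖
    have hq0 : 0 ≤ q := norm_nonneg _
    have h3 : 1 / (1 - X.game.ρ) ≤ 1 / (1 - X.game.ρ) * (1 + q) :=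
      le_mul_of_one_le_right (by positivity) (by linarith)
    have h4 : 0 ≤ K * (1 + q) := by positivity
    refine (norm_sub_le _ _).trans ((add_le_add h1 h2).trans ?_)
    linarith
  · have hzle := hζ₀' _ hζ
    have h2pos : (0 : ℝ) < (2 : ℝ) ^ (1 - X.sched.ζ) := by positivity
    have hdclose : |LP| * (4 * (2 : ℝ) ^ (1 - X.sched.ζ)) ≤ p₀ / 2 := by
      rw [le_div_iff₀ (by positivity)] at hzle
      linarith
    have key := hX.measure_error_ge hrun (d := 4 * (2 : ℝ) ^ (1 - X.sched.ζ)) (p₀ := p₀) (κ := κ)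
      (F := F) (p := p) (M₀ := M₀) (C₁ := C₁) (c := c) (δ := δ) (H := H) (t₀ := t₀) (k := k)
      (n₀ := k * X.T) (J := J) hP hR hp₀ hpos
      (by rw [hmin]) hF hlyap hdclose rfl hT
      (fun x y l hl => hX.l1Dist_mfAt_le x y (by linarith) rfl hl) le_rfl
      (by rw [hmin, hXβ]; exact hσ) ht₀2 hpt (by rw [hXβ, hXν]; exact hb) (by rw [hXβ]; exact hβ)
      hM₀pos.le hQ Nat.lt_two_pow_self.le (by rw [hXβ, hXν]) hcpos (min_le_left _ _)
      (by rw [hXν]; exact min_le_right _ _) hδ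
    rw [hXν] at key
    refine key.trans (measureReal_mono (fun ω hω => ?_) (measure_ne_top _ _))
    simp only [Set.mem_ofPred_eq] at hω ⊢
    refine hω.trans ?_
    set q := ‖X.Qtab s a (k + 1) 1 ω‖
    have hq0 : 0 ≤ q := norm_nonneg _
    have hw : 0 ≤ √(Real.log (2 * X.T / δ)) * (X.T : ℝ) ^ (1 / 2 - ν) := by positivity
    have h5 : 0 ≤ (M₀ + 1 / (1 - X.game.ρ)) * (1 + q) *
      (√(Real.log (2 * X.T / δ)) * (X.T : ℝ) ^ (1 / 2 - ν)) := by positivity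
    have h6 : (|LR| + |LP| / (1 - X.game.ρ)) * (4 * (2 : ℝ) ^ (1 - X.sched.ζ)) / (1 - X.game.ρ) =
      (|LR| + |LP| / (1 - X.game.ρ)) * 4 / (1 - X.game.ρ) * (2 : ℝ) ^ (1 - X.sched.ζ) := by ring
    rw [h6, add_mul _ (1 : ℝ)]
    simp only [add_mul] at h5 ⊢
    linarith

end Main

theorem mainTheorem3 {S A : Type*} [Fintype S] [DecidableEq S] [Nonempty S]
    [Fintype A] [DecidableEq A] [Nonempty A]
    (G : MeanFieldGame S A) (LP LR : ℝ) (hP : G.KernelLipschitz LP) (hR : G.RewardLipschitz LR)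
    (εnet : ℝ) (net : Finset (S → ℝ)) (hnet : IsEpsNet εnet net) (hcomm : G.Communicating net)
    (cμ cπ ψ : ℝ) :
    ∃ σ ∈ Set.Ioo (0 : ℝ) 1, ∃ ζ₀ D : ℝ, 1 < ζ₀ ∧ 0 < D ∧
      ∀ ν cβ : ℝ, 1 / (σ * (1 - √G.ρ)) ≤ cβ →
        ∃ C M : ℝ, 0 < C ∧ 1 ≤ M ∧
          ∀ X : Sandbox S A, X.game = G → X.sched.Admissible →
            X.sched.cμ = cμ → X.sched.cπ = cπ → X.sched.ψ = ψ →
            X.sched.ν = ν → X.sched.cβ = cβ →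
            IsNetProjection net X.proj → X.p₁ ∈ stdSimplex ℝ S → X.init.Valid → 1 ≤ X.T →
          ∀ (Ω : Type*) [MeasurableSpace Ω] (ℙ : Measure Ω) [IsProbabilityMeasure ℙ]
            (s : ℕ → Ω → S) (a : ℕ → Ω → A), X.IsRun ℙ s a →
          ∀ k : ℕ, 1 ≤ k →
            (∀ ω, 1 + ‖X.Qtab s a k 1 ω‖ ≤ M ^ (k - 1) * (1 + ‖X.init.Q‖)) ∧
            ∀ δ ∈ Set.Ioo (0 : ℝ) 1,
              1 - δ ≤ ℙ.real {ω | X.qError s a k ω ≤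
                C * (1 + ‖X.Qtab s a k 1 ω‖) *
                  ((X.T : ℝ) ^ (1 - 2 * ν) + (X.T : ℝ) ^ (1 - X.sched.ζ - ν)
                    + √(Real.log (2 * X.T / δ)) * (X.T : ℝ) ^ (1 / 2 - ν)
                    + (2 : ℝ) ^ (1 - X.sched.ζ))} ∧
              (ζ₀ ≤ X.sched.ζ →
                1 - δ ≤ ℙ.real {ω | X.qError s a k ω ≤
                  C * (1 + ‖X.Qtab s a k 1 ω‖) *
                    ((X.T : ℝ) ^ (1 - 2 * ν) + (X.T : ℝ) ^ (1 - X.sched.ζ - ν)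
                      + √(Real.log (2 * X.T / δ)) * (X.T : ℝ) ^ (1 / 2 - ν))
                    + D * (2 : ℝ) ^ (1 - X.sched.ζ)}) := by
  -- Outside the admissible ranges no instance exists, so arbitrary constants do; the same happens
  -- below for ν.
  by_cases hpos : 0 < cπ ∧ 0 < ψ
  swap
  · refine ⟨1 / 2, by norm_num, 2, 1, by norm_num, by norm_num, fun ν cβ _ =>
      ⟨1, 1, one_pos, le_rfl, ?_⟩⟩
    rintro X - hadm - rfl rfl
    exact absurd ⟨hadm.cπ_mem.1, hadm.ψ_mem.1⟩ hpos
  obtain ⟨σ, hσ, ζ₀, D, hζ₀, hD, h⟩ :=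
    exists_error_bound_of_pos G LP LR hP hR net hnet.1 hcomm hpos.1 hpos.2
  refine ⟨σ, hσ, ζ₀, D, hζ₀, hD, fun ν cβ hcβ => ?_⟩
  by_cases hν : ν ∈ Set.Ioc (1 / 2 : ℝ) 1
  swap
  · refine ⟨1, 1, one_pos, le_rfl, ?_⟩
    rintro X - hadm - - - rfl
    exact absurd hadm.ν_mem hν
  obtain ⟨C, M, hC, hM, h⟩ := h ν hν cβ hcβ
  have hz0 : (0 : ℝ) < (2 : ℝ) ^ (ζ₀ - 1) := by positivity
  -- D absorbs the drift term into the first claim when ζ ≥ ζ₀. The last summand serves ζ < ζ₀,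
  -- where 2^{ζ₀-1} · 2^{1-ζ} ≥ 1 and the deterministic bound suffices.
  refine ⟨C + D + C * (2 : ℝ) ^ (ζ₀ - 1), M, by positivity, hM, ?_⟩
  intro X hG hadm _ hcπ hψ hXν hXβ hproj _ hinit hT Ω _ ℙ _ s a hrun k hk
  have hX : X.Regular net := ⟨hadm, hnet.1, fun μ hμ => (hproj μ hμ).1, hinit⟩
  obtain ⟨k, rfl⟩ : ∃ j, k = j + 1 := ⟨k - 1, by omega⟩
  obtain ⟨h1, h2, h3⟩ := h X hG hX hcπ hψ hXν hXβ hT Ω ℙ s a hrun k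
  refine ⟨h1, fun δ hδ => ?_⟩
  set w := √(Real.log (2 * X.T / δ)) * (X.T : ℝ) ^ (1 / 2 - ν)
  set w₁ := (X.T : ℝ) ^ (1 - 2 * ν)
  set w₂ := (X.T : ℝ) ^ (1 - X.sched.ζ - ν)
  set b := (2 : ℝ) ^ (1 - X.sched.ζ) with hb
  have hw : 0 ≤ w := by positivity
  have hw₁ : 0 ≤ w₁ := by positivity
  have hw₂ : 0 ≤ w₂ := by positivity
  have hb0 : 0 < b := by positivity
  have hle : ∀ q : ℝ, 0 ≤ q → C * (1 + q) * w ≤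
      (C + D + C * (2 : ℝ) ^ (ζ₀ - 1)) * (1 + q) * (w₁ + w₂ + w) := by
    intro q hq
    have h5 : C ≤ C + D + C * (2 : ℝ) ^ (ζ₀ - 1) := by
      linarith [mul_pos hC hz0]
    exact mul_le_mul (mul_le_mul_of_nonneg_right h5 (by linarith)) (by linarith) hw (by positivity)
  refine ⟨?_, fun hζ => ?_⟩
  · rcases le_or_gt ζ₀ X.sched.ζ with hζ | hζ
    · refine (h3 hζ δ hδ).trans (measureReal_mono (fun ω hω => ?_) (measure_ne_top _ _))
      simp only [Set.mem_ofPred_eq] at hω ⊢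
      refine hω.trans ?_
      have hq := norm_nonneg (X.Qtab s a (k + 1) 1 ω)
      rw [mul_add _ (w₁ + w₂ + w) b]
      refine add_le_add (hle _ hq) (mul_le_mul_of_nonneg_right ?_ hb0.le)
      nlinarith [mul_pos hC hz0]
    · have huniv : {ω | X.qError s a (k + 1) ω ≤
          (C + D + C * (2 : ℝ) ^ (ζ₀ - 1)) * (1 + ‖X.Qtab s a (k + 1) 1 ω‖) *
            (w₁ + w₂ + w + b)} = Set.univ := by
        refine Set.eq_univ_of_forall fun ω => ?_
        simp only [Set.mem_ofPred_eq]
        refine (h2 ω).trans ?_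
        have hq := norm_nonneg (X.Qtab s a (k + 1) 1 ω)
        set q := ‖X.Qtab s a (k + 1) 1 ω‖
        have h6 : 1 ≤ (2 : ℝ) ^ (ζ₀ - 1) * b := by
          rw [hb, ← Real.rpow_add (by norm_num)]
          exact Real.one_le_rpow (by norm_num) (by linarith)
        calc C * (1 + q) ≤ C * (1 + q) * ((2 : ℝ) ^ (ζ₀ - 1) * b) :=
              le_mul_of_one_le_right (by positivity) h6
          _ = C * (2 : ℝ) ^ (ζ₀ - 1) * (1 + q) * b := by ring
          _ ≤ _ := by
            refine mul_le_mul (mul_le_mul_of_nonneg_right (by linarith) (by linarith))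
              (by linarith) hb0.le (by positivity)
      rw [huniv]
      simp only [probReal_univ]
      linarith [hδ.1]
  · refine (h3 hζ δ hδ).trans (measureReal_mono (fun ω hω => ?_) (measure_ne_top _ _))
    simp only [Set.mem_ofPred_eq] at hω ⊢
    refine hω.trans ?_
    exact add_le_add (hle _ (norm_nonneg _)) le_rfl
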